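/- Let $1<\alpha\le 2$, $T\ge 1$, $N\ge 0$. For $z\in\mathbb C$ put $z^{<\beta>}=|z|^{\beta-1}\bar z$, applied coordinatewise to vectors. Complex random variables $X_1,\dots,X_n$ are jointly symmetric $\alpha$-stable (S$\alpha$S) if, viewed as a random vector in $\mathbb R^{2n}$, they have the characteristic function $E e^{i\langle t,X\rangle}=\exp\{-\int|\langle t,x\rangle|^\alpha d\Gamma(x)\}$ with a finite symmetric measure $\Gamma=\Gamma_{X_1,\dots,X_n}$ on the unit sphere; for jointly S$\alpha$S $X,Y$ the covariation is $[X,Y]_\alpha=\int x\,y^{<\alpha-1>}d\Gamma_{X,Y}(x,y)$, and $\|X\|_\alpha=[X,X]_\alpha^{1/\alpha}$. A $\mathbb C^T$-valued S$\alpha$S process $\vec Z(\theta)$, $\theta\in[-\pi,\pi]$, with independent increments has an absolutely continuous matrix-valued spectral measure with (integrable, $T\times T$) spectral density $f$ if $$[u^\top(\vec Z(t)-\vec Z(s)),\,v^\top(\vec Z(t)-\vec Z(s))]_\alpha=u^\top\Big(\int_s^t f(\theta)\,d\theta\Big)v^{<\alpha-1>}$$ for all $-\pi\le s\le t\le\pi$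 and $u,v\in\mathbb C^T$. Let $L^\alpha(f)$ be the space of measurable $u:(-\pi,\pi]\to\mathbb C^T$ with $\int_{-\pi}^{\pi} u^\top f u^{<\alpha-1>}d\theta<\infty$, this integral being the $\alpha$-th power of the norm; for $u\in L^\alpha(f)$ the integral $\int u^\top d\vec Z$ is the limit in probability of the integrals of step functions converging to $u$ in $L^\alpha(f)$. A vector-valued S$\alpha$S sequence $\vec\xi(n)$, $n\in\mathbb Z$, is harmonizable with spectral process $\vec Z^\xi$ and spectral density $f$ if $\vec\xi(n)=\int_{-\pi}^{\pi}e^{in\theta}d\vec Z^\xi(\theta)$ and $[\xi_k(n),\xi_l(m)]_\alpha=\int_{-\pi}^{\pi}e^{i(n-m)\theta}f_{kl}(\theta)\,d\theta$ for all $n,m\in\mathbb Z$ and all $k,l$. Let $\vec\xi$ and $\vec\eta$ be mutually independent $\mathbb C^T$-valued harmonizable S$\alpha$S sequences with spectral processes $\vec Z^\xi,\vec Z^\eta$ and spectral densities $f,g$ such that $f(\theta)+g(\theta)$ is positive definite for almost all $\theta$ and $$\int_{-\pi}^{\pi}\mathrm{Tr}\big[(f(\theta)+g(\theta))^{-1/(\alpha-1)}\big]d\theta<\infty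 .$$ Let $\vec a(0),\dots,\vec a(N)\in\mathbb C^T$, $A_N\vec\xi=\sum_{j=0}^N\vec a(j)^\top\vec\xi(j)$ and $A_N(e^{i\theta})=\sum_{j=0}^N\vec a(j)e^{ij\theta}$. Let $H^N(\xi+\eta)$ be the $\|\cdot\|_\alpha$-closed linear span of the variables $\xi_k(j)+\eta_k(j)$, $1\le k\le T$, $j\in\mathbb Z\setminus\{0,\dots,N\}$, and let $L_N^\alpha(f+g)$ be the closed subspace of $L^\alpha(f+g)$ generated by the functions $e^{ij\theta}\delta_k$ for the same $j,k$, where $\delta_k$ is the $k$-th coordinate vector. Then: 1. There is an almost surely unique optimal linear estimate $\hat A_N\vec\xi$, that is, an element of $H^N(\xi+\eta)$ at the least $\|\cdot\|_\alpha$-distance from $A_N\vec\xi$, and it has the form $$\hat A_N\vec\xi=\int_{-\pi}^{\pi}h(\theta)^\top\big(d\vec Z^\xi(\theta)+d\vec Z^\eta(\theta)\big),\qquad h\in L_N^\alpha(f+g).$$ 2. There are $\vec c(0),\dots,\vec c(N)\in\mathbb C^T$ such that, with $C_N(e^{i\theta})=\sum_{j=0}^N\vec c(j)e^{-ij\theta}$,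 $$f(\theta)\big(A_N(e^{i\theta})-h(\theta)\big)^{<\alpha-1>}-g(\theta)\,h(\theta)^{<\alpha-1>}=C_N(e^{i\theta})\quad\text{for almost all }\theta,$$ and $h$ is integrable with $$\int_{-\pi}^{\pi}e^{-ik\theta}h(\theta)\,d\theta=0,\qquad k=0,1,\dots,N.$$ These relations determine $h$ and the coefficients: if $h'\in L^\alpha(f+g)$ and $\vec c\,'(0),\dots,\vec c\,'(N)$ satisfy them too, then $h'=h$ almost everywhere and $\vec c\,'=\vec c$. 3. The error is $$\|A_N\vec\xi-\hat A_N\vec\xi\|_\alpha^\alpha=\int_{-\pi}^{\pi}(A_N(e^{i\theta})-h(\theta))^\top f(\theta)(A_N(e^{i\theta})-h(\theta))^{<\alpha-1>}d\theta+\int_{-\pi}^{\pi}h(\theta)^\top g(\theta)\,h(\theta)^{<\alpha-1>}d\theta,$$ where both integrals converge; for $T=1$ it equals $\int_{-\pi}^{\pi}|A_N(e^{i\theta})-h(\theta)|^\alpha f(\theta)\,d\theta+\int_{-\pi}^{\pi}|h(\theta)|^\alpha g(\theta)\,d\theta$. -/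

import Mathlib

open MeasureTheory ProbabilityTheory Filter Topology Set
open scoped ENNReal Matrix ComplexOrder

noncomputable section

namespace HSaS

/-- Lebesgue measure on `(-π, π]`. -/
def lebPi : Measure ℝ := volume.restrict (Ioc (-Real.pi) Real.pi)

/-- The signed power `z^{<β>} = |z|^{β-1} * conj z`. -/
def spow (β : ℝ) (z : ℂ) : ℂ := ((‖z‖ ^ (β - 1) : ℝ) : ℂ) * (starRingEnd ℂ) z

/-- The signed power applied to each coordinate of a vector. -/
def vspow {T : ℕ} (β : ℝ) (v : Fin T → ℂ) : Fin T → ℂ := fun k => spow β (v k)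

/-- The expression `u^⊤ M v^{<α-1>}`. -/
def sform {T : ℕ} (α : ℝ) (M : Matrix (Fin T) (Fin T) ℂ) (u v : Fin T → ℂ) : ℂ :=
  u ⬝ᵥ (M *ᵥ vspow (α - 1) v)

/-- The Euclidean inner product of `ℂⁿ = ℝ²ⁿ`. -/
def realPairing {n : ℕ} (t x : Fin n → ℂ) : ℝ := (∑ j, (starRingEnd ℂ) (t j) * x j).re

section Stable

variable {Ω : Type*} [MeasurableSpace Ω]

/-- `Γ` is a spectral measure of the complex random vector `X = (X₁, …, Xₙ)`, regarded as a real
random vector of dimension `2n`: a finite symmetric measure on the unit sphere with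
`E exp (i ⟨t, X⟩) = exp (- ∫ |⟨t, x⟩|^α dΓ(x))`. -/
structure IsSpectralMeasure (α : ℝ) (P : Measure Ω) {n : ℕ} (X : Fin n → Ω → ℂ)
    (Γ : Measure (EuclideanSpace ℂ (Fin n))) : Prop where
  finite : IsFiniteMeasure Γ
  sphere : Γ (Metric.sphere 0 1)ᶜ = 0
  symmetric : Γ.map (fun x => -x) = Γ
  charFun : ∀ t : Fin n → ℂ,
    ∫ ω, Complex.exp (Complex.I * (realPairing t (fun j => X j ω) : ℂ)) ∂P
      = Complex.exp (-((∫ x, |realPairing t (fun j => x j)| ^ α ∂Γ : ℝ) : ℂ))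

/-- The complex random variables `X₁, …, Xₙ` are jointly symmetric `α`-stable. -/
def JointlySaS (α : ℝ) (P : Measure Ω) {n : ℕ} (X : Fin n → Ω → ℂ) : Prop :=
  (∀ j, AEMeasurable (X j) P) ∧ ∃ Γ, IsSpectralMeasure α P X Γ

open Classical in
/-- The covariation `[X, Y]_α = ∫ x * y^{<α-1>} dΓ_{X,Y}(x, y)` of jointly symmetric `α`-stable
complex random variables. -/
def covariation (α : ℝ) (P : Measure Ω) (X Y : Ω → ℂ) : ℂ :=
  if h : ∃ Γ, IsSpectralMeasure α P ![X, Y] Γ then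
    ∫ x, x 0 * spow (α - 1) (x 1) ∂h.choose
  else 0

/-- The norm `‖X‖_α = [X, X]_α^{1/α}` of a symmetric `α`-stable complex random variable. -/
def alphaNorm (α : ℝ) (P : Measure Ω) (X : Ω → ℂ) : ℝ := (covariation α P X X).re ^ (1 / α)

/-- `Y` belongs to the closure, in the norm `‖·‖_α`, of the linear span of the family `S`. -/
def MemClosedSpan (α : ℝ) (P : Measure Ω) (S : Set (Ω → ℂ)) (Y : Ω → ℂ) : Prop :=
  ∃ y : ℕ → Ω → ℂ, (∀ n, y n ∈ Submodule.span ℂ S) ∧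
    (∀ n, JointlySaS α P ![Y - y n]) ∧
    Tendsto (fun n => alphaNorm α P (Y - y n)) atTop (𝓝 0)

/-- `Xhat` is a projection of `X` on the closed linear span of the family `S`: an element of this
span at the least `‖·‖_α`-distance from `X`. -/
structure IsProjection (α : ℝ) (P : Measure Ω) (S : Set (Ω → ℂ)) (X Xhat : Ω → ℂ) : Prop where
  mem : MemClosedSpan α P S Xhat
  stable : JointlySaS α P ![X - Xhat]
  le : ∀ Y, MemClosedSpan α P S Y → alphaNorm α P (X - Xhat) ≤ alphaNorm α P (X - Y)

end Stable

section Lalpha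

variable {T : ℕ}

/-- `∫ u(θ)^⊤ f(θ) u(θ)^{<α-1>} dθ`, the `α`-th power of the norm of `L^α(f)`. -/
def lpow (α : ℝ) (f : ℝ → Matrix (Fin T) (Fin T) ℂ) (u : ℝ → Fin T → ℂ) : ℝ≥0∞ :=
  ∫⁻ θ, ENNReal.ofReal (sform α (f θ) (u θ) (u θ)).re ∂lebPi

/-- Membership in `L^α(f)`. -/
def MemLalpha (α : ℝ) (f : ℝ → Matrix (Fin T) (Fin T) ℂ) (u : ℝ → Fin T → ℂ) : Prop :=
  AEStronglyMeasurable u lebPi ∧ lpow α f u < ∞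

/-- The function `e^{ijθ} δ_k`. -/
def expo (j : ℤ) (k : Fin T) : ℝ → Fin T → ℂ :=
  fun θ => Pi.single k (Complex.exp (Complex.I * j * θ))

/-- Membership in `L_N^α(f)`, the closed subspace of `L^α(f)` generated by the functions
`e^{ijθ} δ_k`, `j ∈ ℤ \ {0, …, N}`. -/
def MemLalphaN (α : ℝ) (f : ℝ → Matrix (Fin T) (Fin T) ℂ) (N : ℕ) (u : ℝ → Fin T → ℂ) : Prop :=
  MemLalpha α f u ∧
    ∃ p : ℕ → ℝ → Fin T → ℂ,
      (∀ n, p n ∈ Submodule.span ℂ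
        {q | ∃ (j : ℤ) (k : Fin T), j ∉ Icc (0 : ℤ) N ∧ q = expo j k}) ∧
      Tendsto (fun n => lpow α f (u - p n)) atTop (𝓝 0)

/-- A step function `∑ᵢ c i 1_{(s i, t i]}` on `[-π, π]` with values in `ℂ^T`. -/
structure StepFun (T : ℕ) where
  m : ℕ
  s : Fin m → ℝ
  t : Fin m → ℝ
  c : Fin m → Fin T → ℂ
  s_mem : ∀ i, s i ∈ Icc (-Real.pi) Real.pi
  t_mem : ∀ i, t i ∈ Icc (-Real.pi) Real.pi
  le : ∀ i, s i ≤ t i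

/-- The function on `ℝ` given by a step function. -/
def StepFun.toFun (φ : StepFun T) : ℝ → Fin T → ℂ :=
  fun θ => ∑ i, (Ioc (φ.s i) (φ.t i)).indicator (fun _ => φ.c i) θ

/-- The elementary integral `∫ φ(θ)^⊤ dZ(θ)` of a step function. -/
def StepFun.integral {Ω : Type*} (φ : StepFun T) (Z : ℝ → Fin T → Ω → ℂ) : Ω → ℂ :=
  fun ω => ∑ i, ∑ k, φ.c i k * (Z (φ.t i) k ω - Z (φ.s i) k ω)

end Lalpha

section Harmonizable

variable {Ω : Type*} [MeasurableSpace Ω] {T : ℕ}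

/-- `Z` is a vector-valued symmetric `α`-stable process on `[-π, π]` with independent increments. -/
structure IsSaSProcess (α : ℝ) (P : Measure Ω) (Z : ℝ → Fin T → Ω → ℂ) : Prop where
  stable : ∀ (n : ℕ) (t : Fin n → ℝ) (k : Fin n → Fin T),
    (∀ i, t i ∈ Icc (-Real.pi) Real.pi) → JointlySaS α P (fun i => Z (t i) (k i))
  indep : HasIndepIncrements
    (fun (t : Icc (-Real.pi) Real.pi) (ω : Ω) (k : Fin T) => Z t k ω) P

/-- The matrix-valued spectral measure of the process `Z` is finite and absolutely continuous with
density `f`: for every increment `ΔZ = Z(t) - Z(s)` and all `u, v ∈ ℂ^T`,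
`[u^⊤ ΔZ, v^⊤ ΔZ]_α = u^⊤ (∫_s^t f(θ) dθ) v^{<α-1>}`. -/
structure HasSpectralDensity (α : ℝ) (P : Measure Ω) (Z : ℝ → Fin T → Ω → ℂ)
    (f : ℝ → Matrix (Fin T) (Fin T) ℂ) : Prop where
  integrable : ∀ k l, Integrable (fun θ => f θ k l) lebPi
  covariation_eq : ∀ s t, s ∈ Icc (-Real.pi) Real.pi → t ∈ Icc (-Real.pi) Real.pi → s ≤ t →
    ∀ u v : Fin T → ℂ,
      covariation α P (fun ω => ∑ k, u k * (Z t k ω - Z s k ω))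
          (fun ω => ∑ k, v k * (Z t k ω - Z s k ω))
        = sform α (Matrix.of fun k l => ∫ θ in s..t, f θ k l) u v

/-- `I` is the stochastic integral `∫ u(θ)^⊤ dZ(θ)` of `u ∈ L^α(f)`, where `f` is the spectral
density of `Z`: the limit in probability of the elementary integrals of step functions that
converge to `u` in `L^α(f)`. -/
def IsStochIntegral (α : ℝ) (P : Measure Ω) (Z : ℝ → Fin T → Ω → ℂ)
    (f : ℝ → Matrix (Fin T) (Fin T) ℂ) (u : ℝ → Fin T → ℂ) (I : Ω → ℂ) : Prop :=
  MemLalpha α f u ∧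
    ∃ φ : ℕ → StepFun T,
      Tendsto (fun n => lpow α f (u - (φ n).toFun)) atTop (𝓝 0) ∧
      TendstoInMeasure P (fun n => (φ n).integral Z) atTop I

/-- `ξ` is a vector-valued harmonizable symmetric `α`-stable sequence,
`ξ(n) = ∫ e^{inθ} dZ(θ)`, with absolutely continuous spectral measure of density `f`. -/
structure IsHarmonizable (α : ℝ) (P : Measure Ω) (ξ : ℤ → Fin T → Ω → ℂ)
    (Z : ℝ → Fin T → Ω → ℂ) (f : ℝ → Matrix (Fin T) (Fin T) ℂ) : Prop where
  stable : ∀ (m : ℕ) (n : Fin m → ℤ) (k : Fin m → Fin T),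
    JointlySaS α P (fun i => ξ (n i) (k i))
  process : IsSaSProcess α P Z
  density : HasSpectralDensity α P Z f
  repr : ∀ n k, IsStochIntegral α P Z f (expo n k) (ξ n k)
  covariation_eq : ∀ (n m : ℤ) (k l : Fin T),
    covariation α P (ξ n k) (ξ m l)
      = ∫ θ, Complex.exp (Complex.I * (n - m) * θ) * f θ k l ∂lebPi

/-- The minimality condition `∫ Tr [(f(θ) + g(θ))^{-1/(α-1)}] dθ < ∞`; the negative power requires
`f(θ) + g(θ)` to be positive definite for almost all `θ`. -/
def Minimality (α : ℝ) (f g : ℝ → Matrix (Fin T) (Fin T) ℂ) : Prop :=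
  (∀ᵐ θ ∂lebPi, (f θ + g θ).PosDef) ∧
    Integrable (fun θ => (cfc (fun x : ℝ => x ^ (-1 / (α - 1))) (f θ + g θ)).trace) lebPi

/-- The functional `A_N ξ = ∑_{j=0}^N a(j)^⊤ ξ(j)`. -/
def functional {N : ℕ} (a : Fin (N + 1) → Fin T → ℂ) (ξ : ℤ → Fin T → Ω → ℂ) : Ω → ℂ :=
  fun ω => ∑ j, ∑ k, a j k * ξ ((j : ℕ) : ℤ) k ω

/-- The observed random variables `ξ_k(j) + η_k(j)`, `j ∈ ℤ \ {0, …, N}`. -/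
def observations (N : ℕ) (ξ η : ℤ → Fin T → Ω → ℂ) : Set (Ω → ℂ) :=
  {Y | ∃ (j : ℤ) (k : Fin T), j ∉ Icc (0 : ℤ) N ∧ Y = ξ j k + η j k}

/-- `A_N(e^{iθ}) = ∑_{j=0}^N a(j) e^{ijθ}`. -/
def polyA {N : ℕ} (a : Fin (N + 1) → Fin T → ℂ) (θ : ℝ) : Fin T → ℂ :=
  fun k => ∑ j, a j k * Complex.exp (Complex.I * ((j : ℕ) : ℂ) * θ)

/-- `C_N(e^{iθ}) = ∑_{j=0}^N c(j) e^{-ijθ}`. -/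
def polyC {N : ℕ} (c : Fin (N + 1) → Fin T → ℂ) (θ : ℝ) : Fin T → ℂ :=
  fun k => ∑ j, c j k * Complex.exp (-Complex.I * ((j : ℕ) : ℂ) * θ)

/-- The equation `f (A_N - h)^{<α-1>} - g h^{<α-1>} = C_N` for almost all `θ`. -/
def SpectralEquation (α : ℝ) {N : ℕ} (a c : Fin (N + 1) → Fin T → ℂ)
    (f g : ℝ → Matrix (Fin T) (Fin T) ℂ) (h : ℝ → Fin T → ℂ) : Prop :=
  ∀ᵐ θ ∂lebPi, f θ *ᵥ vspow (α - 1) (polyA a θ - h θ) - g θ *ᵥ vspow (α - 1) (h θ) = polyC c θ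

/-- The system `∫ e^{-ijθ} h(θ) dθ = 0`, `j = 0, …, N`. -/
def CoefficientSystem (N : ℕ) (h : ℝ → Fin T → ℂ) : Prop :=
  ∀ (j : Fin (N + 1)) (k : Fin T),
    ∫ θ, Complex.exp (-Complex.I * ((j : ℕ) : ℂ) * θ) * h θ k ∂lebPi = 0

end Harmonizable

end HSaS

end

open HSaS

noncomputable section

namespace HSaS

/-! The problem is a strictly convex minimisation in `L^α(f+g)`, transported to random variables by
an isometry.

Geometry. The covariation satisfies `[Y,Y] + α Re [X,Y] ≤ [X+Y,X+Y]` (`covariation_subgradient`).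
Applied to increments of `Z`, this makes the integrals of `f` over intervals satisfy a subgradient
inequality for the form `u^⊤ M v^{<α-1>}`. For `α < 2` such an inequality kills every off-diagonal
entry, so by differentiation `f(θ)` is almost everywhere positive semidefinite, and diagonal unless
`α = 2` (`stableMatrix_of_subgradient`, `HasSpectralDensity.isDensity`). Hence the form is `∑
|(Bu)_k|^α` for some matrix `B`, and the scalar inequalities for `|z|^α` pass to it: subgradient,
uniform convexity, and a triangle inequality with factor `1 + ε`.

Isometry. The number `‖X‖_α^α` depends only on the law of `X` (`IsSaS.unique`), adds over
independent summands and survives limits in probability along which these numbers converge. So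
stochastic integrals have the norm of their integrands. As signal and noise are independent, the
error of the estimate with characteristic `h` is `∫ (A-h)^⊤ f (A-h)^{<α-1>} + ∫ h^⊤ g h^{<α-1>}`,
the functional `errorPow`. `Corresponds` matches the closed span of the observations with
`L_N^α(f+g)`.

Minimisation. The trace condition and Hölder's inequality embed `L^α(f+g)` in `L¹` (`IsCoercive`),
which yields completeness; uniform convexity then makes minimising sequences Cauchy and minimisers
unique. Stationarity in the directions `e^{ijθ} δ_k`, `j ∉ {0,…,N}`, says that `f (A-h)^{<α-1>} - g
h^{<α-1>}` is an integrable function whose remaining Fourier modes are exactly those of `C_N`. The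
vanishing coefficients of `h` hold for trigonometric polynomials and pass to `L¹` limits.

Converse. For two solutions the integral of `(h'-h)^⊤ (C_N - C_N')` vanishes by the coefficient
system, while its real part is pointwise a sum of two nonnegative terms by monotonicity of the
signed power. Both terms vanish, and strict monotonicity gives `h' = h`. -/

/-! ### Scalar inequalities for the signed power and for `‖z‖ ^ α`. -/

lemma norm_spow {β : ℝ} (hβ : 0 < β) (z : ℂ) : ‖spow β z‖ = ‖z‖ ^ β := by
  rcases eq_or_ne z 0 with rfl | hz
  · simp [spow, Real.zero_rpow hβ.ne']
  · have h : 0 < ‖z‖ := norm_pos_iff.mpr hz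
    rw [spow, norm_mul, RCLike.norm_conj, Complex.norm_real, Real.norm_of_nonneg (by positivity)]
    rw [Real.rpow_sub h, Real.rpow_one]
    field_simp

lemma spow_zero {β : ℝ} : spow β 0 = 0 := by simp [spow]

lemma spow_neg (β : ℝ) (z : ℂ) : spow β (-z) = -spow β z := by simp [spow]

lemma spow_two_sub_one (z : ℂ) : spow (2 - 1) z = (starRingEnd ℂ) z := by
  norm_num [spow]

lemma spow_ofReal_mul {β r : ℝ} (hβ : 0 < β) (hr : 0 ≤ r) (z : ℂ) :
    spow β (r * z) = ((r ^ β : ℝ) : ℂ) * spow β z := by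
  rcases eq_or_lt_of_le hr with rfl | hr
  · simp [spow, Real.zero_rpow hβ.ne']
  · simp only [spow, norm_mul, Complex.norm_real, Real.norm_of_nonneg hr.le, map_mul,
      Complex.conj_ofReal]
    rw [Real.mul_rpow hr.le (norm_nonneg _), Real.rpow_sub hr, Real.rpow_one]
    push_cast
    have : (r : ℂ) ≠ 0 := by exact_mod_cast hr.ne'
    field_simp

lemma mul_spow_self {α : ℝ} (hα : 0 < α) (z : ℂ) :
    z * spow (α - 1) z = ((‖z‖ ^ α : ℝ) : ℂ) := by
  rcases eq_or_ne z 0 with rfl | hz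
  · simp [Real.zero_rpow hα.ne']
  · have h : 0 < ‖z‖ := norm_pos_iff.mpr hz
    have h2 : z * spow (α - 1) z = ((‖z‖ ^ (α - 1 - 1) : ℝ) : ℂ) * (z * (starRingEnd ℂ) z) := by
      rw [spow]; ring
    rw [h2, Complex.mul_conj, Complex.normSq_eq_norm_sq, ← Complex.ofReal_mul]
    congr 1
    rw [← Real.rpow_natCast, ← Real.rpow_add h]
    congr 1
    push_cast
    ring

@[fun_prop]
lemma measurable_spow (β : ℝ) : Measurable (spow β) := by
  unfold spow
  fun_prop

lemma continuous_spow {β : ℝ} (hβ : 0 < β) : Continuous (spow β) := by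
  rw [continuous_iff_continuousAt]
  intro z
  rcases eq_or_ne z 0 with rfl | hz
  · rw [ContinuousAt, spow_zero, tendsto_zero_iff_norm_tendsto_zero]
    simp_rw [norm_spow hβ]
    have : Continuous fun z : ℂ => ‖z‖ ^ β := continuous_norm.rpow_const fun _ => Or.inr hβ.le
    simpa [Real.zero_rpow hβ.ne'] using this.tendsto 0
  · unfold spow
    have h1 : ContinuousAt (fun z : ℂ => ‖z‖ ^ (β - 1)) z :=
      continuous_norm.continuousAt.rpow_const (Or.inl (norm_ne_zero_iff.mpr hz))
    have h2 : ContinuousAt (fun z : ℂ => (starRingEnd ℂ) z) z := Complex.continuous_conj.continuousAt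
    exact (Complex.continuous_ofReal.continuousAt.comp h1).mul h2

/-- Young's inequality for the pairing of `b` with the signed power of `a`. -/
lemma norm_mul_rpow_le {α : ℝ} (hα : 1 < α) {a b : ℝ} (ha : 0 ≤ a) (hb : 0 ≤ b) :
    α * (b * a ^ (α - 1)) ≤ b ^ α + (α - 1) * a ^ α := by
  have hα0 : (0 : ℝ) < α - 1 := by linarith
  have hpq : α.HolderConjugate (α / (α - 1)) := Real.HolderConjugate.conjExponent hα
  have h := Real.young_inequality_of_nonneg hb (Real.rpow_nonneg ha (α - 1)) hpq
  rw [← Real.rpow_mul ha] at h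
  have h1 : (α - 1) * (α / (α - 1)) = α := by field_simp
  rw [h1] at h
  calc α * (b * a ^ (α - 1)) ≤ α * (b ^ α / α + a ^ α / (α / (α - 1))) := by gcongr
    _ = _ := by field_simp

/-- The functional `z ↦ α Re (z a^{<α-1>})` is the differential of the convex function `‖z‖ ^ α` at
`a`. After splitting off `‖a‖ ^ α` this is Young's inequality. -/
lemma norm_rpow_subgradient {α : ℝ} (hα : 1 < α) (a b : ℂ) :
    ‖a‖ ^ α + α * ((b - a) * spow (α - 1) a).re ≤ ‖b‖ ^ α := by
  have h1 : ((b - a) * spow (α - 1) a).re = (b * spow (α - 1) a).re - ‖a‖ ^ α := by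
    rw [sub_mul, mul_spow_self (by linarith), Complex.sub_re, Complex.ofReal_re]
  have h2 : (b * spow (α - 1) a).re ≤ ‖b‖ * ‖a‖ ^ (α - 1) := by
    refine (Complex.re_le_norm _).trans ?_
    rw [norm_mul, norm_spow (by linarith)]
  have h3 := norm_mul_rpow_le hα (norm_nonneg a) (norm_nonneg b)
  have h4 : α * (b * spow (α - 1) a).re ≤ α * (‖b‖ * ‖a‖ ^ (α - 1)) := by gcongr
  rw [h1]
  linarith

lemma norm_midpoint_rpow_le {α : ℝ} (hα : 1 < α) (a b : ℂ) :
    ‖(a + b) / 2‖ ^ α ≤ (‖a‖ ^ α + ‖b‖ ^ α) / 2 := by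
  have h1 := norm_rpow_subgradient hα ((a + b) / 2) a
  have h2 := norm_rpow_subgradient hα ((a + b) / 2) b
  have h3 : (b - (a + b) / 2) = - (a - (a + b) / 2) := by ring
  rw [h3, neg_mul, Complex.neg_re] at h2
  linarith

/-- Strict convexity of `x ^ α` on moduli forces `‖a‖ = ‖b‖`; equality in the triangle inequality
then puts `a` and `b` on the same ray. -/
lemma eq_of_norm_midpoint_rpow {α : ℝ} (hα : 1 < α) {a b : ℂ}
    (h : (‖a‖ ^ α + ‖b‖ ^ α) / 2 ≤ ‖(a + b) / 2‖ ^ α) : a = b := by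
  have h1 : ‖(a + b) / 2‖ = ‖a + b‖ / 2 := by simp
  rw [h1] at h
  have hc := strictConvexOn_rpow hα
  have h2 : ‖a‖ = ‖b‖ := by
    by_contra hne
    have h3 := hc.2 (mem_Ici.2 (norm_nonneg a)) (mem_Ici.2 (norm_nonneg b)) hne
      (by norm_num : (0 : ℝ) < 1 / 2) (by norm_num : (0 : ℝ) < 1 / 2) (by norm_num)
    simp only [smul_eq_mul] at h3
    have h4 : (‖a + b‖ / 2) ^ α ≤ (1 / 2 * ‖a‖ + 1 / 2 * ‖b‖) ^ α := by
      gcongr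
      linarith [norm_add_le a b]
    linarith
  have h5 : ‖a‖ ≤ ‖a + b‖ / 2 := by
    rw [← h2, add_self_div_two] at h
    exact (Real.rpow_le_rpow_iff (norm_nonneg _) (by positivity) (by linarith)).1 h
  have h6 : SameRay ℝ a b := sameRay_iff_norm_add.2
    (le_antisymm (norm_add_le a b) (by linarith))
  have h7 := h6.norm_smul_eq
  rw [h2] at h7
  rcases eq_or_ne ‖b‖ 0 with h0 | h0
  · rw [h0] at h2
    rw [norm_eq_zero.1 h0, norm_eq_zero.1 h2]
  · exact (smul_right_injective ℂ h0 h7).symm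

/-- Uniform convexity of `z ↦ ‖z‖ ^ α` in a homogeneous form. -/
lemma exists_norm_sub_rpow_le {α : ℝ} (hα : 1 < α) {ε : ℝ} (hε : 0 < ε) :
    ∃ C : ℝ, 0 ≤ C ∧ ∀ a b : ℂ, ‖a - b‖ ^ α + C * ‖(a + b) / 2‖ ^ α ≤
      (ε + C / 2) * (‖a‖ ^ α + ‖b‖ ^ α) := by
  have hα0 : 0 < α := by linarith
  have hcont : Continuous fun z : ℂ => ‖z‖ ^ α := continuous_norm.rpow_const fun _ => Or.inr hα0.le
  let D : ℂ × ℂ → ℝ := fun x => (‖x.1‖ ^ α + ‖x.2‖ ^ α) / 2 - ‖(x.1 + x.2) / 2‖ ^ α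
  have hD : Continuous D := by
    have h1 := hcont.comp (continuous_fst (X := ℂ) (Y := ℂ))
    have h2 := hcont.comp (continuous_snd (X := ℂ) (Y := ℂ))
    have h3 : Continuous fun x : ℂ × ℂ => ‖(x.1 + x.2) / 2‖ ^ α :=
      hcont.comp (f := fun x : ℂ × ℂ => (x.1 + x.2) / 2) (by fun_prop)
    exact ((h1.add h2).div_const 2).sub h3
  have hS : Continuous fun x : ℂ × ℂ => ‖x.1 - x.2‖ ^ α :=
    hcont.comp (f := fun x : ℂ × ℂ => x.1 - x.2) (by fun_prop)
  -- By homogeneity only pairs with `‖a‖ ^ α + ‖b‖ ^ α = 1` matter. Where `‖a - b‖ ^ α < ε` nothing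
  -- is to be shown; the other pairs form the compact set `K`, on which the midpoint defect `D`
  -- stays above some `δ > 0`.
  let K : Set (ℂ × ℂ) := {x | ‖x.1‖ ^ α + ‖x.2‖ ^ α = 1 ∧ ε ≤ ‖x.1 - x.2‖ ^ α}
  have hKc : IsClosed K :=
    (isClosed_eq ((hcont.comp continuous_fst).add (hcont.comp continuous_snd)) continuous_const).inter
      (isClosed_le continuous_const hS)
  have hle1 : ∀ x : ℝ, 0 ≤ x → x ^ α ≤ 1 → x ≤ 1 := fun x hx h => by
    rw [← Real.one_rpow α] at h
    exact (Real.rpow_le_rpow_iff hx zero_le_one hα0).1 h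
  have hK1 : ∀ x : ℂ × ℂ, ‖x.1‖ ^ α + ‖x.2‖ ^ α = 1 → ‖x.1‖ ≤ 1 ∧ ‖x.2‖ ≤ 1 := by
    intro x hx
    have h1 : 0 ≤ ‖x.1‖ ^ α := by positivity
    have h2 : 0 ≤ ‖x.2‖ ^ α := by positivity
    exact ⟨hle1 _ (norm_nonneg _) (by linarith), hle1 _ (norm_nonneg _) (by linarith)⟩
  have hKcomp : IsCompact K := by
    refine Metric.isCompact_of_isClosed_isBounded hKc
      ((Metric.isBounded_closedBall (x := (0 : ℂ × ℂ)) (r := 1)).subset ?_)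
    intro x hx
    rw [mem_closedBall_zero_iff, Prod.norm_def]
    exact max_le (hK1 x hx.1).1 (hK1 x hx.1).2
  obtain ⟨δ, hδ, hKδ⟩ : ∃ δ > 0, ∀ x ∈ K, δ ≤ D x := by
    rcases K.eq_empty_or_nonempty with he | hne
    · exact ⟨1, one_pos, fun x hx => by simp [he] at hx⟩
    · obtain ⟨x₀, hx₀, hmin⟩ := hKcomp.exists_isMinOn hne hD.continuousOn
      refine ⟨D x₀, ?_, fun x hx => hmin hx⟩
      by_contra hneg
      have : x₀.1 = x₀.2 := eq_of_norm_midpoint_rpow hα (by simp only [D] at hneg; linarith)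
      have h2 := hx₀.2
      rw [this, sub_self, norm_zero, Real.zero_rpow hα0.ne'] at h2
      linarith
  have hbase : ∀ a b : ℂ, ‖a‖ ^ α + ‖b‖ ^ α = 1 →
      ‖a - b‖ ^ α ≤ ε + 2 ^ α / δ * D (a, b) := by
    intro a b hab
    have hDnn : 0 ≤ D (a, b) := by
      have := norm_midpoint_rpow_le hα a b
      simp only [D]; linarith
    by_cases h : ε ≤ ‖a - b‖ ^ α
    · have h1 := hKδ (a, b) ⟨hab, h⟩
      have h2 : ‖a - b‖ ^ α ≤ 2 ^ α := by
        have := hK1 (a, b) hab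
        have h3 := norm_sub_le a b
        gcongr
        simp only at this
        linarith [this.1, this.2]
      -- The constant `C = 2 ^ α / δ` turns `D ≥ δ` into the crude bound `‖a - b‖ ^ α ≤ 2 ^ α`.
      have h3 : (2 : ℝ) ^ α ≤ 2 ^ α / δ * D (a, b) := by
        rw [div_mul_eq_mul_div, le_div_iff₀ hδ]
        gcongr
      linarith
    · have : 0 ≤ 2 ^ α / δ * D (a, b) := by positivity
      linarith
  refine ⟨2 ^ α / δ, by positivity, fun a b => ?_⟩
  set s : ℝ := ‖a‖ ^ α + ‖b‖ ^ α with hs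
  have hs0 : 0 ≤ s := by positivity
  rcases eq_or_lt_of_le hs0 with h0 | hpos
  · have h1 : 0 ≤ ‖a‖ ^ α := by positivity
    have h2 : 0 ≤ ‖b‖ ^ α := by positivity
    have ha : a = 0 := by
      have : ‖a‖ ^ α = 0 := by linarith
      simpa using (Real.rpow_eq_zero (norm_nonneg a) hα0.ne').1 this
    have hb : b = 0 := by
      have : ‖b‖ ^ α = 0 := by linarith
      simpa using (Real.rpow_eq_zero (norm_nonneg b) hα0.ne').1 this
    rw [← h0]
    simp [ha, hb, Real.zero_rpow hα0.ne']
  · set r : ℝ := s ^ (-(1 / α)) with hr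
    have hr0 : 0 < r := by positivity
    have hrs : r ^ α = s⁻¹ := by
      rw [hr, ← Real.rpow_mul hs0]
      rw [show -(1 / α) * α = -1 by field_simp, Real.rpow_neg_one]
    have hscale : ∀ z : ℂ, ‖(r : ℂ) * z‖ ^ α = s⁻¹ * ‖z‖ ^ α := by
      intro z
      rw [norm_mul, Complex.norm_real, Real.norm_of_nonneg hr0.le,
        Real.mul_rpow hr0.le (norm_nonneg _), hrs]
    have h := hbase (r * a) (r * b) (by
      rw [hscale, hscale, ← mul_add, ← hs]; exact inv_mul_cancel₀ hpos.ne')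
    simp only [D] at h
    rw [← mul_sub, ← mul_add, mul_div_assoc, hscale, hscale, hscale, hscale, ← mul_add, ← hs] at h
    have h' := mul_le_mul_of_nonneg_left h hs0
    have e1 : s * (s⁻¹ * ‖a - b‖ ^ α) = ‖a - b‖ ^ α := by field_simp
    have e2 : s * (ε + 2 ^ α / δ * (s⁻¹ * s / 2 - s⁻¹ * ‖(a + b) / 2‖ ^ α)) =
        ε * s + 2 ^ α / δ * (s / 2 - ‖(a + b) / 2‖ ^ α) := by field_simp
    rw [e1, e2] at h'
    linarith

/-- A substitute for Minkowski's inequality, linear in the `α`-th powers so that it can be summed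
and integrated. If `‖b‖ ≤ δ ‖a‖` the factor `(1 + δ) ^ α ≤ 1 + ε` suffices; otherwise `‖b‖` controls
the whole sum. -/
lemma exists_norm_add_rpow_le {α : ℝ} (hα : 0 < α) {ε : ℝ} (hε : 0 < ε) :
    ∃ K : ℝ, 0 ≤ K ∧ ∀ a b : ℂ, ‖a + b‖ ^ α ≤ (1 + ε) * ‖a‖ ^ α + K * ‖b‖ ^ α := by
  obtain ⟨δ, hδ, hδε⟩ : ∃ δ > 0, (1 + δ) ^ α ≤ 1 + ε := by
    refine ⟨(1 + ε) ^ (1 / α) - 1, ?_, ?_⟩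
    · have : 1 < (1 + ε) ^ (1 / α) := Real.one_lt_rpow (by linarith) (by positivity)
      linarith
    · rw [add_sub_cancel, ← Real.rpow_mul (by positivity)]
      simp [hα.ne']
  refine ⟨(1 + 1 / δ) ^ α, by positivity, fun a b => ?_⟩
  have h0 : 0 ≤ ‖a‖ ^ α := by positivity
  have h1 : 0 ≤ ‖b‖ ^ α := by positivity
  by_cases h : ‖b‖ ≤ δ * ‖a‖
  · calc ‖a + b‖ ^ α ≤ ((1 + δ) * ‖a‖) ^ α := by
          gcongr
          linarith [norm_add_le a b]
      _ = (1 + δ) ^ α * ‖a‖ ^ α := Real.mul_rpow (by positivity) (norm_nonneg _)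
      _ ≤ (1 + ε) * ‖a‖ ^ α := by gcongr
      _ ≤ _ := by
        have : 0 ≤ (1 + 1 / δ) ^ α * ‖b‖ ^ α := by positivity
        linarith
  · calc ‖a + b‖ ^ α ≤ ((1 + 1 / δ) * ‖b‖) ^ α := by
          gcongr
          have h2 : ‖a‖ ≤ 1 / δ * ‖b‖ := by
            rw [one_div_mul_eq_div, le_div_iff₀ hδ]
            linarith
          linarith [norm_add_le a b]
      _ = (1 + 1 / δ) ^ α * ‖b‖ ^ α := Real.mul_rpow (by positivity) (norm_nonneg _)
      _ ≤ _ := by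
        have : 0 ≤ (1 + ε) * ‖a‖ ^ α := by positivity
        linarith

/-! ### The form `u^⊤ M v^{<α-1>}` and the matrices for which it is convex. -/

section Forms

variable {T : ℕ} {α : ℝ} {M : Matrix (Fin T) (Fin T) ℂ}

lemma sform_neg_left (α : ℝ) (M : Matrix (Fin T) (Fin T) ℂ) (u w : Fin T → ℂ) :
    sform α M (-u) w = -sform α M u w := neg_dotProduct _ _

lemma sform_smul_left (α : ℝ) (M : Matrix (Fin T) (Fin T) ℂ) (c : ℂ) (u w : Fin T → ℂ) :
    sform α M (c • u) w = c * sform α M u w := smul_dotProduct _ _ _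

lemma vspow_neg (β : ℝ) (v : Fin T → ℂ) : vspow β (-v) = -vspow β v := by
  funext k; simp [vspow, spow_neg]

lemma sform_neg_neg (α : ℝ) (M : Matrix (Fin T) (Fin T) ℂ) (u : Fin T → ℂ) :
    sform α M (-u) (-u) = sform α M u u := by
  simp [sform, vspow_neg, Matrix.mulVec_neg]

lemma sform_add_mat (α : ℝ) (M M' : Matrix (Fin T) (Fin T) ℂ) (u v : Fin T → ℂ) :
    sform α (M + M') u v = sform α M u v + sform α M' u v := by
  simp [sform, Matrix.add_mulVec, dotProduct_add]

lemma sform_eq_sum (α : ℝ) (M : Matrix (Fin T) (Fin T) ℂ) (u v : Fin T → ℂ) :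
    sform α M u v = ∑ k, ∑ l, u k * (M k l * spow (α - 1) (v l)) := by
  simp [sform, dotProduct, Matrix.mulVec, vspow, Finset.mul_sum]

/-- The real number `Re (u^⊤ M u^{<α-1>})`. -/
def nform (α : ℝ) (M : Matrix (Fin T) (Fin T) ℂ) (u : Fin T → ℂ) : ℝ := (sform α M u u).re

lemma nform_neg (α : ℝ) (M : Matrix (Fin T) (Fin T) ℂ) (u : Fin T → ℂ) :
    nform α M (-u) = nform α M u := by rw [nform, sform_neg_neg, nform]

lemma nform_add_mat (α : ℝ) (M M' : Matrix (Fin T) (Fin T) ℂ) (u : Fin T → ℂ) :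
    nform α (M + M') u = nform α M u + nform α M' u := by
  simp [nform, sform_add_mat]

lemma nform_zero (α : ℝ) (M : Matrix (Fin T) (Fin T) ℂ) : nform α M 0 = 0 := by
  simp [nform, sform]

lemma continuous_sform (hα : 1 < α) (M : Matrix (Fin T) (Fin T) ℂ) :
    Continuous fun x : (Fin T → ℂ) × (Fin T → ℂ) => sform α M x.1 x.2 := by
  simp_rw [sform_eq_sum]
  have := continuous_spow (β := α - 1) (by linarith)
  fun_prop

lemma continuous_nform (hα : 1 < α) (M : Matrix (Fin T) (Fin T) ℂ) :
    Continuous (nform α M) :=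
  Complex.continuous_re.comp ((continuous_sform hα M).comp (continuous_id.prodMk continuous_id))

/-- The matrices that occur as values of a spectral density: positive semidefinite, and diagonal
unless `α = 2`. -/
def StableMatrix (α : ℝ) (M : Matrix (Fin T) (Fin T) ℂ) : Prop :=
  M.PosSemidef ∧ (α = 2 ∨ M.IsDiag)

lemma StableMatrix.add {M' : Matrix (Fin T) (Fin T) ℂ} (h : StableMatrix α M)
    (h' : StableMatrix α M') : StableMatrix α (M + M') := by
  refine ⟨h.1.add h'.1, ?_⟩
  rcases h.2 with h2 | h2
  · exact Or.inl h2
  · rcases h'.2 with h3 | h3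
    · exact Or.inl h3
    · exact Or.inr (h2.add h3)

lemma sform_diagonal (α : ℝ) (d : Fin T → ℂ) (u v : Fin T → ℂ) :
    sform α (Matrix.diagonal d) u v = ∑ k, d k * (u k * spow (α - 1) (v k)) := by
  simp only [sform, dotProduct, Matrix.mulVec_diagonal, vspow]
  exact Finset.sum_congr rfl fun k _ => by ring

open scoped MatrixOrder Matrix.Norms.L2Operator in
lemma exists_eq_star_mul_self (hM : M.PosSemidef) :
    ∃ B : Matrix (Fin T) (Fin T) ℂ, M = star B * B :=
  CStarAlgebra.nonneg_iff_eq_star_mul_self.mp hM.nonneg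

/-- The form of a stable matrix is the canonical form after a linear change of variables. -/
lemma StableMatrix.exists_factor (hα : 1 < α) (h : StableMatrix α M) :
    ∃ B : Matrix (Fin T) (Fin T) ℂ, ∀ u v,
      sform α M u v = ∑ k, (B *ᵥ u) k * spow (α - 1) ((B *ᵥ v) k) := by
  obtain ⟨hM, rfl | hd⟩ := h
  · obtain ⟨B, rfl⟩ := exists_eq_star_mul_self hM
    -- For `α = 2` the form is `u^⊤ M v̄`, linear in the first argument, so the factor of `M = B* B`
    -- has to be conjugated entrywise.
    refine ⟨B.map (starRingEnd ℂ), fun u v => ?_⟩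
    have h1 : vspow (2 - 1) v = star v := by
      funext k; simp [vspow, spow_two_sub_one]
    have h2 : ∀ x : Fin T → ℂ, B.map (starRingEnd ℂ) *ᵥ x = star (B *ᵥ star x) := by
      intro x; funext k; simp [Matrix.mulVec, dotProduct]
    rw [sform, h1, ← Matrix.mulVec_mulVec, Matrix.dotProduct_mulVec, h2 v]
    simp only [dotProduct]
    refine Finset.sum_congr rfl fun k _ => ?_
    rw [spow_two_sub_one]
    congr 1
    · simp [Matrix.vecMul, Matrix.mulVec, dotProduct, Matrix.star_apply, mul_comm]
    · simp
  · have hdiag := hd.diagonal_diag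
    have hnn : ∀ k, M k k = (((M k k).re : ℝ) : ℂ) ∧ 0 ≤ (M k k).re := fun k => by
      have := hM.diag_nonneg (i := k)
      rw [Complex.le_def] at this
      exact ⟨Complex.ext rfl (by simpa using this.2.symm), by simpa using this.1⟩
    -- The exponent `1` of a diagonal entry splits as `1/α + (α-1)/α`, one share for each argument.
    refine ⟨Matrix.diagonal fun k => (((M k k).re ^ (1 / α) : ℝ) : ℂ), fun u v => ?_⟩
    rw [← hdiag, sform_diagonal, hdiag]
    refine Finset.sum_congr rfl fun k _ => ?_
    obtain ⟨h1, h2⟩ := hnn k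
    rw [Matrix.mulVec_diagonal, Matrix.mulVec_diagonal,
      spow_ofReal_mul (by linarith) (Real.rpow_nonneg h2 _), ← Real.rpow_mul h2]
    have h3 : ((M k k).re : ℂ) = (((M k k).re ^ (1 / α) : ℝ) : ℂ) *
        (((M k k).re ^ (1 / α * (α - 1)) : ℝ) : ℂ) := by
      rw [← Complex.ofReal_mul, ← Real.rpow_add_of_nonneg h2 (by positivity)
        (by have : 0 < α - 1 := by linarith
            positivity)]
      rw [show 1 / α + 1 / α * (α - 1) = 1 by field_simp; ring, Real.rpow_one]
    simp only [Matrix.diag_apply]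
    rw [h1, Complex.ofReal_re, h3]
    ring

lemma StableMatrix.exists_nform_factor (hα : 1 < α) (h : StableMatrix α M) :
    ∃ B : Matrix (Fin T) (Fin T) ℂ,
      (∀ u v, sform α M u v = ∑ k, (B *ᵥ u) k * spow (α - 1) ((B *ᵥ v) k)) ∧
      (∀ u, sform α M u u = (nform α M u : ℂ)) ∧
      ∀ u, nform α M u = ∑ k, ‖(B *ᵥ u) k‖ ^ α := by
  obtain ⟨B, hB⟩ := h.exists_factor hα
  have h1 : ∀ u, sform α M u u = ((∑ k, ‖(B *ᵥ u) k‖ ^ α : ℝ) : ℂ) := by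
    intro u
    rw [hB]
    push_cast
    exact Finset.sum_congr rfl fun k _ => by rw [mul_spow_self (by linarith)]
  have h2 : ∀ u, nform α M u = ∑ k, ‖(B *ᵥ u) k‖ ^ α := fun u => by
    rw [nform, h1, Complex.ofReal_re]
  exact ⟨B, hB, fun u => by rw [h1, h2], h2⟩

lemma StableMatrix.sform_self (hα : 1 < α) (h : StableMatrix α M) (u : Fin T → ℂ) :
    sform α M u u = (nform α M u : ℂ) := by
  obtain ⟨B, -, h1, -⟩ := h.exists_nform_factor hα
  exact h1 u

lemma StableMatrix.nform_nonneg (hα : 1 < α) (h : StableMatrix α M) (u : Fin T → ℂ) :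
    0 ≤ nform α M u := by
  obtain ⟨B, -, -, h2⟩ := h.exists_nform_factor hα
  rw [h2]
  positivity

lemma StableMatrix.subgradient (hα : 1 < α) (h : StableMatrix α M) (u v : Fin T → ℂ) :
    nform α M u + α * (sform α M (v - u) u).re ≤ nform α M v := by
  obtain ⟨B, h0, -, h2⟩ := h.exists_nform_factor hα
  rw [h2, h2, h0, Complex.re_sum, Finset.mul_sum, ← Finset.sum_add_distrib]
  refine Finset.sum_le_sum fun k _ => ?_
  rw [Matrix.mulVec_sub]
  exact norm_rpow_subgradient hα _ _

lemma StableMatrix.norm_sform_le (hα : 1 < α) (h : StableMatrix α M) (u v : Fin T → ℂ) :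
    ‖sform α M u v‖ ≤ nform α M u + nform α M v := by
  obtain ⟨B, h0, -, h2⟩ := h.exists_nform_factor hα
  rw [h2, h2, h0, ← Finset.sum_add_distrib]
  refine (norm_sum_le _ _).trans (Finset.sum_le_sum fun k _ => ?_)
  rw [norm_mul, norm_spow (by linarith)]
  have h3 := norm_mul_rpow_le hα (norm_nonneg ((B *ᵥ v) k)) (norm_nonneg ((B *ᵥ u) k))
  have h4 : 0 ≤ ‖(B *ᵥ u) k‖ ^ α := by positivity
  have h5 : 0 ≤ ‖(B *ᵥ v) k‖ ^ α := by positivity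
  have h6 : 0 ≤ ‖(B *ᵥ u) k‖ * ‖(B *ᵥ v) k‖ ^ (α - 1) := by positivity
  by_contra hc
  push Not at hc
  nlinarith

/-- The scalar inequality is summed over the coordinates of `B *ᵥ u` and `B *ᵥ v`. The constant `C`
does not depend on `M`, so the result can be integrated over `θ`. -/
lemma exists_nform_sub_le (hα : 1 < α) {ε : ℝ} (hε : 0 < ε) :
    ∃ C : ℝ, 0 ≤ C ∧ ∀ M : Matrix (Fin T) (Fin T) ℂ, StableMatrix α M → ∀ u v,
      nform α M (u - v) + C * nform α M ((1 / 2 : ℂ) • (u + v)) ≤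
        (ε + C / 2) * (nform α M u + nform α M v) := by
  obtain ⟨C, hC, h⟩ := exists_norm_sub_rpow_le hα hε
  refine ⟨C, hC, fun M hM u v => ?_⟩
  obtain ⟨B, -, -, h2⟩ := hM.exists_nform_factor hα
  simp_rw [h2]
  rw [Finset.mul_sum, ← Finset.sum_add_distrib, ← Finset.sum_add_distrib, Finset.mul_sum]
  refine Finset.sum_le_sum fun k _ => ?_
  rw [Matrix.mulVec_sub, Matrix.mulVec_smul, Matrix.mulVec_add]
  have e : ((1 / 2 : ℂ) • (B *ᵥ u + B *ᵥ v)) k = ((B *ᵥ u) k + (B *ᵥ v) k) / 2 := by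
    simp only [Pi.smul_apply, Pi.add_apply, smul_eq_mul]
    ring
  rw [e]
  exact h _ _

lemma exists_nform_add_le (hα : 1 < α) {ε : ℝ} (hε : 0 < ε) :
    ∃ K : ℝ, 0 ≤ K ∧ ∀ M : Matrix (Fin T) (Fin T) ℂ, StableMatrix α M → ∀ u v,
      nform α M (u + v) ≤ (1 + ε) * nform α M u + K * nform α M v := by
  obtain ⟨K, hK, h⟩ := exists_norm_add_rpow_le (α := α) (by linarith) hε
  refine ⟨K, hK, fun M hM u v => ?_⟩
  obtain ⟨B, -, -, h2⟩ := hM.exists_nform_factor hα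
  simp_rw [h2]
  rw [Finset.mul_sum, Finset.mul_sum, ← Finset.sum_add_distrib]
  refine Finset.sum_le_sum fun k _ => ?_
  rw [Matrix.mulVec_add]
  exact h _ _

/-- A matrix form which is real nonnegative and satisfies the subgradient inequality is stable. -/
lemma stableMatrix_of_subgradient (hα₁ : 1 < α) (hα₂ : α ≤ 2)
    (h1 : ∀ u, (sform α M u u).im = 0 ∧ 0 ≤ (sform α M u u).re)
    (h2 : ∀ u v, nform α M v + α * (sform α M (u - v) v).re ≤ nform α M u) :
    StableMatrix α M := by
  rcases eq_or_lt_of_le hα₂ with rfl | hlt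
  · refine ⟨?_, Or.inl rfl⟩
    have h3 : ∀ x : Fin T → ℂ, 0 ≤ star x ⬝ᵥ (M *ᵥ x) := by
      intro x
      have h4 : sform 2 M (star x) (star x) = star x ⬝ᵥ (M *ᵥ x) := by
        rw [sform]
        congr 2
        funext k; simp [vspow, spow_two_sub_one]
      rw [← h4, Complex.le_def]
      exact ⟨by simpa using (h1 (star x)).2, by simpa using (h1 (star x)).1.symm⟩
    refine Matrix.PosSemidef.of_dotProduct_mulVec_nonneg ?_ h3
    -- Over `ℂ` a real-valued quadratic form already forces the matrix to be Hermitian.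
    rw [← Matrix.isSymmetric_toEuclideanLin_iff, LinearMap.isSymmetric_iff_inner_map_self_real]
    intro v
    have h5 := h3 (WithLp.ofLp v)
    have h6 : inner ℂ (M.toEuclideanLin v) v = star (star (WithLp.ofLp v) ⬝ᵥ (M *ᵥ WithLp.ofLp v)) := by
      rw [EuclideanSpace.inner_eq_star_dotProduct, Matrix.star_dotProduct, star_star,
        dotProduct_comm]
      rfl
    rw [h6]
    have h7 : star (star (WithLp.ofLp v) ⬝ᵥ (M *ᵥ WithLp.ofLp v)) = star (WithLp.ofLp v) ⬝ᵥ (M *ᵥ WithLp.ofLp v) :=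
      (IsSelfAdjoint.of_nonneg h5)
    rw [h7]
    exact h7
  · have hα0 : 0 < α - 1 := by linarith
    have hs1 : spow (α - 1) 1 = 1 := by simp [spow]
    have hdiag : M.IsDiag := by
      intro i j hij
      by_contra hne
      set m := M i j with hm
      have hpos : 0 < ‖m‖ ^ α := Real.rpow_pos_of_pos (norm_pos_iff.mpr hne) _
      -- The vector `e_i` is perturbed by `r m e_j` with `m = M i j`. The cross term `m (r
      -- m)^{<α-1>}` has order `r ^ (α-1)`, the other perturbation terms orders `r` and `r ^ α`.
      -- After division by `r ^ (α-1)` the right side tends to `0` with `r`, because `α < 2`.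
      have key : ∀ r : ℝ, 0 < r → ‖m‖ ^ α ≤
          (α - 1) * (m * M j i).re * r ^ (2 - α) + (α - 1) * (M j j).re * ‖m‖ ^ α * r := by
        intro r hr
        have h3 := h2 (Pi.single i 1) (Pi.single i 1 + Pi.single j ((r : ℂ) * m))
        have hv : vspow (α - 1) (Pi.single i 1 + Pi.single j ((r : ℂ) * m)) =
            Pi.single i 1 + Pi.single j (((r ^ (α - 1) : ℝ) : ℂ) * spow (α - 1) m) := by
          funext k
          rw [← spow_ofReal_mul hα0 hr.le]
          rcases eq_or_ne k i with rfl | hki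
          · simp [vspow, hij, hs1]
          · rcases eq_or_ne k j with rfl | hkj
            · simp [vspow, hki]
            · simp [vspow, hki, hkj, spow_zero]
        have hvi : vspow (α - 1) (Pi.single i (1 : ℂ)) = Pi.single i 1 := by
          funext k
          rcases eq_or_ne k i with rfl | hki
          · simp [vspow, hs1]
          · simp [vspow, hki, spow_zero]
        rw [sub_add_cancel_left] at h3
        simp only [nform, sform, hv, hvi] at h3
        simp only [Matrix.mulVec_add, Matrix.mulVec_single, add_dotProduct, dotProduct_add,
          neg_dotProduct, single_dotProduct, Pi.smul_apply, Matrix.col_apply,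
          MulOpposite.smul_eq_mul_unop, MulOpposite.unop_op, ← hm] at h3
        have e1 : m * (((r ^ (α - 1) : ℝ) : ℂ) * spow (α - 1) m) =
            ((r ^ (α - 1) * ‖m‖ ^ α : ℝ) : ℂ) := by
          rw [mul_left_comm, mul_spow_self (by linarith)]; push_cast; rfl
        have e2 : (r : ℂ) * m * (M j j * (((r ^ (α - 1) : ℝ) : ℂ) * spow (α - 1) m)) =
            ((r * r ^ (α - 1) * ‖m‖ ^ α : ℝ) : ℂ) * M j j := by
          calc _ = (r : ℂ) * M j j * (m * (((r ^ (α - 1) : ℝ) : ℂ) * spow (α - 1) m)) := by ring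
            _ = _ := by rw [e1]; push_cast; ring
        have e3 : (r : ℂ) * m * M j i = (r : ℂ) * (m * M j i) := by ring
        simp only [e1, e2, e3, mul_one, one_mul, Complex.add_re, Complex.neg_re, Complex.re_ofReal_mul,
          Complex.ofReal_re] at h3
        have hr1 : 0 < r ^ (α - 1) := by positivity
        have hr2 : r = r ^ (α - 1) * r ^ (2 - α) := by
          rw [← Real.rpow_add hr]; norm_num
        have h4 : r ^ (α - 1) * ‖m‖ ^ α ≤ (α - 1) * (r * (m * M j i).re) +
            (α - 1) * (r * r ^ (α - 1) * ‖m‖ ^ α * (M j j).re) := by linarith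
        have h5 : r ^ (α - 1) * ‖m‖ ^ α ≤ r ^ (α - 1) * ((α - 1) * (m * M j i).re * r ^ (2 - α) +
            (α - 1) * (M j j).re * ‖m‖ ^ α * r) := by
          calc _ ≤ _ := h4
            _ = (α - 1) * ((r ^ (α - 1) * r ^ (2 - α)) * (m * M j i).re) +
                (α - 1) * (r * r ^ (α - 1) * ‖m‖ ^ α * (M j j).re) := by rw [← hr2]
            _ = _ := by ring
        exact le_of_mul_le_mul_left h5 hr1
      have hlim : Tendsto (fun r : ℝ => (α - 1) * (m * M j i).re * r ^ (2 - α) +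
          (α - 1) * (M j j).re * ‖m‖ ^ α * r) (𝓝[>] 0) (𝓝 0) := by
        have : Continuous fun r : ℝ => (α - 1) * (m * M j i).re * r ^ (2 - α) +
            (α - 1) * (M j j).re * ‖m‖ ^ α * r := by
          have := Real.continuous_rpow_const (q := 2 - α) (by linarith)
          fun_prop
        have h3 := this.tendsto 0
        rw [Real.zero_rpow (by linarith), mul_zero, mul_zero, add_zero] at h3
        exact h3.mono_left nhdsWithin_le_nhds
      have := ge_of_tendsto hlim (eventually_nhdsWithin_of_forall fun r hr => key r hr)
      linarith
    refine ⟨?_, Or.inr hdiag⟩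
    rw [← hdiag.diagonal_diag]
    refine Matrix.PosSemidef.diagonal fun k => ?_
    have h3 := h1 (Pi.single k 1)
    have h4 : sform α M (Pi.single k 1) (Pi.single k 1) = M k k := by
      have hvi : vspow (α - 1) (Pi.single k (1 : ℂ)) = Pi.single k 1 := by
        funext l
        rcases eq_or_ne l k with rfl | hki
        · simp [vspow, hs1]
        · simp [vspow, hki, spow_zero]
      simp [sform, hvi]
    rw [h4] at h3
    simp only [Pi.zero_apply, Matrix.diag_apply]
    rw [Complex.le_def]
    exact ⟨by simpa using h3.2, by simpa using h3.1.symm⟩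

/-- Monotonicity of the signed power is strict with respect to the form. -/
lemma StableMatrix.nform_sub_eq_zero (hα : 1 < α) (h : StableMatrix α M) {u v : Fin T → ℂ}
    (huv : (sform α M (u - v) u - sform α M (u - v) v).re ≤ 0) : nform α M (u - v) = 0 := by
  have hα0 : 0 < α := by linarith
  -- The subgradient inequalities at `u` and at `v`, both evaluated at the midpoint `m`, add up to
  -- `nform u + nform v ≤ 2 nform m`. Uniform convexity with arbitrarily small `ε` then leaves no
  -- room for `u - v`.
  set m := (1 / 2 : ℂ) • (u + v) with hm
  have h1 := h.subgradient hα u m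
  have h2 := h.subgradient hα v m
  have e1 : m - u = (-(1 / 2) : ℂ) • (u - v) := by
    funext k; simp [hm]; ring
  have e2 : m - v = ((1 / 2) : ℂ) • (u - v) := by
    funext k; simp [hm]; ring
  have e3 : (sform α M (m - u) u).re = -(1 / 2) * (sform α M (u - v) u).re := by
    rw [e1, sform_smul_left, show (-(1 / 2) : ℂ) = ((-(1 / 2) : ℝ) : ℂ) by push_cast; rfl,
      Complex.re_ofReal_mul]
  have e4 : (sform α M (m - v) v).re = (1 / 2) * (sform α M (u - v) v).re := by
    rw [e2, sform_smul_left, show ((1 / 2) : ℂ) = (((1 / 2) : ℝ) : ℂ) by push_cast; rfl,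
      Complex.re_ofReal_mul]
  rw [e3] at h1
  rw [e4] at h2
  rw [Complex.sub_re] at huv
  have h3 : nform α M u + nform α M v ≤ 2 * nform α M m := by nlinarith
  have h0 := h.nform_nonneg hα (u - v)
  have hs : 0 ≤ nform α M u + nform α M v :=
    add_nonneg (h.nform_nonneg hα u) (h.nform_nonneg hα v)
  refine le_antisymm (le_of_forall_pos_le_add fun δ hδ => ?_) h0
  obtain ⟨C, hC, h4⟩ := exists_nform_sub_le (T := T) hα
    (ε := δ / (nform α M u + nform α M v + 1)) (by positivity)
  have h5 := h4 M h u v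
  rw [← hm] at h5
  have h6 : δ / (nform α M u + nform α M v + 1) * (nform α M u + nform α M v) ≤ δ := by
    rw [div_mul_eq_mul_div, div_le_iff₀ (by positivity)]
    nlinarith
  nlinarith

end Forms

/-! ### Lower bound of the form by the trace of a negative power. -/

section LowerBound

variable {T : ℕ} {α : ℝ} {M : Matrix (Fin T) (Fin T) ℂ}

lemma trace_cfc (hM : M.IsHermitian) (φ : ℝ → ℝ) :
    (cfc φ M).trace = ((∑ i, φ (hM.eigenvalues i) : ℝ) : ℂ) := by
  rw [hM.cfc_eq, Matrix.IsHermitian.cfc, Unitary.conjStarAlgAut_apply, Matrix.trace_mul_cycle]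
  simp [Matrix.trace]

lemma sum_norm_sq_le_quadratic (hM : M.IsHermitian) {c : ℝ} (hc : ∀ i, c ≤ hM.eigenvalues i)
    (x : Fin T → ℂ) : c * ∑ k, ‖x k‖ ^ 2 ≤ (star x ⬝ᵥ (M *ᵥ x)).re := by
  have h1 : (M - (c : ℂ) • 1).PosSemidef := by
    have hh : (M - (c : ℂ) • 1) = Unitary.conjStarAlgAut ℂ _ hM.eigenvectorUnitary
        (Matrix.diagonal (fun i => ((hM.eigenvalues i - c : ℝ) : ℂ))) := by
      have : Matrix.diagonal (fun i => ((hM.eigenvalues i - c : ℝ) : ℂ)) =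
          Matrix.diagonal (RCLike.ofReal ∘ hM.eigenvalues) - (c : ℂ) • (1 : Matrix (Fin T) (Fin T) ℂ) := by
        rw [Matrix.smul_one_eq_diagonal, Matrix.diagonal_sub]
        congr 1; funext i; simp
      rw [this, map_sub, map_smul, map_one, ← hM.spectral_theorem]
    rw [hh, Unitary.conjStarAlgAut_apply]
    refine Matrix.PosSemidef.mul_mul_conjTranspose_same (Matrix.PosSemidef.diagonal fun i => ?_) _
    simp only [Pi.zero_apply]
    exact_mod_cast sub_nonneg.2 (hc i)
  have h2 := h1.dotProduct_mulVec_nonneg x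
  rw [Matrix.sub_mulVec, dotProduct_sub, Matrix.smul_mulVec, Matrix.one_mulVec, dotProduct_smul,
    Complex.le_def] at h2
  have h3 : star x ⬝ᵥ x = ((∑ k, ‖x k‖ ^ 2 : ℝ) : ℂ) := by
    simp only [dotProduct, Pi.star_apply, RCLike.star_def]
    push_cast
    exact Finset.sum_congr rfl fun k _ => by rw [mul_comm, Complex.mul_conj, Complex.normSq_eq_norm_sq]; push_cast; rfl
  rw [h3, smul_eq_mul, ← Complex.ofReal_mul, Complex.sub_re, Complex.ofReal_re] at h2
  exact sub_nonneg.1 h2.1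

/-- Each `λ_i ^ (-1/(α-1))` is one term of the trace `w`, so every eigenvalue is at least `w ^
(-(α-1))`. This bounds the quadratic form when `α = 2` and each diagonal entry when `M` is diagonal.
The power `w ^ (α-1)` is the one that Hölder's inequality later turns into `∫ w`. -/
lemma StableMatrix.norm_rpow_le (hα : 1 < α) (h : StableMatrix α M) (hM : M.PosDef)
    (u : Fin T → ℂ) :
    ‖u‖ ^ α ≤ (cfc (fun x : ℝ => x ^ (-1 / (α - 1))) M).trace.re ^ (α - 1) * nform α M u := by
  have hα0 : 0 < α - 1 := by linarith
  set w := (cfc (fun x : ℝ => x ^ (-1 / (α - 1))) M).trace.re with hw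
  have hw' : w = ∑ i, hM.1.eigenvalues i ^ (-1 / (α - 1)) := by
    rw [hw, trace_cfc hM.1, Complex.ofReal_re]
  have hev : ∀ i, 0 < hM.1.eigenvalues i := hM.eigenvalues_pos
  rcases isEmpty_or_nonempty (Fin T) with hT | hT
  · have : u = 0 := Subsingleton.elim _ _
    rw [this, norm_zero, Real.zero_rpow (by linarith), nform_zero, mul_zero]
  have hwpos : 0 < w := by
    rw [hw']
    exact Finset.sum_pos (fun i _ => Real.rpow_pos_of_pos (hev i) _) Finset.univ_nonempty
  have hc : ∀ i, (w ^ (α - 1))⁻¹ ≤ hM.1.eigenvalues i := by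
    intro i
    have h1 : hM.1.eigenvalues i ^ (-1 / (α - 1)) ≤ w := by
      rw [hw']
      exact Finset.single_le_sum (f := fun i => hM.1.eigenvalues i ^ (-1 / (α - 1)))
        (fun i _ => (Real.rpow_pos_of_pos (hev i) _).le) (Finset.mem_univ i)
    have h2 := Real.rpow_le_rpow (Real.rpow_pos_of_pos (hev i) _).le h1 hα0.le
    rw [← Real.rpow_mul (hev i).le, div_mul_cancel₀ _ hα0.ne', Real.rpow_neg_one] at h2
    exact (inv_le_comm₀ (by positivity) (hev i)).2 h2
  have hquad := sum_norm_sq_le_quadratic hM.1 hc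
  have hq' : ∀ x : Fin T → ℂ, ∑ k, ‖x k‖ ^ 2 ≤ w ^ (α - 1) * (star x ⬝ᵥ (M *ᵥ x)).re := by
    intro x
    have := hquad x
    rwa [inv_mul_le_iff₀ (by positivity)] at this
  obtain ⟨i₀, hi₀⟩ : ∃ i, ‖u‖ = ‖u i‖ := by
    obtain ⟨i, -, hi⟩ := Finset.exists_mem_eq_sup (Finset.univ : Finset (Fin T))
      Finset.univ_nonempty fun i => ‖u i‖₊
    refine ⟨i, ?_⟩
    rw [← coe_nnnorm, ← coe_nnnorm, Pi.nnnorm_def, hi]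
  rw [hi₀]
  rcases h.2 with rfl | hd
  · have h1 := hq' (star u)
    have h2 : nform 2 M u = (star (star u) ⬝ᵥ (M *ᵥ star u)).re := by
      rw [nform, sform, star_star]
      congr 3
      funext k; simp [vspow, spow_two_sub_one]
    rw [h2]
    refine le_trans ?_ h1
    have := Finset.single_le_sum (f := fun k => ‖(star u) k‖ ^ 2) (fun i _ => by positivity)
      (Finset.mem_univ i₀)
    simpa using this
  · have hdd : ∀ k, 1 ≤ w ^ (α - 1) * (M k k).re := by
      intro k
      have h1 := hq' (Pi.single k 1)
      have h2 : star (Pi.single k (1 : ℂ)) ⬝ᵥ (M *ᵥ Pi.single k 1) = M k k := by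
        rw [← Pi.single_star]
        simp
      rw [h2] at h1
      refine le_trans ?_ h1
      have := Finset.single_le_sum (f := fun l => ‖(Pi.single k (1 : ℂ) : Fin T → ℂ) l‖ ^ 2)
        (fun i _ => by positivity) (Finset.mem_univ k)
      simpa using this
    have h3 : nform α M u = ∑ k, (M k k).re * ‖u k‖ ^ α := by
      rw [nform, ← hd.diagonal_diag, sform_diagonal, Complex.re_sum, hd.diagonal_diag]
      refine Finset.sum_congr rfl fun k _ => ?_
      rw [mul_spow_self (by linarith), mul_comm, Complex.re_ofReal_mul, mul_comm]
      rfl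
    rw [h3, Finset.mul_sum]
    have hnn : ∀ k, ‖u k‖ ^ α ≤ w ^ (α - 1) * ((M k k).re * ‖u k‖ ^ α) := fun k => by
      rw [← mul_assoc]
      exact le_mul_of_one_le_left (by positivity) (hdd k)
    refine (hnn i₀).trans (Finset.single_le_sum (f := fun k => w ^ (α - 1) * ((M k k).re * ‖u k‖ ^ α))
      (fun i _ => ?_) (Finset.mem_univ i₀))
    exact le_trans (by positivity) (hnn i)

end LowerBound

/-! ### Moving a representing measure to the unit sphere. -/

section Normalization

variable {α : ℝ} {n : ℕ}

lemma realPairing_neg (t x : Fin n → ℂ) : realPairing t (fun j => -x j) = -realPairing t x := by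
  simp [realPairing]

lemma realPairing_smul (t x : Fin n → ℂ) (r : ℝ) :
    realPairing t (fun j => (r : ℂ) * x j) = r * realPairing t x := by
  simp only [realPairing]
  rw [← Complex.re_ofReal_mul, Finset.mul_sum]
  congr 1
  exact Finset.sum_congr rfl fun j _ => by ring

@[fun_prop]
lemma continuous_realPairing (t : Fin n → ℂ) : Continuous (realPairing t) := by
  unfold realPairing
  fun_prop

lemma lintegral_eq_of_integrable_ofReal {E : Type*} [MeasurableSpace E] {μ : Measure E} {G : E → ℝ}
    (hG : Measurable G) (h0 : ∀ x, 0 ≤ G x) :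
    ∫ x, G x ∂μ = (∫⁻ x, ENNReal.ofReal (G x) ∂μ).toReal :=
  integral_eq_lintegral_of_nonneg_ae (ae_of_all _ h0) hG.aestronglyMeasurable

/-- Every finite measure with finite moment of order `α` can be moved to the unit sphere. -/
lemma exists_normalized_measure {E : Type*} [MeasurableSpace E] (hα : 0 < α) (μ : Measure E)
    (φ : E → EuclideanSpace ℂ (Fin n)) (hφ : Measurable φ)
    (hint : Integrable (fun e => ‖φ e‖ ^ α) μ) :
    ∃ Γ : Measure (EuclideanSpace ℂ (Fin n)), IsFiniteMeasure Γ ∧ Γ (Metric.sphere 0 1)ᶜ = 0 ∧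
      Γ.map (fun x => -x) = Γ ∧
      ∀ t : Fin n → ℂ, ∫ x, |realPairing t (fun j => x j)| ^ α ∂Γ =
        ∫ e, |realPairing t (fun j => φ e j)| ^ α ∂μ := by
  have hd : Measurable fun e => ENNReal.ofReal (‖φ e‖ ^ α) :=
    (hφ.norm.pow_const α).ennreal_ofReal
  -- Weighting by `‖φ‖ ^ α` and projecting radially keeps the integrals of `|⟨t, ·⟩| ^ α`, which are
  -- homogeneous of degree `α`. Points with `φ = 0` receive weight zero, so the default value of
  -- their projection does not matter.
  set ν₀ := μ.withDensity fun e => ENNReal.ofReal (‖φ e‖ ^ α) with hν₀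
  have hν₀f : IsFiniteMeasure ν₀ := isFiniteMeasure_withDensity_ofReal hint.2
  have hnm : Measurable fun e => ‖φ e‖⁻¹ • φ e := hφ.norm.inv.smul hφ
  set ν := ν₀.map fun e => ‖φ e‖⁻¹ • φ e with hν
  have hνf : IsFiniteMeasure ν := Measure.isFiniteMeasure_map _ _
  have hneg : Measurable fun x : EuclideanSpace ℂ (Fin n) => -x := measurable_neg
  have hsph : ν (Metric.sphere 0 1)ᶜ = 0 := by
    rw [hν, Measure.map_apply hnm Metric.isClosed_sphere.measurableSet.compl, hν₀,
      withDensity_apply_eq_zero' hd.aemeasurable]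
    convert measure_empty (μ := μ) using 2
    ext e
    simp only [mem_inter_iff, mem_preimage, mem_compl_iff, mem_sphere_zero_iff_norm,
      mem_empty_iff_false, iff_false, not_and]
    intro h1 h2
    apply h2
    have h3 : ‖φ e‖ ≠ 0 := by
      intro h0
      apply h1
      simp [h0, Real.zero_rpow hα.ne']
    rw [norm_smul, norm_inv, norm_norm, inv_mul_cancel₀ h3]
  have hsph' : (ν.map fun x => -x) (Metric.sphere 0 1)ᶜ = 0 := by
    rw [Measure.map_apply hneg Metric.isClosed_sphere.measurableSet.compl]
    convert hsph using 2
    ext x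
    simp
  -- Averaging with the reflected measure makes it symmetric; the exponent is even and does not
  -- change.
  refine ⟨(2⁻¹ : ℝ≥0∞) • (ν + ν.map fun x => -x), ?_, ?_, ?_, fun t => ?_⟩
  · have : IsFiniteMeasure (ν.map fun x => -x) := Measure.isFiniteMeasure_map _ _
    exact Measure.smul_finite _ (by simp)
  · simp [hsph, hsph']
  · rw [Measure.map_smul, Measure.map_add _ _ hneg, Measure.map_map hneg hneg]
    have : ((fun x : EuclideanSpace ℂ (Fin n) => -x) ∘ fun x => -x) = id := by
      funext x; simp
    rw [this, Measure.map_id, add_comm]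
  · have hG : Measurable fun x : EuclideanSpace ℂ (Fin n) => |realPairing t (fun j => x j)| ^ α := by
      have : Measurable fun x : EuclideanSpace ℂ (Fin n) => realPairing t (fun j => x j) :=
        ((continuous_realPairing t).comp (by fun_prop)).measurable
      exact (this.norm).pow_const α
    have hG' : Measurable fun e => |realPairing t (fun j => φ e j)| ^ α := hG.comp hφ
    rw [lintegral_eq_of_integrable_ofReal hG (fun x => by positivity),
      lintegral_eq_of_integrable_ofReal hG' (fun x => by positivity)]
    congr 1
    rw [lintegral_smul_measure, lintegral_add_measure, lintegral_map hG.ennreal_ofReal hneg]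
    have hev : ∀ x : EuclideanSpace ℂ (Fin n), |realPairing t (fun j => (-x) j)| =
        |realPairing t (fun j => x j)| := fun x => by
      simp only [PiLp.neg_apply]
      rw [realPairing_neg, abs_neg]
    simp_rw [hev]
    rw [← two_mul, smul_eq_mul, ← mul_assoc, ENNReal.inv_mul_cancel (by simp) (by simp), one_mul,
      hν, lintegral_map hG.ennreal_ofReal hnm, hν₀,
      lintegral_withDensity_eq_lintegral_mul _ hd
        (g := fun e => ENNReal.ofReal (|realPairing t fun j => (‖φ e‖⁻¹ • φ e) j| ^ α))
        (hG.comp hnm).ennreal_ofReal]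
    refine lintegral_congr fun e => ?_
    simp only [Pi.mul_apply, PiLp.smul_apply, Complex.real_smul]
    rw [← ENNReal.ofReal_mul (by positivity)]
    congr 1
    rw [realPairing_smul, abs_mul, abs_of_nonneg (inv_nonneg.2 (norm_nonneg _)),
      Real.mul_rpow (by positivity) (abs_nonneg _), ← mul_assoc,
      ← Real.mul_rpow (norm_nonneg _) (by positivity)]
    rcases eq_or_ne (φ e) 0 with h0 | h0
    · simp [h0, realPairing, Real.zero_rpow hα.ne']
    · rw [mul_inv_cancel₀ (norm_ne_zero_iff.2 h0), Real.one_rpow, one_mul]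

end Normalization

/-! ### A single stable variable: its norm is determined by its law. -/

section Scalar

variable {Ω : Type*} [MeasurableSpace Ω] {α : ℝ} {P : Measure Ω} {X Y : Ω → ℂ}

/-- A representation of the characteristic function of a complex symmetric `α`-stable random
variable by a measure on the plane that need not live on the unit circle. -/
structure ScalarRep (α : ℝ) (P : Measure Ω) (X : Ω → ℂ) (Γ : Measure ℂ) : Prop where
  aemeasurable : AEMeasurable X P
  finite : IsFiniteMeasure Γ
  integrable : Integrable (fun x => ‖x‖ ^ α) Γ
  charFun : ∀ t : ℂ, ∫ ω, Complex.exp (Complex.I * (((starRingEnd ℂ) t * X ω).re : ℂ)) ∂P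
    = Complex.exp (-((∫ x, |((starRingEnd ℂ) t * x).re| ^ α ∂Γ : ℝ) : ℂ))

/-- `X` is symmetric `α`-stable with `‖X‖_α ^ α = r`. -/
def IsSaS (α : ℝ) (P : Measure Ω) (X : Ω → ℂ) (r : ℝ) : Prop :=
  ∃ Γ, ScalarRep α P X Γ ∧ ∫ x, ‖x‖ ^ α ∂Γ = r

lemma abs_re_conj_mul_rpow_le (hα : 0 < α) (t x : ℂ) :
    |((starRingEnd ℂ) t * x).re| ^ α ≤ ‖t‖ ^ α * ‖x‖ ^ α := by
  rw [← Real.mul_rpow (norm_nonneg _) (norm_nonneg _)]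
  refine Real.rpow_le_rpow (abs_nonneg _) ?_ hα.le
  refine (Complex.abs_re_le_norm _).trans ?_
  rw [norm_mul, RCLike.norm_conj]

lemma measurable_abs_re_conj_mul_rpow (t : ℂ) :
    Measurable fun x : ℂ => |((starRingEnd ℂ) t * x).re| ^ α := by
  have : Measurable fun x : ℂ => ((starRingEnd ℂ) t * x).re := by fun_prop
  exact this.norm.pow_const α

lemma ScalarRep.integrable_re {Γ : Measure ℂ} (hα : 0 < α) (h : ScalarRep α P X Γ) (t : ℂ) :
    Integrable (fun x => |((starRingEnd ℂ) t * x).re| ^ α) Γ := by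
  refine (h.integrable.const_mul (‖t‖ ^ α)).mono'
    (measurable_abs_re_conj_mul_rpow t).aestronglyMeasurable (ae_of_all _ fun x => ?_)
  rw [Real.norm_of_nonneg (by positivity)]
  exact abs_re_conj_mul_rpow_le hα t x

/-- The mean over the unit circle of the directional powers. -/
lemma integral_abs_re_rpow (α : ℝ) (z : ℂ) :
    ∫ φ in (-Real.pi)..Real.pi, |((starRingEnd ℂ) (Complex.exp (φ * Complex.I)) * z).re| ^ α =
      (∫ φ in (-Real.pi)..Real.pi, |Real.cos φ| ^ α) * ‖z‖ ^ α := by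
  have h1 : ∀ φ : ℝ, |((starRingEnd ℂ) (Complex.exp (φ * Complex.I)) * z).re| ^ α =
      |Real.cos (φ - z.arg)| ^ α * ‖z‖ ^ α := by
    intro φ
    have hz : z = ‖z‖ * Complex.exp (z.arg * Complex.I) := (Complex.norm_mul_exp_arg_mul_I z).symm
    have e1 : (starRingEnd ℂ) (Complex.exp (φ * Complex.I)) * z =
        ‖z‖ * Complex.exp (((z.arg - φ : ℝ) : ℂ) * Complex.I) := by
      nth_rewrite 1 [hz]
      rw [← Complex.exp_conj, mul_left_comm, ← Complex.exp_add]
      congr 2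
      simp
      ring
    rw [e1, Complex.re_ofReal_mul, Complex.exp_ofReal_mul_I_re, abs_mul, abs_norm,
      Real.mul_rpow (norm_nonneg _) (abs_nonneg _), mul_comm, ← Real.cos_neg, neg_sub]
  simp_rw [h1]
  rw [intervalIntegral.integral_mul_const]
  congr 1
  have hper : Function.Periodic (fun φ : ℝ => |Real.cos φ| ^ α) (2 * Real.pi) := by
    intro φ; simp [Real.cos_add_two_pi]
  rw [intervalIntegral.integral_comp_sub_right (fun φ => |Real.cos φ| ^ α)]
  have := hper.intervalIntegral_add_eq (-Real.pi - z.arg) (-Real.pi)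
  convert this using 2 <;> ring

lemma integral_abs_cos_rpow_pos (α : ℝ) (hα : 0 < α) :
    0 < ∫ φ in (-Real.pi)..Real.pi, |Real.cos φ| ^ α := by
  have hc : Continuous fun φ : ℝ => |Real.cos φ| ^ α :=
    Real.continuous_cos.abs.rpow_const fun _ => Or.inr hα.le
  refine intervalIntegral.integral_pos (by linarith [Real.pi_pos]) hc.continuousOn
    (fun x _ => by positivity) ⟨0, ⟨by linarith [Real.pi_pos], Real.pi_pos.le⟩, by simp⟩

/-- The exponent of the characteristic function, averaged over all directions, is a fixed positive
multiple of `∫ ‖x‖ ^ α dΓ`, by Fubini and the rotation invariance in `integral_abs_re_rpow`. -/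
lemma ScalarRep.integral_norm_rpow {Γ : Measure ℂ} (hα : 0 < α) (h : ScalarRep α P X Γ) :
    (∫ φ in (-Real.pi)..Real.pi, |Real.cos φ| ^ α) * ∫ x, ‖x‖ ^ α ∂Γ =
      ∫ φ in (-Real.pi)..Real.pi,
        ∫ x, |((starRingEnd ℂ) (Complex.exp (φ * Complex.I)) * x).re| ^ α ∂Γ := by
  have := h.finite
  rw [← integral_const_mul]
  simp_rw [← integral_abs_re_rpow α _]
  have hm : Measurable fun q : ℝ × ℂ =>
      |((starRingEnd ℂ) (Complex.exp (q.1 * Complex.I)) * q.2).re| ^ α := by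
    have : Continuous fun q : ℝ × ℂ =>
      ((starRingEnd ℂ) (Complex.exp (q.1 * Complex.I)) * q.2).re := by fun_prop
    exact this.measurable.norm.pow_const α
  have h1 : Integrable (fun q : ℝ × ℂ => ‖q.2‖ ^ α)
      ((volume.restrict (Ioc (-Real.pi) Real.pi)).prod Γ) := by
    have := (integrable_const (μ := volume.restrict (Ioc (-Real.pi) Real.pi)) (1 : ℝ)).mul_prod
      h.integrable
    simpa using this
  have h2 : Integrable (fun q : ℝ × ℂ =>
      |((starRingEnd ℂ) (Complex.exp (q.1 * Complex.I)) * q.2).re| ^ α)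
      ((volume.restrict (Ioc (-Real.pi) Real.pi)).prod Γ) := by
    refine h1.mono' hm.aestronglyMeasurable (ae_of_all _ fun q => ?_)
    rw [Real.norm_of_nonneg (by positivity)]
    refine (abs_re_conj_mul_rpow_le hα _ _).trans (le_of_eq ?_)
    rw [Complex.norm_exp_ofReal_mul_I, Real.one_rpow, one_mul]
  simp_rw [intervalIntegral.integral_of_le (by linarith [Real.pi_pos] : -Real.pi ≤ Real.pi)]
  exact (integral_integral_swap (f := fun φ x =>
    |((starRingEnd ℂ) (Complex.exp ((φ : ℝ) * Complex.I)) * x).re| ^ α) h2).symm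

lemma ScalarRep.exponent_unique {Γ Γ' : Measure ℂ} (h : ScalarRep α P X Γ)
    (h' : ScalarRep α P X Γ') (t : ℂ) :
    ∫ x, |((starRingEnd ℂ) t * x).re| ^ α ∂Γ = ∫ x, |((starRingEnd ℂ) t * x).re| ^ α ∂Γ' := by
  have h1 := (h.charFun t).symm.trans (h'.charFun t)
  rw [← Complex.ofReal_neg, ← Complex.ofReal_neg, ← Complex.ofReal_exp, ← Complex.ofReal_exp,
    Complex.ofReal_inj] at h1
  exact neg_injective (Real.exp_injective h1)

/-- Two representing measures have the same exponents, hence the same directional average.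
Uniqueness of the spectral measure itself is never needed, although `covariation` uses an
arbitrarily chosen one. -/
lemma IsSaS.unique {r r' : ℝ} (hα : 0 < α) (h : IsSaS α P X r) (h' : IsSaS α P X r') : r = r' := by
  obtain ⟨Γ, hΓ, rfl⟩ := h
  obtain ⟨Γ', hΓ', rfl⟩ := h'
  have h1 := hΓ.integral_norm_rpow hα
  have h2 := hΓ'.integral_norm_rpow hα
  simp_rw [hΓ.exponent_unique hΓ'] at h1
  exact mul_left_cancel₀ (integral_abs_cos_rpow_pos α hα).ne' (h1.trans h2.symm)

lemma IsSaS.aemeasurable {r : ℝ} (h : IsSaS α P X r) : AEMeasurable X P := by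
  obtain ⟨Γ, hΓ, -⟩ := h
  exact hΓ.aemeasurable

lemma IsSaS.nonneg {r : ℝ} (h : IsSaS α P X r) : 0 ≤ r := by
  obtain ⟨Γ, -, rfl⟩ := h
  exact integral_nonneg fun x => by positivity

end Scalar

/-! ### Linear images of jointly stable vectors. -/

section Joint

variable {Ω : Type*} [MeasurableSpace Ω] {α : ℝ} {P : Measure Ω} {n m : ℕ} {X : Fin n → Ω → ℂ}

lemma norm_euclidean_ae_eq_one {Γ : Measure (EuclideanSpace ℂ (Fin n))}
    (h : IsSpectralMeasure α P X Γ) : ∀ᵐ x ∂Γ, ‖x‖ = 1 := by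
  rw [ae_iff]
  convert h.sphere using 2
  ext x; simp

lemma realPairing_linear (L : Matrix (Fin m) (Fin n) ℂ) (t : Fin m → ℂ) (x : Fin n → ℂ) :
    realPairing t (L *ᵥ x) = realPairing (Lᴴ *ᵥ t) x := by
  simp only [realPairing]
  congr 1
  have h1 : ∑ j, (starRingEnd ℂ) (t j) * (L *ᵥ x) j = star t ⬝ᵥ (L *ᵥ x) := rfl
  have h2 : ∑ j, (starRingEnd ℂ) ((Lᴴ *ᵥ t) j) * x j = star (Lᴴ *ᵥ t) ⬝ᵥ x := rfl
  rw [h1, h2, Matrix.star_mulVec, Matrix.conjTranspose_conjTranspose, Matrix.dotProduct_mulVec]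

/-- Linear images of jointly symmetric `α`-stable variables are jointly symmetric `α`-stable. -/
lemma JointlySaS.linear (hα : 0 < α) (h : JointlySaS α P X) (L : Matrix (Fin m) (Fin n) ℂ) :
    JointlySaS α P (fun i ω => ∑ j, L i j * X j ω) := by
  obtain ⟨hX, Γ, hΓ⟩ := h
  have := hΓ.finite
  refine ⟨fun i => Finset.aemeasurable_fun_sum _ fun j _ => (hX j).const_mul _, ?_⟩
  have hc : Continuous fun x : EuclideanSpace ℂ (Fin n) =>
      (WithLp.toLp 2 (L *ᵥ WithLp.ofLp x) : EuclideanSpace ℂ (Fin m)) := by fun_prop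
  obtain ⟨C, hC⟩ := (isCompact_sphere (0 : EuclideanSpace ℂ (Fin n)) 1).exists_bound_of_continuousOn
    hc.continuousOn
  have hint : Integrable (fun x : EuclideanSpace ℂ (Fin n) =>
      ‖(WithLp.toLp 2 (L *ᵥ WithLp.ofLp x) : EuclideanSpace ℂ (Fin m))‖ ^ α) Γ := by
    refine Integrable.mono' (integrable_const (C ^ α))
      (hc.measurable.norm.pow_const α).aestronglyMeasurable ?_
    filter_upwards [norm_euclidean_ae_eq_one hΓ] with x hx
    rw [Real.norm_of_nonneg (by positivity)]
    exact Real.rpow_le_rpow (norm_nonneg _) (hC x (by simpa using hx)) hα.le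
  obtain ⟨Γ', h1, h2, h3, h4⟩ := exists_normalized_measure hα Γ _ hc.measurable hint
  refine ⟨Γ', h1, h2, h3, fun t => ?_⟩
  rw [h4]
  have e1 : ∀ ω, realPairing t (fun i => ∑ j, L i j * X j ω) =
      realPairing (Lᴴ *ᵥ t) (fun j => X j ω) := fun ω => realPairing_linear L t _
  have e2 : ∀ x : EuclideanSpace ℂ (Fin n), realPairing t
      (fun j => (WithLp.toLp 2 (L *ᵥ WithLp.ofLp x) : EuclideanSpace ℂ (Fin m)) j) =
      realPairing (Lᴴ *ᵥ t) (fun j => x j) := fun x => realPairing_linear L t _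
  simp_rw [e1, e2]
  exact hΓ.charFun _

lemma realPairing_mul_conj (t : ℂ) (u x : Fin n → ℂ) :
    realPairing (fun j => t * (starRingEnd ℂ) (u j)) x = ((starRingEnd ℂ) t * ∑ j, u j * x j).re := by
  simp only [realPairing]
  rw [Finset.mul_sum]
  congr 1
  exact Finset.sum_congr rfl fun j _ => by simp; ring

/-- A linear functional of a jointly stable vector, represented by the image of the spectral
measure. -/
lemma IsSpectralMeasure.scalarRep (hα : 0 < α) {Γ : Measure (EuclideanSpace ℂ (Fin n))}
    (hX : ∀ j, AEMeasurable (X j) P) (h : IsSpectralMeasure α P X Γ) (u : Fin n → ℂ) :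
    ScalarRep α P (fun ω => ∑ j, u j * X j ω) (Γ.map fun x => ∑ j, u j * x j) := by
  have := h.finite
  have hc : Continuous fun x : EuclideanSpace ℂ (Fin n) => ∑ j, u j * x j := by fun_prop
  obtain ⟨C, hC⟩ := (isCompact_sphere (0 : EuclideanSpace ℂ (Fin n)) 1).exists_bound_of_continuousOn
    hc.continuousOn
  have hnm : Measurable fun x : ℂ => ‖x‖ ^ α := measurable_norm.pow_const α
  refine ⟨Finset.aemeasurable_fun_sum _ fun j _ => (hX j).const_mul _,
    Measure.isFiniteMeasure_map _ _, ?_, fun t => ?_⟩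
  · rw [integrable_map_measure hnm.aestronglyMeasurable hc.measurable.aemeasurable]
    refine Integrable.mono' (integrable_const (C ^ α))
      (hnm.comp hc.measurable).aestronglyMeasurable ?_
    filter_upwards [norm_euclidean_ae_eq_one h] with x hx
    simp only [Function.comp]
    rw [Real.norm_of_nonneg (by positivity)]
    exact Real.rpow_le_rpow (norm_nonneg _) (hC x (by simpa using hx)) hα.le
  · rw [integral_map hc.measurable.aemeasurable
      (measurable_abs_re_conj_mul_rpow t).aestronglyMeasurable]
    simp_rw [← realPairing_mul_conj]
    exact h.charFun _

lemma IsSpectralMeasure.isSaS (hα : 0 < α) {Γ : Measure (EuclideanSpace ℂ (Fin n))}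
    (hX : ∀ j, AEMeasurable (X j) P) (h : IsSpectralMeasure α P X Γ) (u : Fin n → ℂ) :
    IsSaS α P (fun ω => ∑ j, u j * X j ω) (∫ x, ‖∑ j, u j * x j‖ ^ α ∂Γ) := by
  refine ⟨_, h.scalarRep hα hX u, ?_⟩
  rw [integral_map (Continuous.aemeasurable (by fun_prop))
    (measurable_norm.pow_const α).aestronglyMeasurable]

lemma JointlySaS.exists_isSaS (hα : 0 < α) (h : JointlySaS α P X) (u : Fin n → ℂ) :
    ∃ r, IsSaS α P (fun ω => ∑ j, u j * X j ω) r := by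
  obtain ⟨hX, Γ, hΓ⟩ := h
  exact ⟨_, hΓ.isSaS hα hX u⟩

end Joint

/-! ### The norm as a covariation, and the subgradient inequality. -/

section Norm

variable {Ω : Type*} [MeasurableSpace Ω] {α : ℝ} {P : Measure Ω} {X Y : Ω → ℂ} {r : ℝ}

lemma IsSaS.jointlySaS (hα : 0 < α) (h : IsSaS α P X r) : JointlySaS α P ![X] := by
  obtain ⟨Γ, hΓ, -⟩ := h
  have hm : Measurable fun x : ℂ => (!₂[x] : EuclideanSpace ℂ (Fin 1)) := by
    have : Continuous fun x : ℂ => (!₂[x] : EuclideanSpace ℂ (Fin 1)) := by fun_prop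
    exact this.measurable
  obtain ⟨Γ', h1, h2, h3, h4⟩ := exists_normalized_measure hα Γ _ hm (by
    simpa [EuclideanSpace.norm_eq] using hΓ.integrable)
  refine ⟨fun j => by fin_cases j; exact hΓ.aemeasurable, Γ', h1, h2, h3, fun t => ?_⟩
  rw [h4]
  simpa [realPairing] using hΓ.charFun (t 0)

lemma jointlySaS_single_iff (hα : 0 < α) : JointlySaS α P ![X] ↔ ∃ r, IsSaS α P X r := by
  refine ⟨fun h => ?_, fun ⟨r, h⟩ => h.jointlySaS hα⟩
  obtain ⟨r, hr⟩ := h.exists_isSaS hα (fun _ => 1)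
  exact ⟨r, by simpa using hr⟩

lemma IsSaS.covariation_self (hα : 0 < α) (h : IsSaS α P X r) : covariation α P X X = r := by
  have hj := (h.jointlySaS hα).linear hα (Matrix.of ![![1], ![1]])
  have hfun : (fun (i : Fin 2) ω => ∑ j, (Matrix.of ![![(1 : ℂ)], ![1]]) i j * (![X] : Fin 1 → Ω → ℂ) j ω)
      = ![X, X] := by
    funext i ω
    fin_cases i <;> simp
  rw [hfun] at hj
  rw [covariation, dif_pos hj.2]
  set Γ := hj.2.choose
  have hΓ : IsSpectralMeasure α P ![X, X] Γ := hj.2.choose_spec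
  have hfin := hΓ.finite
  -- In the direction `(s, -s)` the vector `(X, X)` has characteristic function `1`, so the exponent
  -- vanishes there. With `s = 1` and `s = i` the chosen spectral measure is seen to live on the
  -- diagonal `x 0 = x 1`.
  have hzero : ∀ s : ℂ, ∀ᵐ x ∂Γ, ((starRingEnd ℂ) s * (x 0 - x 1)).re = 0 := by
    intro s
    have h1 := (hΓ.scalarRep hα hj.1 ![1, -1]).integrable_re hα s
    have h2 := hΓ.charFun ![s, -s]
    have e1 : ∀ ω, realPairing ![s, -s] (fun j => (![X, X] : Fin 2 → Ω → ℂ) j ω) = 0 := by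
      intro ω; simp [realPairing, Fin.sum_univ_two]
    have e2 : ∀ x : EuclideanSpace ℂ (Fin 2), realPairing ![s, -s] (fun j => x j) =
        ((starRingEnd ℂ) s * (x 0 - x 1)).re := by
      intro x; simp [realPairing, Fin.sum_univ_two, mul_sub]; ring
    simp_rw [e1, e2] at h2
    rw [integrable_map_measure (measurable_abs_re_conj_mul_rpow s).aestronglyMeasurable
      (Continuous.aemeasurable (by fun_prop))] at h1
    have h1' : Integrable (fun x : EuclideanSpace ℂ (Fin 2) =>
        |((starRingEnd ℂ) s * (x 0 - x 1)).re| ^ α) Γ := by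
      refine h1.congr (ae_of_all _ fun x => ?_)
      simp [Fin.sum_univ_two, sub_eq_add_neg]
    -- The characteristic function at `0` shows that `P` has total mass one.
    have hz : ∫ ω, (1 : ℂ) ∂P = 1 := by
      have h3 := hΓ.charFun 0
      simpa [realPairing, Real.zero_rpow hα.ne'] using h3
    have h3 : ∫ x : EuclideanSpace ℂ (Fin 2), |((starRingEnd ℂ) s * (x 0 - x 1)).re| ^ α ∂Γ = 0 := by
      simp only [Complex.ofReal_zero, mul_zero, Complex.exp_zero] at h2
      rw [hz, ← Complex.ofReal_neg, ← Complex.ofReal_exp, ← Complex.ofReal_one, Complex.ofReal_inj,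
        eq_comm, Real.exp_eq_one_iff, neg_eq_zero] at h2
      exact h2
    rw [integral_eq_zero_iff_of_nonneg (fun x => by positivity) h1'] at h3
    filter_upwards [h3] with x hx
    simpa using (Real.rpow_eq_zero (abs_nonneg _) hα.ne').1 hx
  have heq : ∀ᵐ x ∂Γ, x 0 = x 1 := by
    filter_upwards [hzero 1, hzero Complex.I] with x h1 h2
    rw [← sub_eq_zero]
    exact Complex.ext (by simpa using h1) (by simpa using h2)
  have h1 : ∫ x, x 0 * spow (α - 1) (x 1) ∂Γ = ((∫ x, ‖x 0‖ ^ α ∂Γ : ℝ) : ℂ) := by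
    rw [← integral_complex_ofReal]
    refine integral_congr_ae (heq.mono fun x hx => ?_)
    simp only
    rw [← hx, mul_spow_self hα]
  rw [h1]
  have h2 := hΓ.isSaS hα hj.1 ![1, 0]
  simp only [Fin.sum_univ_two, Matrix.cons_val_zero, Matrix.cons_val_one, one_mul, zero_mul,
    add_zero] at h2
  rw [h.unique hα h2]

lemma IsSaS.alphaNorm_eq (hα : 0 < α) (h : IsSaS α P X r) : alphaNorm α P X = r ^ (1 / α) := by
  rw [alphaNorm, h.covariation_self hα, Complex.ofReal_re]

lemma IsSaS.alphaNorm_rpow (hα : 0 < α) (h : IsSaS α P X r) : alphaNorm α P X ^ α = r := by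
  rw [h.alphaNorm_eq hα, ← Real.rpow_mul h.nonneg, one_div_mul_cancel hα.ne', Real.rpow_one]

/-- The subgradient inequality for the covariation. -/
lemma covariation_subgradient (hα : 1 < α) (h : JointlySaS α P ![X, Y]) :
    (covariation α P Y Y).re + α * (covariation α P X Y).re ≤
      (covariation α P (X + Y) (X + Y)).re := by
  have hα0 : 0 < α := by linarith
  have hcov : covariation α P X Y = ∫ x, x 0 * spow (α - 1) (x 1) ∂h.2.choose := by
    rw [covariation, dif_pos h.2]
  set Γ := h.2.choose
  have hΓ : IsSpectralMeasure α P ![X, Y] Γ := h.2.choose_spec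
  have hfin := hΓ.finite
  have hY := hΓ.isSaS hα0 h.1 ![0, 1]
  have hXY := hΓ.isSaS hα0 h.1 ![1, 1]
  simp only [Fin.sum_univ_two, Matrix.cons_val_zero, Matrix.cons_val_one, one_mul, zero_mul,
    zero_add] at hY hXY
  have hY' := hY.covariation_self hα0
  have hXY' := hXY.covariation_self hα0
  change covariation α P Y Y = _ at hY'
  change covariation α P (X + Y) (X + Y) = _ at hXY'
  rw [hY', hXY', hcov, Complex.ofReal_re, Complex.ofReal_re]
  -- On the unit sphere both coordinates have modulus at most one, so every integrand below is
  -- bounded.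
  have hbdd : ∀ᵐ x ∂Γ, ‖x 0‖ ≤ 1 ∧ ‖x 1‖ ≤ 1 := by
    filter_upwards [norm_euclidean_ae_eq_one hΓ] with x hx
    rw [← hx]
    exact ⟨PiLp.norm_apply_le x 0, PiLp.norm_apply_le x 1⟩
  have hcs := continuous_spow (β := α - 1) (by linarith)
  have hcr : Continuous fun z : ℂ => ‖z‖ ^ α := continuous_norm.rpow_const fun _ => Or.inr hα0.le
  have i1 : Integrable (fun x : EuclideanSpace ℂ (Fin 2) => x 0 * spow (α - 1) (x 1)) Γ := by
    refine Integrable.mono' (integrable_const 1)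
      (Continuous.aestronglyMeasurable (by fun_prop)) ?_
    filter_upwards [hbdd] with x hx
    rw [norm_mul, norm_spow (by linarith)]
    exact mul_le_one₀ hx.1 (by positivity) (Real.rpow_le_one (norm_nonneg _) hx.2 (by linarith))
  have i2 : Integrable (fun x : EuclideanSpace ℂ (Fin 2) => ‖x 1‖ ^ α) Γ := by
    refine Integrable.mono' (integrable_const 1)
      (hcr.comp (by fun_prop)).aestronglyMeasurable ?_
    filter_upwards [hbdd] with x hx
    rw [Real.norm_of_nonneg (by positivity)]
    exact Real.rpow_le_one (norm_nonneg _) hx.2 (by linarith)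
  have i3 : Integrable (fun x : EuclideanSpace ℂ (Fin 2) => ‖x 0 + x 1‖ ^ α) Γ := by
    refine Integrable.mono' (integrable_const (2 ^ α))
      (hcr.comp (f := fun x : EuclideanSpace ℂ (Fin 2) => x 0 + x 1)
        (by fun_prop)).aestronglyMeasurable ?_
    filter_upwards [hbdd] with x hx
    rw [Real.norm_of_nonneg (by positivity)]
    refine Real.rpow_le_rpow (norm_nonneg _) ?_ hα0.le
    linarith [norm_add_le (x 0) (x 1), hx.1, hx.2]
  have i4 : Integrable (fun x : EuclideanSpace ℂ (Fin 2) => (x 0 * spow (α - 1) (x 1)).re) Γ := i1.re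
  have e : (∫ x, x 0 * spow (α - 1) (x 1) ∂Γ).re = ∫ x, (x 0 * spow (α - 1) (x 1)).re ∂Γ :=
    (integral_re i1).symm
  rw [e, ← integral_const_mul, ← integral_add i2 (i4.const_mul α)]
  -- The scalar subgradient inequality is integrated against one joint spectral measure of `(X, Y)`;
  -- it represents `Y` and `X + Y` as well.
  refine integral_mono (i2.add (i4.const_mul α)) i3 fun x => ?_
  have := norm_rpow_subgradient hα (x 1) (x 0 + x 1)
  simpa using this

end Norm

/-! ### Sums of independent stable variables. -/

section Sums

variable {Ω : Type*} [MeasurableSpace Ω] {α : ℝ} {P : Measure Ω} {ι : Type*} [Fintype ι]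

/-- Sums of independent symmetric `α`-stable variables: the powers of the norms add up. -/
lemma IsSaS.sum (hα : 0 < α) {X : ι → Ω → ℂ} {r : ι → ℝ} (hind : iIndepFun X P)
    (h : ∀ i, IsSaS α P (X i) (r i)) : IsSaS α P (fun ω => ∑ i, X i ω) (∑ i, r i) := by
  choose Γ hΓ hr using h
  have hfin : ∀ i, IsFiniteMeasure (Γ i) := fun i => (hΓ i).finite
  -- Independence multiplies characteristic functions and so adds exponents. The representing
  -- measures can be added as they are, since `ScalarRep` does not ask them to live on a circle.
  refine ⟨Measure.sum Γ, ⟨?_, inferInstance, ?_, fun t => ?_⟩, ?_⟩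
  · exact Finset.aemeasurable_fun_sum _ fun i _ => (hΓ i).aemeasurable
  · rw [Measure.sum_fintype, integrable_finsetSum_measure]
    exact fun i _ => (hΓ i).integrable
  · rw [Measure.sum_fintype, integral_finsetSum_measure fun i _ => (hΓ i).integrable_re hα t]
    push_cast
    rw [← Finset.sum_neg_distrib, Complex.exp_sum]
    simp_rw [← (hΓ _).charFun t]
    have hmeas : Measurable fun x : ℂ =>
        Complex.exp (Complex.I * (((starRingEnd ℂ) t * x).re : ℂ)) := by fun_prop
    rw [← hind.integral_fun_prod_comp (f := fun _ x =>
      Complex.exp (Complex.I * (((starRingEnd ℂ) t * x).re : ℂ)))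
      (fun i => (hΓ i).aemeasurable) (fun i => hmeas.aestronglyMeasurable)]
    congr 1
    funext ω
    rw [← Complex.exp_sum, ← Finset.mul_sum, Finset.mul_sum Finset.univ _ ((starRingEnd ℂ) t),
      Complex.re_sum]
    push_cast
    rfl
  · rw [Measure.sum_fintype, integral_finsetSum_measure fun i _ => (hΓ i).integrable]
    exact Finset.sum_congr rfl fun i _ => hr i

lemma IsSaS.add [IsProbabilityMeasure P] (hα : 0 < α) {X Y : Ω → ℂ} {r s : ℝ}
    (hind : IndepFun X Y P) (hX : IsSaS α P X r) (hY : IsSaS α P Y s) :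
    IsSaS α P (X + Y) (r + s) := by
  obtain ⟨Γ, hΓ, rfl⟩ := hX
  obtain ⟨Γ', hΓ', rfl⟩ := hY
  have := hΓ.finite
  have := hΓ'.finite
  refine ⟨Γ + Γ', ⟨hΓ.aemeasurable.add hΓ'.aemeasurable, inferInstance,
    hΓ.integrable.add_measure hΓ'.integrable, fun t => ?_⟩,
    integral_add_measure hΓ.integrable hΓ'.integrable⟩
  rw [integral_add_measure (hΓ.integrable_re hα t) (hΓ'.integrable_re hα t)]
  push_cast
  rw [neg_add, Complex.exp_add, ← hΓ.charFun t, ← hΓ'.charFun t]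
  have hmeas : Measurable fun x : ℂ =>
      Complex.exp (Complex.I * (((starRingEnd ℂ) t * x).re : ℂ)) := by fun_prop
  have h1 := (hind.comp hmeas hmeas).integral_fun_mul_eq_mul_integral
    (hmeas.comp_aemeasurable hΓ.aemeasurable).aestronglyMeasurable
    (hmeas.comp_aemeasurable hΓ'.aemeasurable).aestronglyMeasurable
  simp only [Function.comp_def] at h1
  rw [← h1]
  congr 1
  funext ω
  rw [← Complex.exp_add, ← mul_add, Pi.add_apply, mul_add, Complex.add_re]
  push_cast
  rfl

end Sums

/-! ### Convergence in probability and convergence of the norms. -/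

section Limits

variable {Ω : Type*} [MeasurableSpace Ω] {α : ℝ} {P : Measure Ω} {X : Ω → ℂ} {r : ℝ}

/-- The spectral measure of a single variable on the unit circle. -/
lemma IsSaS.exists_circle (hα : 0 < α) (h : IsSaS α P X r) :
    ∃ Γ, ScalarRep α P X Γ ∧ Γ (Metric.sphere 0 1)ᶜ = 0 ∧ Γ.real univ = r := by
  obtain ⟨hX, Γ₀, hΓ₀⟩ := h.jointlySaS hα
  have hrep := hΓ₀.scalarRep hα hX (fun _ => 1)
  have hc : Continuous fun x : EuclideanSpace ℂ (Fin 1) => ∑ j, (1 : ℂ) * x j := by fun_prop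
  have hrep' : ScalarRep α P X (Γ₀.map fun x => ∑ j, (1 : ℂ) * x j) := by simpa using hrep
  have hs : (Γ₀.map fun x => ∑ j, (1 : ℂ) * x j) (Metric.sphere 0 1)ᶜ = 0 := by
    rw [Measure.map_apply hc.measurable Metric.isClosed_sphere.measurableSet.compl]
    convert hΓ₀.sphere using 2
    ext x
    simp [EuclideanSpace.norm_eq]
  refine ⟨_, hrep', hs, ?_⟩
  have h1 : IsSaS α P X (∫ x, ‖x‖ ^ α ∂(Γ₀.map fun x => ∑ j, (1 : ℂ) * x j)) := ⟨_, hrep', rfl⟩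
  rw [h.unique hα h1]
  have h2 : ∀ᵐ x ∂(Γ₀.map fun x => ∑ j, (1 : ℂ) * x j), ‖x‖ ^ α = 1 := by
    have : ∀ᵐ x ∂(Γ₀.map fun x => ∑ j, (1 : ℂ) * x j), x ∈ Metric.sphere (0 : ℂ) 1 := hs
    filter_upwards [this] with x hx
    rw [mem_sphere_zero_iff_norm.1 hx, Real.one_rpow]
  rw [integral_congr_ae h2]
  simp

lemma ScalarRep.exponent_le {Γ : Measure ℂ} (hα : 0 < α) (h : ScalarRep α P X Γ) (t : ℂ) :
    ∫ x, |((starRingEnd ℂ) t * x).re| ^ α ∂Γ ≤ ‖t‖ ^ α * ∫ x, ‖x‖ ^ α ∂Γ := by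
  rw [← integral_const_mul]
  exact integral_mono (h.integrable_re hα t) (h.integrable.const_mul _)
    fun x => abs_re_conj_mul_rpow_le hα t x

lemma ScalarRep.charFun_map {Γ : Measure ℂ} (h : ScalarRep α P X Γ) (t : ℂ) :
    MeasureTheory.charFun (P.map X) t =
      Complex.exp (-((∫ x, |((starRingEnd ℂ) t * x).re| ^ α ∂Γ : ℝ) : ℂ)) := by
  rw [charFun_apply, integral_map h.aemeasurable
    (Continuous.aestronglyMeasurable (by fun_prop)), ← h.charFun t]
  congr 1
  funext ω
  rw [mul_comm, Complex.inner]
  congr 3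
  simp

/-- The tail is bounded by the mean of `1 - charFun` over `|t| ≤ 2/δ`, where `1 - exp (-σ) ≤ σ ≤
(2/δ) ^ α r`. -/
lemma IsSaS.measureReal_inner_le [IsProbabilityMeasure P] (hα : 0 < α) (h : IsSaS α P X r)
    {a : ℂ} (ha : ‖a‖ = 1) {δ : ℝ} (hδ : 0 < δ) :
    P.real {ω | δ < |inner ℝ a (X ω)|} ≤ 2 * (2 / δ) ^ α * r := by
  have hr0 := h.nonneg
  obtain ⟨Γ, hΓ, hr⟩ := h
  have : IsProbabilityMeasure (P.map X) := Measure.isProbabilityMeasure_map hΓ.aemeasurable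
  have h1 := measureReal_abs_inner_gt_le_integral_charFun (μ := P.map X) (a := a) hδ
  have h2 : (P.map X).real {x | δ < |inner ℝ a x|} = P.real {ω | δ < |inner ℝ a (X ω)|} := by
    rw [measureReal_def, measureReal_def, Measure.map_apply_of_aemeasurable hΓ.aemeasurable]
    · rfl
    · have hc : Continuous fun x : ℂ => |inner ℝ a x| := by fun_prop
      exact (isOpen_lt continuous_const hc).measurableSet
  rw [h2] at h1
  refine h1.trans ?_
  have h3 : ‖∫ t in -2 * δ⁻¹..2 * δ⁻¹, 1 - MeasureTheory.charFun (P.map X) (t • a)‖ ≤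
      ((2 / δ) ^ α * r) * |2 * δ⁻¹ - -2 * δ⁻¹| := by
    refine intervalIntegral.norm_integral_le_of_norm_le_const fun t ht => ?_
    have ht' : |t| ≤ 2 / δ := by
      have hd : 0 < δ⁻¹ := by positivity
      rw [uIoc_of_le (by nlinarith)] at ht
      rw [div_eq_mul_inv, abs_le]
      constructor <;> linarith [ht.1, ht.2]
    rw [hΓ.charFun_map, ← Complex.ofReal_neg, ← Complex.ofReal_exp, ← Complex.ofReal_one,
      ← Complex.ofReal_sub, Complex.norm_real, Real.norm_eq_abs]
    set σ := ∫ x, |((starRingEnd ℂ) (t • a) * x).re| ^ α ∂Γ with hσ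
    have hσ0 : 0 ≤ σ := integral_nonneg fun x => by positivity
    have hσ1 : σ ≤ (2 / δ) ^ α * r := by
      refine (hΓ.exponent_le hα _).trans ?_
      rw [hr, norm_smul, ha, mul_one, Real.norm_eq_abs]
      gcongr
    rw [abs_of_nonneg (by linarith [Real.exp_le_one_iff.2 (neg_nonpos.2 hσ0)])]
    linarith [Real.add_one_le_exp (-σ)]
  calc 2⁻¹ * δ * ‖∫ t in -2 * δ⁻¹..2 * δ⁻¹, 1 - MeasureTheory.charFun (P.map X) (t • a)‖
      ≤ 2⁻¹ * δ * (((2 / δ) ^ α * r) * |2 * δ⁻¹ - -2 * δ⁻¹|) := by gcongr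
    _ = 2 * (2 / δ) ^ α * r := by
      rw [abs_of_nonneg (by have : 0 < δ⁻¹ := by positivity
                            linarith)]
      field_simp
      ring

/-- A tail bound for symmetric `α`-stable variables. -/
lemma IsSaS.measureReal_norm_le [IsProbabilityMeasure P] (hα : 0 < α) (h : IsSaS α P X r)
    {ε : ℝ} (hε : 0 < ε) : P.real {ω | ε ≤ ‖X ω‖} ≤ 4 * (8 / ε) ^ α * r := by
  have h1 := h.measureReal_inner_le hα (a := 1) (by simp) (δ := ε / 4) (by positivity)
  have h2 := h.measureReal_inner_le hα (a := Complex.I) (by simp) (δ := ε / 4) (by positivity)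
  have h3 : {ω | ε ≤ ‖X ω‖} ⊆ {ω | ε / 4 < |inner ℝ (1 : ℂ) (X ω)|} ∪
      {ω | ε / 4 < |inner ℝ Complex.I (X ω)|} := by
    intro ω hω
    simp only [mem_ofPred_eq] at hω
    by_contra hc
    simp only [mem_union, mem_ofPred_eq, not_or, not_lt, Complex.inner] at hc
    have h4 := Complex.norm_le_abs_re_add_abs_im (X ω)
    have h5 : |(X ω).re| ≤ ε / 4 := by simpa using hc.1
    have h6 : |(X ω).im| ≤ ε / 4 := by simpa using hc.2
    linarith
  refine (measureReal_mono h3).trans ((measureReal_union_le _ _).trans ?_)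
  have e : (2 : ℝ) / (ε / 4) = 8 / ε := by field_simp; norm_num
  rw [e] at h1 h2
  linarith

lemma tendstoInMeasure_of_isSaS [IsProbabilityMeasure P] (hα : 0 < α) {ι : Type*} {l : Filter ι}
    {X : ι → Ω → ℂ} {Y : Ω → ℂ} {r : ι → ℝ} (h : ∀ i, IsSaS α P (X i - Y) (r i))
    (hr : Tendsto r l (𝓝 0)) : TendstoInMeasure P X l Y := by
  rw [tendstoInMeasure_iff_measureReal_norm]
  intro ε hε
  have h1 : Tendsto (fun i => 4 * (8 / ε) ^ α * r i) l (𝓝 0) := by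
    simpa using hr.const_mul (4 * (8 / ε) ^ α)
  exact tendsto_of_tendsto_of_tendsto_of_le_of_le tendsto_const_nhds h1
    (fun i => measureReal_nonneg) fun i => (h i).measureReal_norm_le hα hε

lemma tendsto_integral_exp [IsProbabilityMeasure P] {ι : Type*} {l : Filter ι}
    {X : ι → Ω → ℂ} {Y : Ω → ℂ} (hX : ∀ i, AEMeasurable (X i) P) (hY : AEMeasurable Y P)
    (h : TendstoInMeasure P X l Y) (t : ℂ) :
    Tendsto (fun i => ∫ ω, Complex.exp (Complex.I * (((starRingEnd ℂ) t * X i ω).re : ℂ)) ∂P) l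
      (𝓝 (∫ ω, Complex.exp (Complex.I * (((starRingEnd ℂ) t * Y ω).re : ℂ)) ∂P)) := by
  rw [tendstoInMeasure_iff_measureReal_norm] at h
  rw [Metric.tendsto_nhds]
  intro ε hε
  -- Where `‖X i - Y‖ < δ` the exponentials differ by at most `‖t‖ δ ≤ ε/2`; on the remaining set,
  -- of measure below `ε/4`, they differ by at most `2`.
  set δ := ε / (2 * (‖t‖ + 1)) with hδ
  have hδ0 : 0 < δ := by positivity
  have h1 := (h δ hδ0).eventually (gt_mem_nhds (show (0 : ℝ) < ε / 4 by positivity))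
  filter_upwards [h1] with i hi
  have hmeas : Measurable fun x : ℂ =>
      Complex.exp (Complex.I * (((starRingEnd ℂ) t * x).re : ℂ)) := by fun_prop
  have hone : ∀ z : ℂ, ‖Complex.exp (Complex.I * (((starRingEnd ℂ) t * z).re : ℂ))‖ = 1 := by
    intro z; rw [mul_comm, Complex.norm_exp_ofReal_mul_I]
  have hint : ∀ Z : Ω → ℂ, AEMeasurable Z P → Integrable (fun ω =>
      Complex.exp (Complex.I * (((starRingEnd ℂ) t * Z ω).re : ℂ))) P := fun Z hZ =>
    Integrable.of_bound (hmeas.comp_aemeasurable hZ).aestronglyMeasurable 1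
      (ae_of_all _ fun ω => (hone _).le)
  rw [dist_eq_norm, ← integral_sub (hint _ (hX i)) (hint _ hY)]
  have hset : NullMeasurableSet {ω | δ ≤ ‖X i ω - Y ω‖} P :=
    nullMeasurableSet_le aemeasurable_const ((hX i).sub hY).norm
  have hbound : ∀ ω, ‖Complex.exp (Complex.I * (((starRingEnd ℂ) t * X i ω).re : ℂ)) -
      Complex.exp (Complex.I * (((starRingEnd ℂ) t * Y ω).re : ℂ))‖ ≤
      ‖t‖ * δ + {ω | δ ≤ ‖X i ω - Y ω‖}.indicator (fun _ => (2 : ℝ)) ω := by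
    intro ω
    by_cases hω : δ ≤ ‖X i ω - Y ω‖
    · rw [indicator_of_mem (by exact hω)]
      refine (norm_sub_le _ _).trans ?_
      rw [hone, hone]
      have : 0 ≤ ‖t‖ * δ := by positivity
      linarith
    · rw [indicator_of_notMem (by exact hω), add_zero]
      push Not at hω
      have e : Complex.exp (Complex.I * (((starRingEnd ℂ) t * X i ω).re : ℂ)) -
          Complex.exp (Complex.I * (((starRingEnd ℂ) t * Y ω).re : ℂ)) =
          Complex.exp (Complex.I * (((starRingEnd ℂ) t * Y ω).re : ℂ)) *
          (Complex.exp (Complex.I * (((starRingEnd ℂ) t * (X i ω - Y ω)).re : ℂ)) - 1) := by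
        rw [mul_sub, ← Complex.exp_add, ← mul_add, mul_sub, Complex.sub_re]
        push_cast
        ring_nf
      rw [e, norm_mul, hone, one_mul]
      refine (Real.norm_exp_I_mul_ofReal_sub_one_le).trans ?_
      rw [Real.norm_eq_abs]
      refine (Complex.abs_re_le_norm _).trans ?_
      rw [norm_mul, RCLike.norm_conj]
      gcongr
  refine (norm_integral_le_of_norm_le (((integrable_const _).add
    ((integrable_const (2 : ℝ)).indicator₀ hset))) (ae_of_all _ hbound)).trans_lt ?_
  rw [integral_add' (integrable_const _) ((integrable_const (2 : ℝ)).indicator₀ hset),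
    integral_indicator₀ hset]
  simp only [integral_const, probReal_univ, smul_eq_mul, one_mul,
    measureReal_restrict_apply_univ]
  have h2 : ‖t‖ * δ ≤ ε / 2 := by
    rw [hδ, mul_div_assoc', div_le_div_iff₀ (by positivity) (by positivity)]
    nlinarith [norm_nonneg t]
  linarith

lemma norm_rpow_le_re_im (hα : 0 < α) (z : ℂ) : ‖z‖ ^ α ≤ 2 ^ α * (|z.re| ^ α + |z.im| ^ α) := by
  have h1 : ‖z‖ ≤ 2 * max |z.re| |z.im| := by
    have := Complex.norm_le_abs_re_add_abs_im z
    have h2 := le_max_left |z.re| |z.im|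
    have h3 := le_max_right |z.re| |z.im|
    linarith
  have h0 : 0 ≤ max |z.re| |z.im| := le_max_of_le_left (abs_nonneg _)
  calc ‖z‖ ^ α ≤ (2 * max |z.re| |z.im|) ^ α := by gcongr
    _ = 2 ^ α * (max |z.re| |z.im|) ^ α := Real.mul_rpow (by norm_num) h0
    _ ≤ _ := by
      gcongr
      have h2 : 0 ≤ |z.re| ^ α := by positivity
      have h3 : 0 ≤ |z.im| ^ α := by positivity
      rcases max_choice |z.re| |z.im| with h | h <;> rw [h] <;> linarith

lemma tendsto_exponent_zero {ι : Type*} {l : Filter ι} {σ : ι → ℝ}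
    (h : Tendsto (fun i => Complex.exp (-(σ i : ℂ))) l (𝓝 1)) : Tendsto σ l (𝓝 0) := by
  have h1 : Tendsto (fun i => Real.exp (-σ i)) l (𝓝 1) := by
    have := (Complex.continuous_re.tendsto 1).comp h
    refine (by simpa using this : Tendsto _ l (𝓝 (1 : ℝ))).congr fun i => ?_
    simp only [Function.comp]
    rw [← Complex.ofReal_neg, ← Complex.ofReal_exp, Complex.ofReal_re]
  have h2 := (Real.continuousAt_log one_ne_zero).tendsto.comp h1
  have h3 : Tendsto (fun i => -σ i) l (𝓝 0) := by
    refine (by simpa using h2 : Tendsto _ l (𝓝 (0 : ℝ))).congr fun i => ?_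
    simp [Function.comp]
  simpa using h3.neg

/-- Convergence to zero in probability of stable variables implies convergence of the norms. -/
lemma tendsto_of_tendstoInMeasure_zero [IsProbabilityMeasure P] (hα : 0 < α) {ι : Type*}
    {l : Filter ι} {X : ι → Ω → ℂ} {r : ι → ℝ} (h : ∀ i, IsSaS α P (X i) (r i))
    (hX : TendstoInMeasure P X l 0) : Tendsto r l (𝓝 0) := by
  have h0 : ∀ i, 0 ≤ r i := fun i => (h i).nonneg
  have hm : ∀ i, AEMeasurable (X i) P := fun i => (h i).aemeasurable
  choose Γ hΓ hr using h
  have hσ : ∀ t : ℂ, Tendsto (fun i => ∫ x, |((starRingEnd ℂ) t * x).re| ^ α ∂(Γ i)) l (𝓝 0) := by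
    intro t
    apply tendsto_exponent_zero
    have := tendsto_integral_exp hm (Y := 0) aemeasurable_zero hX t
    simp_rw [(hΓ _).charFun t] at this
    simpa using this
  -- The two directions `1` and `i` control the whole norm, by `norm_rpow_le_re_im`.
  have h1 : Tendsto (fun i => 2 ^ α * ((∫ x, |((starRingEnd ℂ) 1 * x).re| ^ α ∂(Γ i)) +
      ∫ x, |((starRingEnd ℂ) Complex.I * x).re| ^ α ∂(Γ i))) l (𝓝 0) := by
    simpa using ((hσ 1).add (hσ Complex.I)).const_mul (2 ^ α)
  refine tendsto_of_tendsto_of_tendsto_of_le_of_le tendsto_const_nhds h1 h0 fun i => ?_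
  simp only
  rw [← hr i, ← integral_add ((hΓ i).integrable_re hα _) ((hΓ i).integrable_re hα _),
    ← integral_const_mul]
  refine integral_mono (hΓ i).integrable ((((hΓ i).integrable_re hα _).add
    ((hΓ i).integrable_re hα _)).const_mul _) fun x => ?_
  have := norm_rpow_le_re_im hα x
  simpa using this

/-- Limits in probability of symmetric `α`-stable variables with convergent norms. -/
lemma IsSaS.of_tendstoInMeasure [IsProbabilityMeasure P] (hα : 0 < α) {ι : Type*} {l : Filter ι}
    [l.NeBot] {X : ι → Ω → ℂ} {Y : Ω → ℂ} {r : ι → ℝ} {s : ℝ} (h : ∀ i, IsSaS α P (X i) (r i))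
    (hY : AEMeasurable Y P) (hX : TendstoInMeasure P X l Y) (hr : Tendsto r l (𝓝 s)) :
    IsSaS α P Y s := by
  have hm : ∀ i, AEMeasurable (X i) P := fun i => (h i).aemeasurable
  choose Γ hΓ hs hmass using fun i => (h i).exists_circle hα
  have hfin : ∀ i, IsFiniteMeasure (Γ i) := fun i => (hΓ i).finite
  let γ : ι → FiniteMeasure ℂ := fun i => ⟨Γ i, hfin i⟩
  -- The spectral measures on the circle eventually have bounded mass, and such measures form a
  -- compact set. Convergence along an ultrafilter finer than `l` is enough to produce a spectral
  -- measure of `Y`.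
  let U := Ultrafilter.of l
  have hU : (U : Filter ι) ≤ l := Ultrafilter.of_le l
  have hs0 : 0 ≤ s := ge_of_tendsto hr (Eventually.of_forall fun i => (h i).nonneg)
  let C : NNReal := ⟨s + 1, by linarith⟩
  have hK := isCompact_setOfPred_finiteMeasure_le_of_isCompact C (isCompact_sphere (0 : ℂ) 1)
  have hmem : ∀ᶠ i in (U : Filter ι), γ i ∈
      {μ : FiniteMeasure ℂ | μ.mass ≤ C ∧ μ (Metric.sphere (0 : ℂ) 1)ᶜ = 0} := by
    have h1 := (hr.mono_left hU).eventually (gt_mem_nhds (show s < s + 1 by linarith))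
    filter_upwards [h1] with i hi
    refine ⟨?_, ?_⟩
    · rw [← NNReal.coe_le_coe]
      change (Γ i).real univ ≤ s + 1
      rw [hmass i]
      exact hi.le
    · rw [FiniteMeasure.null_iff_toMeasure_null]
      exact hs i
  obtain ⟨γ₀, ⟨-, hγ₀s⟩, hlim⟩ := hK.ultrafilter_le_nhds (U.map γ) (le_principal_iff.2 hmem)
  have hlim' : Tendsto γ U (𝓝 γ₀) := hlim
  rw [FiniteMeasure.tendsto_iff_forall_integral_tendsto] at hlim'
  rw [FiniteMeasure.null_iff_toMeasure_null] at hγ₀s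
  have hsph₀ : ∀ᵐ x ∂(γ₀ : Measure ℂ), ‖x‖ = 1 := by
    have : ∀ᵐ x ∂(γ₀ : Measure ℂ), x ∈ Metric.sphere (0 : ℂ) 1 := hγ₀s
    exact this.mono fun x hx => mem_sphere_zero_iff_norm.1 hx
  have hsph : ∀ i, ∀ᵐ x ∂(Γ i), ‖x‖ = 1 := by
    intro i
    have : ∀ᵐ x ∂(Γ i), x ∈ Metric.sphere (0 : ℂ) 1 := hs i
    exact this.mono fun x hx => mem_sphere_zero_iff_norm.1 hx
  have hnorm₀ : ∀ᵐ x ∂(γ₀ : Measure ℂ), ‖x‖ ^ α = 1 :=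
    hsph₀.mono fun x hx => by rw [hx, Real.one_rpow]
  refine ⟨γ₀, ⟨hY, inferInstance, ?_, fun t => ?_⟩, ?_⟩
  · exact (integrable_const (1 : ℝ)).congr (hnorm₀.mono fun x hx => hx.symm)
  -- The truncation makes the exponent a bounded test function and changes nothing on the unit
  -- circle.
  · let G : BoundedContinuousFunction ℂ ℝ := BoundedContinuousFunction.ofNormedAddCommGroup
      (fun x => min (|((starRingEnd ℂ) t * x).re| ^ α) (‖t‖ ^ α))
      (by
        have h1 : Continuous fun x : ℂ => |((starRingEnd ℂ) t * x).re| ^ α :=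
          Continuous.rpow_const (by fun_prop) fun _ => Or.inr hα.le
        exact h1.min continuous_const) (‖t‖ ^ α)
      (fun x => by
        rw [Real.norm_of_nonneg (le_min (by positivity) (by positivity))]
        exact min_le_right _ _)
    have hG : ∀ x : ℂ, ‖x‖ = 1 → G x = |((starRingEnd ℂ) t * x).re| ^ α := by
      intro x hx
      refine min_eq_left ((abs_re_conj_mul_rpow_le hα t x).trans ?_)
      rw [hx, Real.one_rpow, mul_one]
    have h1 := hlim' G
    have h2 : ∫ x, G x ∂(γ₀ : Measure ℂ) = ∫ x, |((starRingEnd ℂ) t * x).re| ^ α ∂(γ₀ : Measure ℂ) :=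
      integral_congr_ae (hsph₀.mono hG)
    have h3 : ∀ i, ∫ x, G x ∂(γ i : Measure ℂ) = ∫ x, |((starRingEnd ℂ) t * x).re| ^ α ∂(Γ i) :=
      fun i => integral_congr_ae ((hsph i).mono hG)
    rw [h2] at h1
    simp_rw [h3] at h1
    have h4 := tendsto_integral_exp hm hY (hX.mono hU) t
    simp_rw [(hΓ _).charFun t] at h4
    have h5 : Continuous fun x : ℝ => Complex.exp (-(x : ℂ)) := by fun_prop
    exact tendsto_nhds_unique h4 ((h5.tendsto _).comp h1)
  · rw [integral_congr_ae hnorm₀]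
    have h1 := hlim' (BoundedContinuousFunction.const ℂ 1)
    simp only [BoundedContinuousFunction.const_apply, integral_const, smul_eq_mul, mul_one] at h1 ⊢
    have h2 : ∀ i, (γ i : Measure ℂ).real univ = r i := hmass
    simp_rw [h2] at h1
    exact tendsto_nhds_unique h1 (hr.mono_left hU)

/-- Borel–Cantelli: almost surely all but finitely many increments are below `2^{-n}`, so the
sequence is Cauchy. -/
lemma exists_tendsto_ae_of_fast [IsProbabilityMeasure P] {Y : ℕ → Ω → ℂ}
    (h : ∀ n, P {ω | (1 / 2 : ℝ) ^ n ≤ ‖Y (n + 1) ω - Y n ω‖} ≤ (1 / 2 : ℝ≥0∞) ^ n) :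
    ∀ᵐ ω ∂P, ∃ y, Tendsto (fun n => Y n ω) atTop (𝓝 y) := by
  have hsum : ∑' n, P {ω | (1 / 2 : ℝ) ^ n ≤ ‖Y (n + 1) ω - Y n ω‖} ≠ ∞ := by
    refine ne_top_of_le_ne_top ?_ (ENNReal.tsum_le_tsum h)
    rw [ENNReal.tsum_geometric]
    norm_num
  filter_upwards [ae_eventually_notMem hsum] with ω hω
  refine cauchySeq_tendsto_of_complete ?_
  refine cauchySeq_of_summable_dist ?_
  refine Summable.of_norm_bounded_eventually_nat (g := fun n : ℕ => (1 / 2 : ℝ) ^ n)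
    (summable_geometric_of_lt_one (by norm_num) (by norm_num)) ?_
  filter_upwards [hω] with n hn
  simp only [not_le] at hn
  rw [Real.norm_of_nonneg dist_nonneg, dist_comm, dist_eq_norm]
  exact hn.le

end Limits

/-! ### The functional `lpow` on `L^α(f)`. -/

section Lpow

variable {T : ℕ} {α : ℝ} {f g : ℝ → Matrix (Fin T) (Fin T) ℂ} {u v : ℝ → Fin T → ℂ}

/-- An integrable density with stable values. -/
structure IsDensity (α : ℝ) (f : ℝ → Matrix (Fin T) (Fin T) ℂ) : Prop where
  integrable : ∀ k l, Integrable (fun θ => f θ k l) lebPi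
  stable : ∀ᵐ θ ∂lebPi, StableMatrix α (f θ)

lemma IsDensity.add (hf : IsDensity α f) (hg : IsDensity α g) : IsDensity α (f + g) := by
  refine ⟨fun k l => (hf.integrable k l).add (hg.integrable k l), ?_⟩
  filter_upwards [hf.stable, hg.stable] with θ h1 h2
  exact h1.add h2

lemma StableMatrix.nform_smul {M : Matrix (Fin T) (Fin T) ℂ} (hα : 1 < α) (h : StableMatrix α M)
    (c : ℂ) (u : Fin T → ℂ) : nform α M (c • u) = ‖c‖ ^ α * nform α M u := by
  obtain ⟨B, -, -, h2⟩ := h.exists_nform_factor hα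
  rw [h2, h2, Finset.mul_sum]
  refine Finset.sum_congr rfl fun k _ => ?_
  rw [Matrix.mulVec_smul, Pi.smul_apply, norm_smul, Real.mul_rpow (norm_nonneg _) (norm_nonneg _)]

lemma norm_sform_le_of_norm_le (hα : 1 < α) (M : Matrix (Fin T) (Fin T) ℂ) (u v : Fin T → ℂ) :
    ‖sform α M u v‖ ≤ (∑ k, ∑ l, ‖M k l‖) * (‖u‖ * ‖v‖ ^ (α - 1)) := by
  rw [sform_eq_sum, Finset.sum_mul]
  refine (norm_sum_le _ _).trans (Finset.sum_le_sum fun k _ => ?_)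
  rw [Finset.sum_mul]
  refine (norm_sum_le _ _).trans (Finset.sum_le_sum fun l _ => ?_)
  rw [norm_mul, norm_mul, norm_spow (by linarith), mul_left_comm]
  have h1 := norm_le_pi_norm u k
  have h2 := norm_le_pi_norm v l
  have : 0 ≤ α - 1 := by linarith
  gcongr

lemma abs_nform_le (hα : 1 < α) (M : Matrix (Fin T) (Fin T) ℂ) (u : Fin T → ℂ) :
    |nform α M u| ≤ (∑ k, ∑ l, ‖M k l‖) * ‖u‖ ^ α := by
  refine (Complex.abs_re_le_norm _).trans ((norm_sform_le_of_norm_le hα M u u).trans (le_of_eq ?_))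
  congr 1
  rcases eq_or_ne ‖u‖ 0 with h | h
  · rw [h, zero_mul, Real.zero_rpow (by linarith)]
  · rw [Real.rpow_sub (by positivity), Real.rpow_one]
    field_simp

lemma aestronglyMeasurable_sform (hf : ∀ k l, Integrable (fun θ => f θ k l) lebPi)
    (hu : AEStronglyMeasurable u lebPi) (hv : AEStronglyMeasurable v lebPi) :
    AEStronglyMeasurable (fun θ => sform α (f θ) (u θ) (v θ)) lebPi := by
  simp_rw [sform_eq_sum]
  have hu' : ∀ k, AEMeasurable (fun θ => u θ k) lebPi := fun k => hu.aemeasurable.eval k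
  have hv' : ∀ k, AEMeasurable (fun θ => v θ k) lebPi := fun k => hv.aemeasurable.eval k
  refine AEMeasurable.aestronglyMeasurable ?_
  refine Finset.aemeasurable_fun_sum _ fun k _ => Finset.aemeasurable_fun_sum _ fun l _ => ?_
  exact (hu' k).mul ((hf k l).aemeasurable.mul ((measurable_spow (α - 1)).comp_aemeasurable (hv' l)))

lemma aemeasurable_nform (hf : ∀ k l, Integrable (fun θ => f θ k l) lebPi)
    (hu : AEStronglyMeasurable u lebPi) :
    AEMeasurable (fun θ => nform α (f θ) (u θ)) lebPi :=
  Complex.measurable_re.comp_aemeasurable (aestronglyMeasurable_sform hf hu hu).aemeasurable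

lemma lpow_eq (α : ℝ) (f : ℝ → Matrix (Fin T) (Fin T) ℂ) (u : ℝ → Fin T → ℂ) :
    lpow α f u = ∫⁻ θ, ENNReal.ofReal (nform α (f θ) (u θ)) ∂lebPi := rfl

lemma lpow_add_density (hα : 1 < α) (hf : IsDensity α f) (hg : IsDensity α g)
    (hu : AEStronglyMeasurable u lebPi) : lpow α (f + g) u = lpow α f u + lpow α g u := by
  simp_rw [lpow_eq]
  rw [← lintegral_add_left' (aemeasurable_nform hf.integrable hu).ennreal_ofReal]
  refine lintegral_congr_ae ?_
  filter_upwards [hf.stable, hg.stable] with θ h1 h2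
  rw [Pi.add_apply, nform_add_mat, ENNReal.ofReal_add (h1.nform_nonneg hα _) (h2.nform_nonneg hα _)]

lemma lpow_neg (u : ℝ → Fin T → ℂ) : lpow α f (-u) = lpow α f u := by
  simp [lpow_eq, nform_neg]

lemma lpow_sub_comm (u v : ℝ → Fin T → ℂ) : lpow α f (u - v) = lpow α f (v - u) := by
  rw [← lpow_neg, neg_sub]

lemma lpow_zero : lpow α f 0 = 0 := by
  simp [lpow_eq, nform_zero]

lemma lpow_congr (h : u =ᵐ[lebPi] v) : lpow α f u = lpow α f v :=
  lintegral_congr_ae (h.mono fun θ hθ => by simp only [hθ])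

lemma lpow_smul (hα : 1 < α) (hf : IsDensity α f) (c : ℂ) (u : ℝ → Fin T → ℂ) :
    lpow α f (c • u) = ENNReal.ofReal (‖c‖ ^ α) * lpow α f u := by
  rw [lpow_eq, lpow_eq, ← lintegral_const_mul' _ _ ENNReal.ofReal_ne_top]
  refine lintegral_congr_ae ?_
  filter_upwards [hf.stable] with θ h1
  rw [Pi.smul_apply, h1.nform_smul hα, ENNReal.ofReal_mul (by positivity)]

lemma exists_lpow_add_le (T : ℕ) (hα : 1 < α) {ε : ℝ} (hε : 0 < ε) :
    ∃ K : ℝ, 0 ≤ K ∧ ∀ (f : ℝ → Matrix (Fin T) (Fin T) ℂ) (u v : ℝ → Fin T → ℂ), IsDensity α f →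
      AEStronglyMeasurable u lebPi →
      lpow α f (u + v) ≤ ENNReal.ofReal (1 + ε) * lpow α f u + ENNReal.ofReal K * lpow α f v := by
  obtain ⟨K, hK, h⟩ := exists_nform_add_le (T := T) hα hε
  refine ⟨K, hK, fun f u v hf hu => ?_⟩
  simp_rw [lpow_eq]
  have hm := (aemeasurable_nform (α := α) hf.integrable hu).ennreal_ofReal
  rw [← lintegral_const_mul' _ _ ENNReal.ofReal_ne_top,
    ← lintegral_const_mul' _ _ ENNReal.ofReal_ne_top, ← lintegral_add_left' (hm.const_mul _)]
  refine lintegral_mono_ae ?_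
  filter_upwards [hf.stable] with θ h1
  rw [← ENNReal.ofReal_mul (by positivity), ← ENNReal.ofReal_mul hK,
    ← ENNReal.ofReal_add (mul_nonneg (by positivity) (h1.nform_nonneg hα _))
      (mul_nonneg hK (h1.nform_nonneg hα _))]
  exact ENNReal.ofReal_le_ofReal (h _ h1 _ _)

lemma exists_lpow_add_le_mul (T : ℕ) (hα : 1 < α) :
    ∃ K : ℝ≥0∞, K ≠ ∞ ∧ ∀ (f : ℝ → Matrix (Fin T) (Fin T) ℂ) (u v : ℝ → Fin T → ℂ), IsDensity α f →
      AEStronglyMeasurable u lebPi → lpow α f (u + v) ≤ K * (lpow α f u + lpow α f v) := by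
  obtain ⟨K, hK, h⟩ := exists_lpow_add_le T hα one_pos
  refine ⟨ENNReal.ofReal (1 + 1) + ENNReal.ofReal K, by simp, fun f u v hf hu => ?_⟩
  refine (h f u v hf hu).trans ?_
  rw [mul_add]
  gcongr
  · exact le_self_add
  · exact le_add_self

/-- Continuity of the norm, from the inequality with factor `1 + ε` applied in both directions. -/
lemma tendsto_lpow_of_sub (hα : 1 < α) (hf : IsDensity α f) {ι : Type*} {l : Filter ι}
    {w : ι → ℝ → Fin T → ℂ} (hu : AEStronglyMeasurable u lebPi)
    (hw : ∀ i, AEStronglyMeasurable (w i) lebPi) (hfin : lpow α f u < ∞)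
    (h : Tendsto (fun i => lpow α f (u - w i)) l (𝓝 0)) :
    Tendsto (fun i => lpow α f (w i)) l (𝓝 (lpow α f u)) := by
  set L := lpow α f u with hL
  have key : ∀ ε : ℝ, 0 < ε → ∀ᶠ i in l,
      lpow α f (w i) ≤ ENNReal.ofReal (1 + ε) * L + ENNReal.ofReal ε ∧
      L ≤ ENNReal.ofReal (1 + ε) * lpow α f (w i) + ENNReal.ofReal ε := by
    intro ε hε
    obtain ⟨K, hK, hKle⟩ := exists_lpow_add_le T hα hε
    have h1 : Tendsto (fun i => ENNReal.ofReal K * lpow α f (u - w i)) l (𝓝 0) := by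
      have := ENNReal.Tendsto.const_mul (a := ENNReal.ofReal K) h (Or.inr ENNReal.ofReal_ne_top)
      simpa using this
    filter_upwards [h1.eventually (gt_mem_nhds (ENNReal.ofReal_pos.2 hε))] with i hi
    constructor
    · have h2 := hKle f u (w i - u) hf hu
      rw [add_sub_cancel, lpow_sub_comm] at h2
      exact h2.trans (by gcongr)
    · have h2 := hKle f (w i) (u - w i) hf (hw i)
      rw [add_sub_cancel] at h2
      exact h2.trans (by gcongr)
  have hfinev : ∀ᶠ i in l, lpow α f (w i) ≠ ∞ := by
    filter_upwards [key 1 one_pos] with i hi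
    exact ne_top_of_le_ne_top (by finiteness) hi.1
  rw [← ENNReal.ofReal_toReal hfin.ne]
  have hreal : Tendsto (fun i => (lpow α f (w i)).toReal) l (𝓝 L.toReal) := by
    rw [Metric.tendsto_nhds]
    intro δ hδ
    set A := L.toReal with hA
    have hA0 : 0 ≤ A := ENNReal.toReal_nonneg
    -- Since `ε ≤ 1` gives `b ≤ 2A + 1`, both errors `ε A + ε` and `ε b + ε` are at most `ε (2A + 2)
    -- ≤ δ/2`.
    set ε := min 1 (δ / (2 * (2 * A + 2))) with hε
    have hε0 : 0 < ε := by positivity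
    have hε1 : ε ≤ 1 := min_le_left _ _
    have hε2 : ε * (2 * A + 2) ≤ δ / 2 := by
      have : ε ≤ δ / (2 * (2 * A + 2)) := min_le_right _ _
      rw [le_div_iff₀ (by positivity)] at this
      linarith
    filter_upwards [key ε hε0, hfinev] with i hi hfi
    have h1 := ENNReal.toReal_mono (by finiteness) hi.1
    have h2 := ENNReal.toReal_mono (by finiteness) hi.2
    rw [ENNReal.toReal_add (by finiteness) (by finiteness), ENNReal.toReal_mul,
      ENNReal.toReal_ofReal (by positivity), ENNReal.toReal_ofReal hε0.le] at h1 h2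
    rw [← hA] at h1 h2
    set b := (lpow α f (w i)).toReal
    have hb0 : 0 ≤ b := ENNReal.toReal_nonneg
    rw [Real.dist_eq, abs_lt]
    have hb : b ≤ 2 * A + 1 := by nlinarith
    constructor <;> nlinarith
  refine (ENNReal.tendsto_ofReal hreal).congr' ?_
  filter_upwards [hfinev] with i hi
  rw [ENNReal.ofReal_toReal hi]

lemma lpow_le_of_bound (hα : 1 < α) {C : ℝ} (hu : ∀ᵐ θ ∂lebPi, ‖u θ‖ ≤ C) :
    lpow α f u ≤ ENNReal.ofReal (C ^ α) *
      ∫⁻ θ, ENNReal.ofReal (∑ k, ∑ l, ‖f θ k l‖) ∂lebPi := by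
  rw [lpow_eq, ← lintegral_const_mul' _ _ ENNReal.ofReal_ne_top]
  refine lintegral_mono_ae ?_
  filter_upwards [hu] with θ hθ
  have hC : 0 ≤ C := (norm_nonneg _).trans hθ
  rw [← ENNReal.ofReal_mul (by positivity)]
  refine ENNReal.ofReal_le_ofReal ((le_abs_self _).trans ((abs_nform_le hα _ _).trans ?_))
  rw [mul_comm]
  gcongr

lemma lintegral_density_lt_top (hf : ∀ k l, Integrable (fun θ => f θ k l) lebPi) :
    ∫⁻ θ, ENNReal.ofReal (∑ k, ∑ l, ‖f θ k l‖) ∂lebPi < ∞ :=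
  Integrable.lintegral_lt_top
    (integrable_finsetSum _ fun k _ => integrable_finsetSum _ fun l _ => (hf k l).norm)

lemma memLalpha_of_bound (hα : 1 < α) (hf : IsDensity α f) (hm : AEStronglyMeasurable u lebPi)
    {C : ℝ} (hu : ∀ᵐ θ ∂lebPi, ‖u θ‖ ≤ C) : MemLalpha α f u :=
  ⟨hm, (lpow_le_of_bound hα hu).trans_lt
    (ENNReal.mul_lt_top ENNReal.ofReal_lt_top (lintegral_density_lt_top hf.integrable))⟩

lemma MemLalpha.add (hα : 1 < α) (hf : IsDensity α f) (hu : MemLalpha α f u)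
    (hv : MemLalpha α f v) : MemLalpha α f (u + v) := by
  obtain ⟨K, hK, h⟩ := exists_lpow_add_le_mul T hα
  refine ⟨hu.1.add hv.1, (h f u v hf hu.1).trans_lt (ENNReal.mul_lt_top hK.lt_top ?_)⟩
  exact ENNReal.add_lt_top.2 ⟨hu.2, hv.2⟩

lemma MemLalpha.smul (hα : 1 < α) (hf : IsDensity α f) (c : ℂ) (hu : MemLalpha α f u) :
    MemLalpha α f (c • u) :=
  ⟨hu.1.const_smul c, by
    rw [lpow_smul hα hf]; exact ENNReal.mul_lt_top ENNReal.ofReal_lt_top hu.2⟩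

lemma MemLalpha.sub (hα : 1 < α) (hf : IsDensity α f) (hu : MemLalpha α f u)
    (hv : MemLalpha α f v) : MemLalpha α f (u - v) := by
  have := hu.add hα hf (hv.smul hα hf (-1))
  simpa [sub_eq_add_neg] using this

lemma tendsto_lpow_add (hα : 1 < α) (hf : IsDensity α f) {ι : Type*} {l : Filter ι}
    {u v : ι → ℝ → Fin T → ℂ} (hum : ∀ i, AEStronglyMeasurable (u i) lebPi)
    (hu : Tendsto (fun i => lpow α f (u i)) l (𝓝 0))
    (hv : Tendsto (fun i => lpow α f (v i)) l (𝓝 0)) :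
    Tendsto (fun i => lpow α f (u i + v i)) l (𝓝 0) := by
  obtain ⟨K, hK, h⟩ := exists_lpow_add_le_mul T hα
  have h1 : Tendsto (fun i => K * (lpow α f (u i) + lpow α f (v i))) l (𝓝 0) := by
    have := ENNReal.Tendsto.const_mul (a := K) (hu.add hv) (Or.inr hK)
    simpa using this
  exact tendsto_of_tendsto_of_tendsto_of_le_of_le tendsto_const_nhds h1 (fun i => zero_le)
    fun i => h f _ _ hf (hum i)

end Lpow

/-! ### Values of a spectral density are stable matrices. -/

section Increments

variable {Ω : Type*} [MeasurableSpace Ω] {T : ℕ} {α : ℝ} {P : Measure Ω}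
  {Z : ℝ → Fin T → Ω → ℂ} {f : ℝ → Matrix (Fin T) (Fin T) ℂ}

lemma IsSaSProcess.jointlySaS_linear (hα : 0 < α) (hZ : IsSaSProcess α P Z) {ι : Type*} [Fintype ι]
    (t : ι → ℝ) (k : ι → Fin T) (ht : ∀ i, t i ∈ Icc (-Real.pi) Real.pi) {m : ℕ}
    (L : Fin m → ι → ℂ) : JointlySaS α P (fun j ω => ∑ i, L j i * Z (t i) (k i) ω) := by
  have e := Fintype.equivFin ι
  have h := (hZ.stable (Fintype.card ι) (t ∘ e.symm) (k ∘ e.symm) fun i => ht _).linear hα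
    (Matrix.of fun j i => L j (e.symm i))
  convert h using 3 with j ω
  simp only [Matrix.of_apply, Function.comp]
  exact (Equiv.sum_comp e.symm fun i => L j i * Z (t i) (k i) ω).symm

lemma IsSaSProcess.jointlySaS_increments (hα : 0 < α) (hZ : IsSaSProcess α P Z) {s t : ℝ}
    (hs : s ∈ Icc (-Real.pi) Real.pi) (ht : t ∈ Icc (-Real.pi) Real.pi) {m : ℕ}
    (L : Fin m → Fin T → ℂ) :
    JointlySaS α P (fun j ω => ∑ k, L j k * (Z t k ω - Z s k ω)) := by
  have h := hZ.jointlySaS_linear hα (ι := Fin T ⊕ Fin T) (Sum.elim (fun _ => t) (fun _ => s))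
    (Sum.elim id id) (by rintro (i | i) <;> simpa) (fun j => Sum.elim (L j) (fun k => -L j k))
  convert h using 3 with j ω
  simp only [Fintype.sum_sum_type, Sum.elim_inl, Sum.elim_inr, id]
  rw [← Finset.sum_add_distrib]
  exact Finset.sum_congr rfl fun k _ => by ring

lemma IsSaSProcess.isSaS_increment (hα : 0 < α) (hZ : IsSaSProcess α P Z)
    (hf : HasSpectralDensity α P Z f) {s t : ℝ}
    (hs : s ∈ Icc (-Real.pi) Real.pi) (ht : t ∈ Icc (-Real.pi) Real.pi) (hst : s ≤ t)
    (u : Fin T → ℂ) :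
    ∃ r, IsSaS α P (fun ω => ∑ k, u k * (Z t k ω - Z s k ω)) r ∧
      sform α (Matrix.of fun k l => ∫ θ in s..t, f θ k l) u u = r := by
  have h := hZ.jointlySaS_increments hα hs ht (m := 1) (fun _ => u)
  have h' : JointlySaS α P ![fun ω => ∑ k, u k * (Z t k ω - Z s k ω)] := by
    convert h using 1
    funext j
    fin_cases j
    rfl
  obtain ⟨r, hr⟩ := (jointlySaS_single_iff hα).1 h'
  exact ⟨r, hr, by rw [← hf.covariation_eq s t hs ht hst, hr.covariation_self hα]⟩

/-- The values of the spectral measure on intervals are stable matrices. -/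
lemma HasSpectralDensity.stableMatrix_integral (hα₁ : 1 < α) (hα₂ : α ≤ 2)
    (hZ : IsSaSProcess α P Z) (hf : HasSpectralDensity α P Z f) {s t : ℝ}
    (hs : s ∈ Icc (-Real.pi) Real.pi) (ht : t ∈ Icc (-Real.pi) Real.pi) (hst : s ≤ t) :
    StableMatrix α (Matrix.of fun k l => ∫ θ in s..t, f θ k l) := by
  have hα0 : 0 < α := by linarith
  refine stableMatrix_of_subgradient hα₁ hα₂ (fun u => ?_) fun u v => ?_
  · obtain ⟨r, hr, h⟩ := hZ.isSaS_increment hα0 hf hs ht hst u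
    rw [h]
    exact ⟨Complex.ofReal_im r, by simpa using hr.nonneg⟩
  -- The covariation inequality for `X = (u - v)^⊤ ΔZ` and `Y = v^⊤ ΔZ` is the required inequality
  -- for the matrix.
  · have h := hZ.jointlySaS_increments hα0 hs ht (m := 2) ![u - v, v]
    have h' : JointlySaS α P ![fun ω => ∑ k, (u - v) k * (Z t k ω - Z s k ω),
        fun ω => ∑ k, v k * (Z t k ω - Z s k ω)] := by
      convert h using 1
      funext j
      fin_cases j <;> rfl
    have h1 := covariation_subgradient hα₁ h'
    have h2 : ((fun ω => ∑ k, (u - v) k * (Z t k ω - Z s k ω)) +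
        fun ω => ∑ k, v k * (Z t k ω - Z s k ω)) = fun ω => ∑ k, u k * (Z t k ω - Z s k ω) := by
      funext ω
      simp only [Pi.add_apply, ← Finset.sum_add_distrib]
      exact Finset.sum_congr rfl fun k _ => by simp; ring
    rw [h2, hf.covariation_eq s t hs ht hst, hf.covariation_eq s t hs ht hst,
      hf.covariation_eq s t hs ht hst] at h1
    exact h1

lemma intervalIntegrable_of_lebPi {F : ℝ → ℂ} (hF : Integrable F lebPi) {s t : ℝ}
    (hs : s ∈ Icc (-Real.pi) Real.pi) (ht : t ∈ Icc (-Real.pi) Real.pi) :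
    IntervalIntegrable F volume s t := by
  have h1 : IntervalIntegrable F volume (-Real.pi) Real.pi :=
    (intervalIntegrable_iff_integrableOn_Ioc_of_le (by linarith [Real.pi_pos])).2 hF
  refine h1.mono_set ?_
  rw [uIcc_of_le (by linarith [Real.pi_pos] : -Real.pi ≤ Real.pi)]
  exact uIcc_subset_Icc hs ht

lemma continuous_sform_mat (α : ℝ) (u v : Fin T → ℂ) :
    Continuous fun M : Matrix (Fin T) (Fin T) ℂ => sform α M u v := by
  simp_rw [sform_eq_sum]
  fun_prop

lemma sform_smul_mat (α : ℝ) (c : ℂ) (M : Matrix (Fin T) (Fin T) ℂ) (u v : Fin T → ℂ) :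
    sform α (c • M) u v = c * sform α M u v := by
  simp [sform, Matrix.smul_mulVec, dotProduct_smul]

/-- A spectral density has stable values almost everywhere. -/
lemma HasSpectralDensity.isDensity (hα₁ : 1 < α) (hα₂ : α ≤ 2)
    (hZ : IsSaSProcess α P Z) (hf : HasSpectralDensity α P Z f) : IsDensity α f := by
  refine ⟨hf.integrable, ?_⟩
  have hpi := Real.pi_pos
  have hl : -Real.pi ∈ Icc (-Real.pi) Real.pi := ⟨le_rfl, by linarith⟩
  have hr : Real.pi ∈ Icc (-Real.pi) Real.pi := ⟨by linarith, le_rfl⟩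
  have hd : ∀ᵐ θ ∂volume, ∀ k l, θ ∈ uIcc (-Real.pi) Real.pi → ∀ c ∈ uIcc (-Real.pi) Real.pi,
      HasDerivAt (fun x => ∫ t in c..x, f t k l) (f θ k l) θ := by
    rw [ae_all_iff]; intro k
    rw [ae_all_iff]; intro l
    exact (intervalIntegrable_of_lebPi (hf.integrable k l) hl hr).ae_hasDerivAt_integral
  -- The endpoint `π` is discarded so that `θ + t` stays in the interval for small `t > 0`.
  have hne : ∀ᵐ θ ∂(volume : Measure ℝ), θ ≠ Real.pi := by simp [ae_iff, measure_singleton]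
  rw [lebPi, ae_restrict_iff' measurableSet_Ioc]
  filter_upwards [hd, hne] with θ hθ hθπ hmem
  have hlt : θ < Real.pi := lt_of_le_of_ne hmem.2 hθπ
  have hθ' : θ ∈ Icc (-Real.pi) Real.pi := Ioc_subset_Icc_self hmem
  rw [uIcc_of_le (by linarith)] at hθ
  -- By Lebesgue differentiation `f θ` is a limit of positive multiples of stable matrices. Reality,
  -- nonnegativity and the subgradient inequality are closed conditions and pass to the limit.
  have hlim : Tendsto (fun t : ℝ => ((t⁻¹ : ℝ) : ℂ) •
      (Matrix.of fun k l => ∫ x in θ..(θ + t), f x k l)) (𝓝[>] 0) (𝓝 (f θ)) := by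
    refine tendsto_pi_nhds.2 fun k => tendsto_pi_nhds.2 fun l => ?_
    have h1 := (hθ k l hθ' (-Real.pi) hl).tendsto_slope_zero_right
    refine h1.congr' ?_
    have h2 : ∀ᶠ t : ℝ in 𝓝[>] 0, θ + t < Real.pi := by
      have : Tendsto (fun t : ℝ => θ + t) (𝓝[>] 0) (𝓝 (θ + 0)) :=
        (Continuous.tendsto (by fun_prop) 0).mono_left nhdsWithin_le_nhds
      exact this.eventually (gt_mem_nhds (by simpa using hlt))
    filter_upwards [h2, self_mem_nhdsWithin] with t ht ht0
    have ht0' : (0 : ℝ) < t := ht0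
    have hmem2 : θ + t ∈ Icc (-Real.pi) Real.pi := ⟨by linarith [hmem.1], ht.le⟩
    rw [intervalIntegral.integral_interval_sub_left
      (intervalIntegrable_of_lebPi (hf.integrable k l) hl hmem2)
      (intervalIntegrable_of_lebPi (hf.integrable k l) hl hθ')]
    rw [Matrix.smul_apply, Matrix.of_apply, Complex.real_smul, smul_eq_mul]
  have hst : ∀ᶠ t : ℝ in 𝓝[>] 0, 0 < t ∧
      StableMatrix α (Matrix.of fun k l => ∫ x in θ..(θ + t), f x k l) := by
    have h2 : ∀ᶠ t : ℝ in 𝓝[>] 0, θ + t < Real.pi := by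
      have : Tendsto (fun t : ℝ => θ + t) (𝓝[>] 0) (𝓝 (θ + 0)) :=
        (Continuous.tendsto (by fun_prop) 0).mono_left nhdsWithin_le_nhds
      exact this.eventually (gt_mem_nhds (by simpa using hlt))
    filter_upwards [h2, self_mem_nhdsWithin] with t ht ht0
    have ht0' : (0 : ℝ) < t := ht0
    exact ⟨ht0', hf.stableMatrix_integral hα₁ hα₂ hZ hθ' ⟨by linarith [hmem.1], ht.le⟩ (by linarith)⟩
  have hsf : ∀ u v : Fin T → ℂ, Tendsto (fun t : ℝ => sform α (((t⁻¹ : ℝ) : ℂ) •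
      (Matrix.of fun k l => ∫ x in θ..(θ + t), f x k l)) u v) (𝓝[>] 0) (𝓝 (sform α (f θ) u v)) :=
    fun u v => ((continuous_sform_mat α u v).tendsto _).comp hlim
  have hre : ∀ u v : Fin T → ℂ, Tendsto (fun t : ℝ => (sform α (((t⁻¹ : ℝ) : ℂ) •
      (Matrix.of fun k l => ∫ x in θ..(θ + t), f x k l)) u v).re) (𝓝[>] 0)
      (𝓝 (sform α (f θ) u v).re) := fun u v => (Complex.continuous_re.tendsto _).comp (hsf u v)
  have him : ∀ u v : Fin T → ℂ, Tendsto (fun t : ℝ => (sform α (((t⁻¹ : ℝ) : ℂ) •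
      (Matrix.of fun k l => ∫ x in θ..(θ + t), f x k l)) u v).im) (𝓝[>] 0)
      (𝓝 (sform α (f θ) u v).im) := fun u v => (Complex.continuous_im.tendsto _).comp (hsf u v)
  refine stableMatrix_of_subgradient hα₁ hα₂ (fun u => ⟨?_, ?_⟩) fun u v => ?_
  · refine tendsto_nhds_unique (him u u) (tendsto_const_nhds.congr' ?_)
    filter_upwards [hst] with t ht
    rw [sform_smul_mat, ht.2.sform_self hα₁, ← Complex.ofReal_mul, Complex.ofReal_im]
  · refine ge_of_tendsto (hre u u) ?_
    filter_upwards [hst] with t ht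
    rw [sform_smul_mat, Complex.re_ofReal_mul]
    exact mul_nonneg (inv_nonneg.2 ht.1.le) (ht.2.nform_nonneg hα₁ u)
  · refine le_of_tendsto_of_tendsto ((hre v v).add ((hre (u - v) v).const_mul α)) (hre u u) ?_
    filter_upwards [hst] with t ht
    simp only [sform_smul_mat, Complex.re_ofReal_mul]
    have h1 := mul_le_mul_of_nonneg_left (ht.2.subgradient hα₁ v u) (inv_nonneg.2 ht.1.le)
    simp only [nform] at h1
    linarith

end Increments

/-! ### Linear operations on limits in measure. -/

section InMeasure

variable {Ω : Type*} [MeasurableSpace Ω] {P : Measure Ω} {ι : Type*} {l : Filter ι}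

lemma tendstoInMeasure_add {X Y : ι → Ω → ℂ} {X' Y' : Ω → ℂ} (hX : TendstoInMeasure P X l X')
    (hY : TendstoInMeasure P Y l Y') :
    TendstoInMeasure P (fun i => X i + Y i) l (X' + Y') := by
  rw [tendstoInMeasure_iff_norm] at *
  intro ε hε
  have h := (hX (ε / 2) (by positivity)).add (hY (ε / 2) (by positivity))
  rw [add_zero] at h
  refine tendsto_of_tendsto_of_tendsto_of_le_of_le tendsto_const_nhds h (fun _ => zero_le)
    fun i => (measure_mono ?_).trans (measure_union_le _ _)
  intro ω hω
  by_contra hc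
  simp only [mem_union, mem_ofPred_eq, not_or, not_le] at hc hω
  have h1 : (X i + Y i) ω - (X' + Y') ω = (X i ω - X' ω) + (Y i ω - Y' ω) := by
    simp only [Pi.add_apply]; ring
  rw [h1] at hω
  linarith [norm_add_le (X i ω - X' ω) (Y i ω - Y' ω), hc.1, hc.2]

lemma tendstoInMeasure_smul {X : ι → Ω → ℂ} {X' : Ω → ℂ} (c : ℂ) (hX : TendstoInMeasure P X l X') :
    TendstoInMeasure P (fun i => c • X i) l (c • X') := by
  rw [tendstoInMeasure_iff_norm] at *
  intro ε hε
  refine tendsto_of_tendsto_of_tendsto_of_le_of_le tendsto_const_nhds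
    (hX (ε / (‖c‖ + 1)) (by positivity)) (fun _ => zero_le) fun i => measure_mono ?_
  intro ω hω
  simp only [mem_ofPred_eq, Pi.smul_apply] at hω ⊢
  rw [← smul_sub, norm_smul] at hω
  rw [div_le_iff₀ (by positivity)]
  nlinarith [norm_nonneg (X i ω - X' ω)]

lemma tendstoInMeasure_sub {X Y : ι → Ω → ℂ} {X' Y' : Ω → ℂ} (hX : TendstoInMeasure P X l X')
    (hY : TendstoInMeasure P Y l Y') :
    TendstoInMeasure P (fun i => X i - Y i) l (X' - Y') := by
  have := tendstoInMeasure_add hX (tendstoInMeasure_smul (-1) hY)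
  simpa [sub_eq_add_neg] using this

lemma tendstoInMeasure_const (X : Ω → ℂ) : TendstoInMeasure P (fun _ : ι => X) l X := by
  rw [tendstoInMeasure_iff_norm]
  intro ε hε
  simpa [hε.not_ge] using tendsto_const_nhds

end InMeasure

/-! ### Algebra of step functions and a common refinement. -/

section Steps

variable {Ω : Type*} {T : ℕ} {Z : ℝ → Fin T → Ω → ℂ}

/-- The sum of two step functions. -/
def StepFun.add (φ ψ : StepFun T) : StepFun T where
  m := φ.m + ψ.m
  s := Fin.append φ.s ψ.s
  t := Fin.append φ.t ψ.t
  c := Fin.append φ.c ψ.c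
  s_mem i := by
    refine Fin.addCases (fun i => ?_) (fun i => ?_) i
    · simpa using φ.s_mem i
    · simpa using ψ.s_mem i
  t_mem i := by
    refine Fin.addCases (fun i => ?_) (fun i => ?_) i
    · simpa using φ.t_mem i
    · simpa using ψ.t_mem i
  le i := by
    refine Fin.addCases (fun i => ?_) (fun i => ?_) i
    · simpa using φ.le i
    · simpa using ψ.le i

lemma StepFun.add_toFun (φ ψ : StepFun T) : (φ.add ψ).toFun = φ.toFun + ψ.toFun := by
  funext θ
  change ∑ i : Fin (φ.m + ψ.m), (Ioc (Fin.append φ.s ψ.s i) (Fin.append φ.t ψ.t i)).indicator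
    (fun _ => Fin.append φ.c ψ.c i) θ = _
  rw [Fin.sum_univ_add]
  simp [StepFun.toFun]

lemma StepFun.add_integral (φ ψ : StepFun T) (Z : ℝ → Fin T → Ω → ℂ) :
    (φ.add ψ).integral Z = φ.integral Z + ψ.integral Z := by
  funext ω
  change ∑ i : Fin (φ.m + ψ.m), ∑ k, Fin.append φ.c ψ.c i k *
    (Z (Fin.append φ.t ψ.t i) k ω - Z (Fin.append φ.s ψ.s i) k ω) = _
  rw [Fin.sum_univ_add]
  simp [StepFun.integral]

/-- A scalar multiple of a step function. -/
def StepFun.smul (a : ℂ) (φ : StepFun T) : StepFun T where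
  m := φ.m
  s := φ.s
  t := φ.t
  c := fun i => a • φ.c i
  s_mem := φ.s_mem
  t_mem := φ.t_mem
  le := φ.le

lemma StepFun.smul_toFun (a : ℂ) (φ : StepFun T) : (φ.smul a).toFun = a • φ.toFun := by
  funext θ
  simp only [StepFun.toFun, StepFun.smul, Pi.smul_apply, Finset.smul_sum]
  refine Finset.sum_congr rfl fun i _ => ?_
  rw [← indicator_const_smul_apply]

lemma StepFun.smul_integral (a : ℂ) (φ : StepFun T) (Z : ℝ → Fin T → Ω → ℂ) :
    (φ.smul a).integral Z = a • φ.integral Z := by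
  funext ω
  simp only [StepFun.integral, StepFun.smul, Finset.mul_sum, mul_assoc, Pi.smul_apply, smul_eq_mul]
  rfl

/-- The zero step function. -/
def StepFun.zero (T : ℕ) : StepFun T where
  m := 0
  s := Fin.elim0
  t := Fin.elim0
  c := Fin.elim0
  s_mem i := i.elim0
  t_mem i := i.elim0
  le i := i.elim0

lemma StepFun.zero_toFun : (StepFun.zero T).toFun = 0 := by
  funext θ; simp [StepFun.toFun, StepFun.zero]

lemma StepFun.zero_integral (Z : ℝ → Fin T → Ω → ℂ) : (StepFun.zero T).integral Z = 0 := by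
  funext θ; simp [StepFun.integral, StepFun.zero]

lemma StepFun.integral_add_process (φ : StepFun T) (Z Z' : ℝ → Fin T → Ω → ℂ) :
    φ.integral (Z + Z') = φ.integral Z + φ.integral Z' := by
  funext ω
  simp only [StepFun.integral, Pi.add_apply, ← Finset.sum_add_distrib]
  exact Finset.sum_congr rfl fun i _ => Finset.sum_congr rfl fun k _ => by ring

lemma StepFun.measurable_toFun (φ : StepFun T) : Measurable φ.toFun := by
  unfold StepFun.toFun
  exact Finset.measurable_fun_sum _ fun i _ => measurable_const.indicator measurableSet_Ioc

lemma StepFun.aestronglyMeasurable (φ : StepFun T) : AEStronglyMeasurable φ.toFun lebPi :=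
  φ.measurable_toFun.aestronglyMeasurable

lemma StepFun.norm_toFun_le (φ : StepFun T) (θ : ℝ) : ‖φ.toFun θ‖ ≤ ∑ i, ‖φ.c i‖ := by
  refine (norm_sum_le _ _).trans (Finset.sum_le_sum fun i _ => ?_)
  exact norm_indicator_le_norm_self _ _

/-- A common refinement of the intervals of a step function. -/
lemma StepFun.exists_partition (φ : StepFun T) :
    ∃ (n : ℕ) (e : ℕ → ℝ) (d : ℕ → Fin T → ℂ), Monotone e ∧ (∀ j, e j ∈ Icc (-Real.pi) Real.pi) ∧
      ∀ (k : Fin T) (G : ℝ → ℂ), ∑ i, φ.c i k * (G (φ.t i) - G (φ.s i)) =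
        ∑ j : Fin n, d j k * (G (e (j + 1)) - G (e j)) := by
  classical
  -- The point `-π` is inserted only to make the set of endpoints nonempty, so that its size has the
  -- form `n + 1`.
  let S : Finset ℝ := insert (-Real.pi) (Finset.univ.image φ.s ∪ Finset.univ.image φ.t)
  have hS : ∀ x ∈ S, x ∈ Icc (-Real.pi) Real.pi := by
    intro x hx
    simp only [S, Finset.mem_insert, Finset.mem_union, Finset.mem_image, Finset.mem_univ,
      true_and] at hx
    rcases hx with rfl | ⟨i, rfl⟩ | ⟨i, rfl⟩
    · exact ⟨le_rfl, by linarith [Real.pi_pos]⟩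
    · exact φ.s_mem i
    · exact φ.t_mem i
  obtain ⟨n, hn⟩ : ∃ n, S.card = n + 1 :=
    Nat.exists_eq_add_one.2 (Finset.card_pos.2 (Finset.insert_nonempty _ _))
  let o := S.orderEmbOfFin hn
  let idx : ℕ → Fin (n + 1) := fun j => ⟨min j n, by omega⟩
  let e : ℕ → ℝ := fun j => o (idx j)
  have hmono : Monotone e := fun i j hij => o.monotone (by
    change min i n ≤ min j n
    omega)
  have hmem : ∀ x ∈ S, ∃ j ≤ n, e j = x := by
    intro x hx
    have : x ∈ Set.range o := by
      rw [Finset.range_orderEmbOfFin]; exact hx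
    obtain ⟨y, rfl⟩ := this
    refine ⟨y, by omega, ?_⟩
    have : idx y = y := by ext; simp [idx]; omega
    simp [e, this]
  choose! b hb hb' using hmem
  have hsS : ∀ i, φ.s i ∈ S := fun i => by simp [S]
  have htS : ∀ i, φ.t i ∈ S := fun i => by simp [S]
  have hle : ∀ i, b (φ.s i) ≤ b (φ.t i) := by
    intro i
    have h1 : o (idx (b (φ.s i))) ≤ o (idx (b (φ.t i))) := by
      have h2 := hb' _ (hsS i)
      have h3 := hb' _ (htS i)
      simp only [e] at h2 h3
      rw [h2, h3]
      exact φ.le i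
    have h4 : min (b (φ.s i)) n ≤ min (b (φ.t i)) n := o.le_iff_le.1 h1
    have h5 := hb _ (hsS i)
    have h6 := hb _ (htS i)
    omega
  refine ⟨n, e, fun j => ∑ i, if j ∈ Finset.Ico (b (φ.s i)) (b (φ.t i)) then φ.c i else 0, hmono,
    fun j => hS _ (Finset.orderEmbOfFin_mem S hn _), fun k G => ?_⟩
  -- Telescoping works for arbitrary `G`; later `G` is a coordinate path of `Z`, or `x ↦ 1_{(-∞,
  -- x]}(θ)` for the step function itself.
  have htel : ∀ i, G (φ.t i) - G (φ.s i) =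
      ∑ j ∈ Finset.range n, if j ∈ Finset.Ico (b (φ.s i)) (b (φ.t i)) then
        G (e (j + 1)) - G (e j) else 0 := by
    intro i
    rw [← Finset.sum_filter]
    have : (Finset.range n).filter (fun j => j ∈ Finset.Ico (b (φ.s i)) (b (φ.t i))) =
        Finset.Ico (b (φ.s i)) (b (φ.t i)) := by
      ext j
      have := hb _ (htS i)
      simp only [Finset.mem_filter, Finset.mem_range, Finset.mem_Ico]
      omega
    rw [this, Finset.sum_Ico_sub (fun j => G (e j)) (hle i), hb' _ (htS i), hb' _ (hsS i)]
  simp_rw [htel]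
  rw [Fin.sum_univ_eq_sum_range (fun j => (∑ i, if j ∈ Finset.Ico (b (φ.s i)) (b (φ.t i)) then
    φ.c i else 0) k * (G (e (j + 1)) - G (e j)))]
  simp_rw [Finset.mul_sum]
  rw [Finset.sum_comm]
  refine Finset.sum_congr rfl fun j _ => ?_
  rw [Finset.sum_apply, Finset.sum_mul]
  refine Finset.sum_congr rfl fun i _ => ?_
  split_ifs <;> simp

lemma indicator_Ioc_eq_sub {s t : ℝ} (hst : s ≤ t) (c : ℂ) (θ : ℝ) :
    (Ioc s t).indicator (fun _ => c) θ =
      c * ((Iic t).indicator (fun _ => 1) θ - (Iic s).indicator (fun _ => 1) θ) := by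
  classical
  simp only [indicator_apply, mem_Ioc, mem_Iic]
  by_cases h1 : θ ≤ t <;> by_cases h2 : θ ≤ s
  · simp [h1, h2, h2.not_gt]
  · simp [h1, h2, not_le.1 h2]
  · exact absurd (h2.trans hst) h1
  · simp [h1, h2]

lemma StepFun.toFun_apply (φ : StepFun T) (θ : ℝ) (k : Fin T) :
    φ.toFun θ k = ∑ i, φ.c i k * ((Iic (φ.t i)).indicator (fun _ => 1) θ -
      (Iic (φ.s i)).indicator (fun _ => 1) θ) := by
  rw [StepFun.toFun, Finset.sum_apply]
  refine Finset.sum_congr rfl fun i _ => ?_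
  rw [← indicator_Ioc_eq_sub (φ.le i)]
  classical
  simp only [indicator_apply]
  split_ifs <;> simp

end Steps

/-! ### The isometry for step functions. -/

section StepIntegral

variable {Ω : Type*} [MeasurableSpace Ω] {T : ℕ} {α : ℝ} {P : Measure Ω}
  {Z : ℝ → Fin T → Ω → ℂ} {f : ℝ → Matrix (Fin T) (Fin T) ℂ}

lemma integrable_sform_const (hf : ∀ k l, Integrable (fun θ => f θ k l) lebPi) (u v : Fin T → ℂ) :
    Integrable (fun θ => sform α (f θ) u v) lebPi := by
  simp_rw [sform_eq_sum]
  exact integrable_finsetSum _ fun k _ => integrable_finsetSum _ fun l _ =>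
    ((hf k l).mul_const _).const_mul _

lemma sform_integral (hf : ∀ k l, Integrable (fun θ => f θ k l) lebPi) {s t : ℝ}
    (hs : s ∈ Icc (-Real.pi) Real.pi) (ht : t ∈ Icc (-Real.pi) Real.pi) (hst : s ≤ t)
    (u v : Fin T → ℂ) :
    sform α (Matrix.of fun k l => ∫ θ in s..t, f θ k l) u v =
      ∫ θ, (Ioc s t).indicator (fun θ => sform α (f θ) u v) θ ∂lebPi := by
  have hsub : Ioc s t ⊆ Ioc (-Real.pi) Real.pi := Ioc_subset_Ioc hs.1 ht.2
  have hres : lebPi.restrict (Ioc s t) = volume.restrict (Ioc s t) := by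
    rw [lebPi, Measure.restrict_restrict measurableSet_Ioc, inter_eq_self_of_subset_left hsub]
  rw [integral_indicator measurableSet_Ioc, hres]
  have hi : ∀ k l, IntegrableOn (fun θ => f θ k l) (Ioc s t) := fun k l => by
    have := (hf k l).integrableOn (s := Ioc s t)
    rwa [IntegrableOn, hres] at this
  simp_rw [sform_eq_sum]
  rw [integral_finsetSum _ fun k _ => integrable_finsetSum _ fun l _ =>
    ((hi k l).mul_const _).const_mul _]
  refine Finset.sum_congr rfl fun k _ => ?_
  rw [integral_finsetSum _ fun l _ => ((hi k l).mul_const _).const_mul _]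
  refine Finset.sum_congr rfl fun l _ => ?_
  rw [integral_const_mul, integral_mul_const, Matrix.of_apply, intervalIntegral.integral_of_le hst]

/-- The intervals are disjoint, so at most one term is nonzero at `θ` and the nonlinear form splits
into a sum. -/
lemma sform_partition (n : ℕ) {e : ℕ → ℝ} (he : Monotone e) (d : ℕ → Fin T → ℂ) (θ : ℝ)
    (F : ℝ → Matrix (Fin T) (Fin T) ℂ) :
    sform α (F θ) (∑ j : Fin n, (Ioc (e j) (e (j + 1))).indicator (fun _ => d j) θ)
      (∑ j : Fin n, (Ioc (e j) (e (j + 1))).indicator (fun _ => d j) θ) =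
      ∑ j : Fin n, (Ioc (e j) (e (j + 1))).indicator (fun x => sform α (F x) (d j) (d j)) θ := by
  by_cases h : ∃ j : Fin n, θ ∈ Ioc (e j) (e (j + 1))
  · obtain ⟨j, hj⟩ := h
    have hne : ∀ i : Fin n, i ≠ j → θ ∉ Ioc (e i) (e (i + 1)) := by
      intro i hij hi
      rcases lt_or_gt_of_ne (Fin.val_ne_of_ne hij) with h | h
      · have := he (Nat.succ_le_of_lt h)
        simp only [Nat.succ_eq_add_one] at this
        linarith [hi.2, hj.1]
      · have := he (Nat.succ_le_of_lt h)
        simp only [Nat.succ_eq_add_one] at this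
        linarith [hj.2, hi.1]
    rw [Finset.sum_eq_single j (fun i _ hi => indicator_of_notMem (hne i hi) _) (by simp),
      Finset.sum_eq_single j (fun i _ hi => indicator_of_notMem (hne i hi) _) (by simp),
      indicator_of_mem hj, indicator_of_mem hj]
  · push Not at h
    rw [Finset.sum_eq_zero fun i _ => indicator_of_notMem (h i) _,
      Finset.sum_eq_zero fun i _ => indicator_of_notMem (h i) _]
    simp [sform]

/-- The elementary integral of a step function is stable, and its norm is the norm of the step
function in `L^α(f)`. -/
lemma StepFun.isSaS_integral (hα₁ : 1 < α) (hα₂ : α ≤ 2) (hZ : IsSaSProcess α P Z)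
    (hf : HasSpectralDensity α P Z f) (φ : StepFun T) :
    IsSaS α P (φ.integral Z) (lpow α f φ.toFun).toReal := by
  have hα0 : 0 < α := by linarith
  have hD := hf.isDensity hα₁ hα₂ hZ
  obtain ⟨n, e, d, he, heI, hsum⟩ := φ.exists_partition
  have hstep : ∀ j : ℕ, e j ≤ e (j + 1) := fun j => he (Nat.le_succ j)
  choose r hr hrs using fun j : ℕ => hZ.isSaS_increment hα0 hf (heI j) (heI (j + 1)) (hstep j) (d j)
  -- On the refined partition the increments are independent, so the powers of their norms add up.
  have hind : iIndepFun (fun (j : Fin n) ω => ∑ k, d j k * (Z (e (j + 1)) k ω - Z (e j) k ω)) P := by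
    have h1 := hZ.indep.nat (t := fun j => (⟨e j, heI j⟩ : Icc (-Real.pi) Real.pi))
      (fun i j hij => he hij)
    have h2 := h1.comp (fun (j : ℕ) (z : Fin T → ℂ) => ∑ k, d j k * z k) (fun j => by fun_prop)
    exact h2.precomp (g := fun j : Fin n => (j : ℕ)) Fin.val_injective
  have h1 := IsSaS.sum hα0 hind fun j => hr j
  have h2 : (fun ω => ∑ j : Fin n, ∑ k, d j k * (Z (e (j + 1)) k ω - Z (e j) k ω)) =
      φ.integral Z := by
    funext ω
    rw [StepFun.integral, Finset.sum_comm, Finset.sum_comm (s := (Finset.univ : Finset (Fin φ.m)))]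
    exact Finset.sum_congr rfl fun k _ => (hsum k fun x => Z x k ω).symm
  rw [h2] at h1
  have h3 : ∀ θ, φ.toFun θ = ∑ j : Fin n, (Ioc (e j) (e (j + 1))).indicator (fun _ => d j) θ := by
    intro θ
    funext k
    rw [φ.toFun_apply, hsum k fun x => (Iic x).indicator (fun _ => 1) θ, Finset.sum_apply]
    refine Finset.sum_congr rfl fun j _ => ?_
    rw [← indicator_Ioc_eq_sub (hstep j)]
    classical
    simp only [indicator_apply]
    split_ifs <;> simp
  have hint : ∀ j : ℕ, Integrable (fun θ => (Ioc (e j) (e (j + 1))).indicator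
      (fun θ => sform α (f θ) (d j) (d j)) θ) lebPi := fun j =>
    (integrable_sform_const hf.integrable _ _).indicator measurableSet_Ioc
  have h4 : ∫ θ, sform α (f θ) (φ.toFun θ) (φ.toFun θ) ∂lebPi = ((∑ j : Fin n, r j : ℝ) : ℂ) := by
    simp_rw [h3, sform_partition n he d _ f]
    rw [integral_finsetSum _ fun (j : Fin n) _ => hint j]
    push_cast
    refine Finset.sum_congr rfl fun j _ => ?_
    rw [← hrs j, sform_integral hf.integrable (heI j) (heI (j + 1)) (hstep j)]
  have hint' : Integrable (fun θ => sform α (f θ) (φ.toFun θ) (φ.toFun θ)) lebPi := by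
    simp_rw [h3, sform_partition n he d _ f]
    exact integrable_finsetSum _ fun (j : Fin n) _ => hint j
  have h5 : (lpow α f φ.toFun).toReal = ∑ j : Fin n, r j := by
    rw [lpow_eq, ← integral_eq_lintegral_of_nonneg_ae
      (hD.stable.mono fun θ h => h.nform_nonneg hα₁ _)
      (aemeasurable_nform hf.integrable φ.aestronglyMeasurable).aestronglyMeasurable]
    have h6 := congrArg Complex.re h4
    rw [Complex.ofReal_re] at h6
    rw [← h6]
    exact integral_re hint'
  rw [h5]
  exact h1

end StepIntegral

/-! ### Stochastic integrals: linearity, isometry, approximation by steps. -/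

section StochInt

variable {Ω : Type*} [MeasurableSpace Ω] {T : ℕ} {α : ℝ} {P : Measure Ω}
  {Z : ℝ → Fin T → Ω → ℂ} {f : ℝ → Matrix (Fin T) (Fin T) ℂ} {u v : ℝ → Fin T → ℂ} {X Y : Ω → ℂ}

lemma StepFun.isStochIntegral (hα : 1 < α) (hf : IsDensity α f) (φ : StepFun T) :
    IsStochIntegral α P Z f φ.toFun (φ.integral Z) :=
  ⟨memLalpha_of_bound hα hf φ.aestronglyMeasurable (ae_of_all _ φ.norm_toFun_le), fun _ => φ,
    by simp [lpow_zero], tendstoInMeasure_const _⟩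

lemma IsStochIntegral.add (hα : 1 < α) (hf : IsDensity α f) (hu : IsStochIntegral α P Z f u X)
    (hv : IsStochIntegral α P Z f v Y) : IsStochIntegral α P Z f (u + v) (X + Y) := by
  obtain ⟨hum, φ, hφ, hφX⟩ := hu
  obtain ⟨hvm, ψ, hψ, hψY⟩ := hv
  refine ⟨hum.add hα hf hvm, fun n => (φ n).add (ψ n), ?_, ?_⟩
  · have h := tendsto_lpow_add hα hf (fun n => hum.1.sub (φ n).aestronglyMeasurable) hφ hψ
    refine h.congr fun n => ?_
    rw [StepFun.add_toFun]
    congr 1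
    abel
  · simp_rw [StepFun.add_integral]
    exact tendstoInMeasure_add hφX hψY

lemma IsStochIntegral.smul (hα : 1 < α) (hf : IsDensity α f) (c : ℂ)
    (hu : IsStochIntegral α P Z f u X) : IsStochIntegral α P Z f (c • u) (c • X) := by
  obtain ⟨hum, φ, hφ, hφX⟩ := hu
  refine ⟨hum.smul hα hf c, fun n => (φ n).smul c, ?_, ?_⟩
  · have h : Tendsto (fun n => ENNReal.ofReal (‖c‖ ^ α) * lpow α f (u - (φ n).toFun)) atTop (𝓝 0) := by
      have := ENNReal.Tendsto.const_mul (a := ENNReal.ofReal (‖c‖ ^ α)) hφ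
        (Or.inr ENNReal.ofReal_ne_top)
      simpa using this
    refine h.congr fun n => ?_
    rw [StepFun.smul_toFun, ← lpow_smul hα hf, smul_sub]
  · simp_rw [StepFun.smul_integral]
    exact tendstoInMeasure_smul c hφX

lemma IsStochIntegral.sub (hα : 1 < α) (hf : IsDensity α f) (hu : IsStochIntegral α P Z f u X)
    (hv : IsStochIntegral α P Z f v Y) : IsStochIntegral α P Z f (u - v) (X - Y) := by
  have := hu.add hα hf (hv.smul hα hf (-1))
  simpa [sub_eq_add_neg] using this

lemma isStochIntegral_zero (hα : 1 < α) (hf : IsDensity α f) :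
    IsStochIntegral α P Z f 0 (0 : Ω → ℂ) := by
  have := (StepFun.zero T).isStochIntegral (P := P) (Z := Z) hα hf
  rwa [StepFun.zero_toFun, StepFun.zero_integral] at this

/-- The stochastic integral is an isometry. -/
lemma IsStochIntegral.isSaS [IsProbabilityMeasure P] (hα₁ : 1 < α) (hα₂ : α ≤ 2)
    (hZ : IsSaSProcess α P Z) (hf : HasSpectralDensity α P Z f)
    (hu : IsStochIntegral α P Z f u X) : IsSaS α P X (lpow α f u).toReal := by
  have hα0 : 0 < α := by linarith
  have hD := hf.isDensity hα₁ hα₂ hZ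
  obtain ⟨hum, φ, hφ, hφX⟩ := hu
  have h1 := fun n => (φ n).isSaS_integral hα₁ hα₂ hZ hf
  refine IsSaS.of_tendstoInMeasure hα0 h1
    (hφX.aemeasurable fun n => (h1 n).aemeasurable) hφX ?_
  exact (ENNReal.tendsto_toReal hum.2.ne).comp
    (tendsto_lpow_of_sub hα₁ hD hum.1 (fun n => (φ n).aestronglyMeasurable) hum.2 hφ)

/-- Continuous functions are limits of step functions, uniformly on `(-π, π]`. -/
lemma exists_step_of_continuous (hu : Continuous u) {ε : ℝ} (hε : 0 < ε) :
    ∃ φ : StepFun T, ∀ θ ∈ Ioc (-Real.pi) Real.pi, ‖u θ - φ.toFun θ‖ ≤ ε := by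
  have hpi := Real.pi_pos
  have huc := isCompact_Icc.uniformContinuousOn_of_continuous
    (hu.continuousOn (s := Icc (-Real.pi) Real.pi))
  rw [Metric.uniformContinuousOn_iff] at huc
  obtain ⟨δ, hδ, hδu⟩ := huc ε hε
  obtain ⟨n, hn⟩ := exists_nat_gt (2 * Real.pi / δ)
  have hn0 : (0 : ℝ) < n := lt_trans (by positivity) hn
  have hstep : 2 * Real.pi / n < δ := by
    rw [div_lt_iff₀ hδ] at hn
    rw [div_lt_iff₀ hn0]
    linarith
  let e : ℕ → ℝ := fun j => -Real.pi + 2 * Real.pi * j / n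
  have he : Monotone e := fun i j hij => by
    simp only [e]
    have : (i : ℝ) ≤ j := by exact_mod_cast hij
    gcongr
  have he0 : e 0 = -Real.pi := by simp [e]
  have hen : e n = Real.pi := by
    simp only [e]
    field_simp
    ring
  have heI : ∀ j ≤ n, e j ∈ Icc (-Real.pi) Real.pi := fun j hj =>
    ⟨by rw [← he0]; exact he (Nat.zero_le j), by rw [← hen]; exact he hj⟩
  let φ : StepFun T :=
    { m := n
      s := fun j => e j
      t := fun j => e (j + 1)
      c := fun j => u (e (j + 1))
      s_mem := fun j => heI _ j.2.le
      t_mem := fun j => heI _ j.2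
      le := fun j => he (Nat.le_succ _) }
  refine ⟨φ, fun θ hθ => ?_⟩
  obtain ⟨j, hj, hθj⟩ : ∃ j < n, θ ∈ Ioc (e j) (e (j + 1)) := by
    -- The index sought is the one before the first grid point not to the left of `θ`.
    have hex : ∃ j, θ ≤ e j := ⟨n, by rw [hen]; exact hθ.2⟩
    classical
    have hpos : 0 < Nat.find hex := by
      rw [Nat.find_pos, he0, not_le]
      exact hθ.1
    have hle : Nat.find hex ≤ n := Nat.find_min' hex (by rw [hen]; exact hθ.2)
    refine ⟨Nat.find hex - 1, by omega, ?_, ?_⟩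
    · exact not_le.1 (Nat.find_min hex (by omega))
    · rw [Nat.sub_add_cancel hpos]
      exact Nat.find_spec hex
  have hval : φ.toFun θ = u (e (j + 1)) := by
    rw [StepFun.toFun, Finset.sum_eq_single (⟨j, hj⟩ : Fin n)]
    · exact indicator_of_mem (by exact hθj) _
    · intro i _ hi
      refine indicator_of_notMem ?_ _
      intro hmem
      have hmem' : θ ∈ Ioc (e i) (e (i + 1)) := hmem
      have hne : (i : ℕ) ≠ j := fun h => hi (Fin.ext h)
      rcases lt_or_gt_of_ne hne with h | h
      · have := he (Nat.succ_le_of_lt h)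
        simp only [Nat.succ_eq_add_one] at this
        linarith [hmem'.2, hθj.1]
      · have := he (Nat.succ_le_of_lt h)
        simp only [Nat.succ_eq_add_one] at this
        linarith [hθj.2, hmem'.1]
    · exact fun h => absurd (Finset.mem_univ _) h
  rw [hval, ← dist_eq_norm]
  refine (hδu θ (Ioc_subset_Icc_self hθ) _ (heI _ hj) ?_).le
  rw [dist_comm, Real.dist_eq, abs_of_nonneg (by linarith [hθj.2])]
  have : e (j + 1) - e j = 2 * Real.pi / n := by
    simp only [e]; push_cast; field_simp; ring
  linarith [hθj.1]

lemma exists_steps_of_continuous (hα : 1 < α) (hf : IsDensity α f) (hu : Continuous u) {ε : ℝ≥0∞}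
    (hε : 0 < ε) : ∃ φ : StepFun T, lpow α f (u - φ.toFun) < ε := by
  set I := ∫⁻ θ, ENNReal.ofReal (∑ k, ∑ l, ‖f θ k l‖) ∂lebPi with hI
  have hIfin : I ≠ ∞ := (lintegral_density_lt_top hf.integrable).ne
  have hlim : Tendsto (fun δ : ℝ => ENNReal.ofReal (δ ^ α) * I) (𝓝[>] 0) (𝓝 0) := by
    have h1 : Tendsto (fun δ : ℝ => δ ^ α) (𝓝[>] 0) (𝓝 0) := by
      have := (Real.continuous_rpow_const (q := α) (by linarith)).tendsto 0
      rw [Real.zero_rpow (by linarith)] at this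
      exact this.mono_left nhdsWithin_le_nhds
    have h2 := ENNReal.Tendsto.mul_const (b := I) (ENNReal.tendsto_ofReal h1) (Or.inr hIfin)
    simpa using h2
  obtain ⟨δ, hδ, hδ0⟩ := ((hlim.eventually (gt_mem_nhds hε)).and self_mem_nhdsWithin).exists
  obtain ⟨φ, hφ⟩ := exists_step_of_continuous hu (show (0 : ℝ) < δ from hδ0)
  refine ⟨φ, lt_of_le_of_lt (lpow_le_of_bound hα (C := δ) ?_) hδ⟩
  rw [lebPi]
  exact (ae_restrict_mem measurableSet_Ioc).mono fun θ hθ => hφ θ hθ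

end StochInt

/-! ### Embedding in `L¹` and completeness. -/

section Coercive

variable {T : ℕ} {α : ℝ} {f g F : ℝ → Matrix (Fin T) (Fin T) ℂ} {u v : ℝ → Fin T → ℂ} {w : ℝ → ℝ}

/-- The density `F` is bounded below by an integrable weight: this embeds `L^α(F)` into `L¹`. -/
structure IsCoercive (α : ℝ) (F : ℝ → Matrix (Fin T) (Fin T) ℂ) (w : ℝ → ℝ) : Prop where
  integrable : Integrable w lebPi
  nonneg : ∀ᵐ θ ∂lebPi, 0 ≤ w θ
  bound : ∀ᵐ θ ∂lebPi, ∀ u : Fin T → ℂ, ‖u‖ ^ α ≤ w θ ^ (α - 1) * nform α (F θ) u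

lemma Minimality.isCoercive (hα : 1 < α) (h : Minimality α f g) (hF : IsDensity α (f + g)) :
    IsCoercive α (f + g)
      (fun θ => (cfc (fun x : ℝ => x ^ (-1 / (α - 1))) (f θ + g θ)).trace.re) := by
  refine ⟨h.2.re, ?_, ?_⟩
  · filter_upwards [h.1] with θ hθ
    rw [trace_cfc hθ.1, Complex.ofReal_re]
    exact Finset.sum_nonneg fun i _ => Real.rpow_nonneg (hθ.eigenvalues_pos i).le _
  · filter_upwards [h.1, hF.stable] with θ h1 h2 u
    exact h2.norm_rpow_le hα h1 u

/-- Hölder's inequality with exponents `α/(α-1)` and `α`, applied to `‖u‖ ≤ w ^ ((α-1)/α) · nform ^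
(1/α)`. -/
lemma IsCoercive.lintegral_enorm_le (hα : 1 < α) (hF : IsDensity α F) (hw : IsCoercive α F w)
    (hu : AEStronglyMeasurable u lebPi) :
    ∫⁻ θ, ‖u θ‖ₑ ∂lebPi ≤ (∫⁻ θ, ENNReal.ofReal (w θ) ∂lebPi) ^ ((α - 1) / α) *
      lpow α F u ^ (1 / α) := by
  have hα0 : 0 < α := by linarith
  have hα1 : 0 < α - 1 := by linarith
  have hpq : (α / (α - 1)).HolderConjugate α := (Real.HolderConjugate.conjExponent hα).symm
  have hN := (aemeasurable_nform (α := α) hF.integrable hu).ennreal_ofReal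
  have hW := hw.integrable.aemeasurable.ennreal_ofReal
  have h1 : ∀ᵐ θ ∂lebPi, ‖u θ‖ₑ ≤ ENNReal.ofReal (w θ) ^ ((α - 1) / α) *
      ENNReal.ofReal (nform α (F θ) (u θ)) ^ (1 / α) := by
    filter_upwards [hw.nonneg, hw.bound, hF.stable] with θ h1 h2 h3
    have hn := h3.nform_nonneg hα (u θ)
    rw [ENNReal.ofReal_rpow_of_nonneg h1 (by positivity),
      ENNReal.ofReal_rpow_of_nonneg hn (by positivity), ← ENNReal.ofReal_mul (by positivity),
      ← ofReal_norm]
    refine ENNReal.ofReal_le_ofReal ?_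
    have h4 := Real.rpow_le_rpow (by positivity) (h2 (u θ)) (show 0 ≤ 1 / α by positivity)
    rw [← Real.rpow_mul (norm_nonneg _), mul_one_div_cancel hα0.ne', Real.rpow_one,
      Real.mul_rpow (by positivity) hn, ← Real.rpow_mul h1, mul_one_div] at h4
    exact h4
  refine (lintegral_mono_ae h1).trans ?_
  refine (ENNReal.lintegral_mul_le_Lp_mul_Lq lebPi hpq (hW.pow_const _) (hN.pow_const _)).trans
    (le_of_eq ?_)
  simp_rw [← ENNReal.rpow_mul]
  rw [show (α - 1) / α * (α / (α - 1)) = 1 by field_simp, show 1 / α * α = 1 by field_simp,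
    show 1 / (α / (α - 1)) = (α - 1) / α by field_simp]
  simp_rw [ENNReal.rpow_one]
  rfl

lemma IsCoercive.integrable_of_mem (hα : 1 < α) (hF : IsDensity α F) (hw : IsCoercive α F w)
    (hu : MemLalpha α F u) : Integrable u lebPi := by
  have hα1 : 0 < α - 1 := by linarith
  refine ⟨hu.1, (hw.lintegral_enorm_le hα hF hu.1).trans_lt (ENNReal.mul_lt_top ?_ ?_)⟩
  · exact ENNReal.rpow_lt_top_of_nonneg (by positivity) hw.integrable.lintegral_lt_top.ne
  · exact ENNReal.rpow_lt_top_of_nonneg (by positivity) hu.2.ne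

lemma IsCoercive.tendsto_lintegral (hα : 1 < α) (hF : IsDensity α F) (hw : IsCoercive α F w)
    {ι : Type*} {l : Filter ι} {v : ι → ℝ → Fin T → ℂ} (hv : ∀ i, AEStronglyMeasurable (v i) lebPi)
    (h : Tendsto (fun i => lpow α F (v i)) l (𝓝 0)) :
    Tendsto (fun i => ∫⁻ θ, ‖v i θ‖ₑ ∂lebPi) l (𝓝 0) := by
  have hα1 : 0 < α - 1 := by linarith
  have h1 : Tendsto (fun i => (∫⁻ θ, ENNReal.ofReal (w θ) ∂lebPi) ^ ((α - 1) / α) *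
      lpow α F (v i) ^ (1 / α)) l (𝓝 0) := by
    have h2 := h.ennrpow_const (1 / α)
    rw [ENNReal.zero_rpow_of_pos (by positivity)] at h2
    have h3 := ENNReal.Tendsto.const_mul
      (a := (∫⁻ θ, ENNReal.ofReal (w θ) ∂lebPi) ^ ((α - 1) / α)) h2 (Or.inr
        (ENNReal.rpow_lt_top_of_nonneg (by positivity) hw.integrable.lintegral_lt_top.ne).ne)
    simpa using h3
  exact tendsto_of_tendsto_of_tendsto_of_le_of_le tendsto_const_nhds h1 (fun _ => zero_le)
    fun i => hw.lintegral_enorm_le hα hF (hv i)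

/-- The space `L^α(F)` is complete. -/
lemma IsCoercive.exists_limit (hα : 1 < α) (hF : IsDensity α F) (hw : IsCoercive α F w)
    {p : ℕ → ℝ → Fin T → ℂ} (hp : ∀ n, MemLalpha α F (p n))
    (hc : Tendsto (fun n : ℕ × ℕ => lpow α F (p n.1 - p n.2)) atTop (𝓝 0)) :
    ∃ h, MemLalpha α F h ∧ Tendsto (fun n => lpow α F (h - p n)) atTop (𝓝 0) := by
  have hmem : ∀ n, MemLp (p n) 1 lebPi := fun n =>
    memLp_one_iff_integrable.2 (hw.integrable_of_mem hα hF (hp n))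
  have hc1 := hw.tendsto_lintegral hα hF (fun n : ℕ × ℕ => (hp n.1).1.sub (hp n.2).1) hc
  -- The candidate for the limit comes from completeness of `L¹`; along a subsequence the
  -- convergence is almost everywhere.
  have hcau : CauchySeq fun n => (hmem n).toLp (p n) := by
    rw [Lp.cauchySeq_Lp_iff_cauchySeq_eLpNorm]
    refine hc1.congr fun n => ?_
    rw [← eLpNorm_one_eq_lintegral_enorm]
    refine eLpNorm_congr_ae ?_
    filter_upwards [(hmem n.1).coeFn_toLp, (hmem n.2).coeFn_toLp] with θ h1 h2
    simp only [Pi.sub_apply, h1, h2]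
  obtain ⟨h, hh⟩ := cauchySeq_tendsto_of_complete hcau
  obtain ⟨ns, hns, hae⟩ := (tendstoInMeasure_of_tendsto_Lp hh).exists_seq_tendsto_ae
  have hae' : ∀ᵐ θ ∂lebPi, Tendsto (fun k => p (ns k) θ) atTop (𝓝 (h θ)) := by
    have h1 : ∀ᵐ θ ∂lebPi, ∀ n, (hmem n).toLp (p n) θ = p n θ :=
      ae_all_iff.2 fun n => (hmem n).coeFn_toLp
    filter_upwards [hae, h1] with θ h2 h3
    simpa only [h3] using h2
  have hhm : AEStronglyMeasurable h lebPi := Lp.aestronglyMeasurable h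
  -- Fatou's lemma along this subsequence transfers the Cauchy property of `lpow` to the limit.
  have hfatou : ∀ n, lpow α F (h - p n) ≤
      liminf (fun k => lpow α F (p (ns k) - p n)) atTop := by
    intro n
    have h1 : lpow α F (h - p n) = ∫⁻ θ, liminf (fun k =>
        ENNReal.ofReal (nform α (F θ) ((p (ns k) - p n) θ))) atTop ∂lebPi := by
      rw [lpow_eq]
      refine lintegral_congr_ae ?_
      filter_upwards [hae'] with θ hθ
      have h2 : Tendsto (fun k => ENNReal.ofReal (nform α (F θ) ((p (ns k) - p n) θ))) atTop
          (𝓝 (ENNReal.ofReal (nform α (F θ) ((h - p n : ℝ → Fin T → ℂ) θ)))) :=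
        ENNReal.tendsto_ofReal (((continuous_nform hα (F θ)).tendsto _).comp
          (hθ.sub_const (p n θ)))
      exact h2.liminf_eq.symm
    rw [h1]
    exact lintegral_liminf_le' fun k =>
      (aemeasurable_nform hF.integrable ((hp (ns k)).1.sub (hp n).1)).ennreal_ofReal
  have hlim : Tendsto (fun n => lpow α F (h - p n)) atTop (𝓝 0) := by
    rw [ENNReal.tendsto_atTop_zero]
    intro ε hε
    rw [ENNReal.tendsto_nhds_zero] at hc
    obtain ⟨N, hN⟩ := eventually_atTop.1 (hc ε hε)
    refine ⟨max N.1 N.2, fun n hn => (hfatou n).trans ?_⟩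
    refine liminf_le_of_le (by isBoundedDefault) fun b hb => ?_
    obtain ⟨k, hk1, hk2⟩ := (hb.and (hns.tendsto_atTop.eventually_ge_atTop N.1)).exists
    exact hk1.trans (hN (ns k, n) ⟨hk2, (le_max_right _ _).trans hn⟩)
  refine ⟨h, ⟨hhm, ?_⟩, hlim⟩
  obtain ⟨n, hn⟩ := (hlim.eventually (gt_mem_nhds one_pos)).exists
  have h1 : MemLalpha α F (h - p n) := ⟨hhm.sub (hp n).1, hn.trans (by simp)⟩
  have h2 := h1.add hα hF (hp n)
  rw [sub_add_cancel] at h2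
  exact h2.2

end Coercive

/-! ### Existence and uniqueness of the minimiser of the error. -/

section Minimizer

variable {T : ℕ} {α : ℝ} {f g : ℝ → Matrix (Fin T) (Fin T) ℂ} {A h : ℝ → Fin T → ℂ} {w : ℝ → ℝ}

/-- The error `∫ (A - h)^⊤ f (A - h)^{<α-1>} + ∫ h^⊤ g h^{<α-1>}` of the estimate given by `h`. -/
def errorPow (α : ℝ) (f g : ℝ → Matrix (Fin T) (Fin T) ℂ) (A h : ℝ → Fin T → ℂ) : ℝ≥0∞ :=
  lpow α f (A - h) + lpow α g h

lemma lpow_le_add_left (hα : 1 < α) (hf : IsDensity α f) (hg : IsDensity α g)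
    {u : ℝ → Fin T → ℂ} (hu : AEStronglyMeasurable u lebPi) : lpow α f u ≤ lpow α (f + g) u := by
  rw [lpow_add_density hα hf hg hu]
  exact le_self_add

lemma lpow_le_add_right (hα : 1 < α) (hf : IsDensity α f) (hg : IsDensity α g)
    {u : ℝ → Fin T → ℂ} (hu : AEStronglyMeasurable u lebPi) : lpow α g u ≤ lpow α (f + g) u := by
  rw [lpow_add_density hα hf hg hu]
  exact le_add_self

lemma MemLalpha.left (hα : 1 < α) (hf : IsDensity α f) (hg : IsDensity α g)
    (hA : MemLalpha α (f + g) A) : MemLalpha α f A :=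
  ⟨hA.1, (lpow_le_add_left hα hf hg hA.1).trans_lt hA.2⟩

lemma MemLalpha.right (hα : 1 < α) (hf : IsDensity α f) (hg : IsDensity α g)
    (hA : MemLalpha α (f + g) A) : MemLalpha α g A :=
  ⟨hA.1, (lpow_le_add_right hα hf hg hA.1).trans_lt hA.2⟩

lemma errorPow_lt_top (hα : 1 < α) (hf : IsDensity α f) (hg : IsDensity α g)
    (hA : MemLalpha α (f + g) A) (hh : MemLalpha α (f + g) h) : errorPow α f g A h < ∞ :=
  ENNReal.add_lt_top.2 ⟨((hA.sub hα (hf.add hg) hh).left hα hf hg).2, (hh.right hα hf hg).2⟩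

lemma tendsto_errorPow (hα : 1 < α) (hf : IsDensity α f) (hg : IsDensity α g)
    (hA : MemLalpha α (f + g) A) (hh : MemLalpha α (f + g) h) {p : ℕ → ℝ → Fin T → ℂ}
    (hp : ∀ n, AEStronglyMeasurable (p n) lebPi)
    (hlim : Tendsto (fun n => lpow α (f + g) (h - p n)) atTop (𝓝 0)) :
    Tendsto (fun n => errorPow α f g A (p n)) atTop (𝓝 (errorPow α f g A h)) := by
  have hfl : Tendsto (fun n => lpow α f (h - p n)) atTop (𝓝 0) :=
    tendsto_of_tendsto_of_tendsto_of_le_of_le tendsto_const_nhds hlim (fun _ => zero_le)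
      fun n => lpow_le_add_left hα hf hg (hh.1.sub (hp n))
  have hgl : Tendsto (fun n => lpow α g (h - p n)) atTop (𝓝 0) :=
    tendsto_of_tendsto_of_tendsto_of_le_of_le tendsto_const_nhds hlim (fun _ => zero_le)
      fun n => lpow_le_add_right hα hf hg (hh.1.sub (hp n))
  refine Tendsto.add ?_ ?_
  · refine tendsto_lpow_of_sub hα hf (hA.1.sub hh.1) (fun n => hA.1.sub (hp n))
      ((hA.sub hα (hf.add hg) hh).left hα hf hg).2 (hfl.congr fun n => ?_)
    rw [lpow_sub_comm]
    congr 1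
    abel
  · exact tendsto_lpow_of_sub hα hg hh.1 hp (hh.right hα hf hg).2 hgl

lemma exists_lpow_sub_le (T : ℕ) (hα : 1 < α) {ε : ℝ} (hε : 0 < ε) :
    ∃ C : ℝ, 0 ≤ C ∧ ∀ (f : ℝ → Matrix (Fin T) (Fin T) ℂ) (u v : ℝ → Fin T → ℂ), IsDensity α f →
      AEStronglyMeasurable u lebPi → AEStronglyMeasurable v lebPi →
      lpow α f (u - v) + ENNReal.ofReal C * lpow α f ((1 / 2 : ℂ) • (u + v)) ≤
        ENNReal.ofReal (ε + C / 2) * (lpow α f u + lpow α f v) := by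
  obtain ⟨C, hC, h⟩ := exists_nform_sub_le (T := T) hα hε
  refine ⟨C, hC, fun f u v hf hu hv => ?_⟩
  simp_rw [lpow_eq]
  have hm := fun {u : ℝ → Fin T → ℂ} (hu : AEStronglyMeasurable u lebPi) =>
    (aemeasurable_nform (α := α) hf.integrable hu).ennreal_ofReal
  rw [← lintegral_const_mul' _ _ ENNReal.ofReal_ne_top, ← lintegral_add_left' (hm (hu.sub hv)),
    ← lintegral_add_left' (hm hu), ← lintegral_const_mul' _ _ ENNReal.ofReal_ne_top]
  refine lintegral_mono_ae ?_
  filter_upwards [hf.stable] with θ h1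
  rw [← ENNReal.ofReal_mul hC, ← ENNReal.ofReal_add (h1.nform_nonneg hα _)
      (mul_nonneg hC (h1.nform_nonneg hα _)),
    ← ENNReal.ofReal_add (h1.nform_nonneg hα _) (h1.nform_nonneg hα _),
    ← ENNReal.ofReal_mul (by positivity)]
  exact ENNReal.ofReal_le_ofReal (h _ h1 _ _)

/-- The pairs `(A - p, A - q)` for `f` and `(p, q)` for `g` have the same difference up to sign, and
the midpoint of the first is `A` minus the midpoint of the second. The two inequalities therefore
add up to uniform convexity of the error, measured in `L^α(f+g)`. -/
lemma exists_errorPow_le (T : ℕ) (hα : 1 < α) {ε : ℝ} (hε : 0 < ε) :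
    ∃ C : ℝ, 0 ≤ C ∧ ∀ (f g : ℝ → Matrix (Fin T) (Fin T) ℂ) (A p q : ℝ → Fin T → ℂ),
      IsDensity α f → IsDensity α g → AEStronglyMeasurable A lebPi →
      AEStronglyMeasurable p lebPi → AEStronglyMeasurable q lebPi →
      lpow α (f + g) (p - q) + ENNReal.ofReal C * errorPow α f g A ((1 / 2 : ℂ) • (p + q)) ≤
        ENNReal.ofReal (ε + C / 2) * (errorPow α f g A p + errorPow α f g A q) := by
  obtain ⟨C, hC, h⟩ := exists_lpow_sub_le T hα hε
  refine ⟨C, hC, fun f g A p q hf hg hA hp hq => ?_⟩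
  have h1 := h f (A - p) (A - q) hf (hA.sub hp) (hA.sub hq)
  have h2 := h g p q hg hp hq
  have e1 : A - p - (A - q) = -(p - q) := by abel
  have e2 : (1 / 2 : ℂ) • (A - p + (A - q)) = A - (1 / 2 : ℂ) • (p + q) := by
    funext θ k
    simp only [Pi.smul_apply, Pi.add_apply, Pi.sub_apply, smul_eq_mul]
    ring
  rw [e1, e2, lpow_neg] at h1
  rw [lpow_add_density hα hf hg (hp.sub hq), errorPow, errorPow, errorPow]
  calc _ = (lpow α f (p - q) + ENNReal.ofReal C * lpow α f (A - (1 / 2 : ℂ) • (p + q))) +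
        (lpow α g (p - q) + ENNReal.ofReal C * lpow α g ((1 / 2 : ℂ) • (p + q))) := by ring
    _ ≤ _ := add_le_add h1 h2
    _ = _ := by ring

/-- Existence of a best approximation in the closure of a subspace. -/
lemma exists_minimizer (hα : 1 < α) (hf : IsDensity α f) (hg : IsDensity α g)
    (hw : IsCoercive α (f + g) w) (hA : MemLalpha α (f + g) A)
    (V : Submodule ℂ (ℝ → Fin T → ℂ)) (hV : ∀ p ∈ V, MemLalpha α (f + g) p) :
    ∃ (h : ℝ → Fin T → ℂ) (p : ℕ → ℝ → Fin T → ℂ), MemLalpha α (f + g) h ∧ (∀ n, p n ∈ V) ∧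
      Tendsto (fun n => lpow α (f + g) (h - p n)) atTop (𝓝 0) ∧
      ∀ q ∈ V, errorPow α f g A h ≤ errorPow α f g A q := by
  set d := ⨅ q : V, errorPow α f g A q with hd
  have hdle : ∀ q ∈ V, d ≤ errorPow α f g A q := fun q hq => iInf_le (fun q : V => errorPow α f g A q) ⟨q, hq⟩
  have hdfin : d ≠ ∞ := ne_top_of_le_ne_top
    (errorPow_lt_top hα hf hg hA (hV 0 V.zero_mem)).ne (hdle 0 V.zero_mem)
  let δ : ℕ → ℝ≥0∞ := fun n => ENNReal.ofReal (1 / ((n : ℝ) + 1))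
  have hδ0 : ∀ n, 0 < δ n := fun n => ENNReal.ofReal_pos.2 (by positivity)
  have hδlim : Tendsto δ atTop (𝓝 0) := by
    have := ENNReal.tendsto_ofReal (tendsto_one_div_add_atTop_nhds_zero_nat (𝕜 := ℝ))
    rwa [ENNReal.ofReal_zero] at this
  have hex : ∀ n, ∃ q ∈ V, errorPow α f g A q < d + δ n := by
    intro n
    have : d < d + δ n := ENNReal.lt_add_right hdfin (hδ0 n).ne'
    obtain ⟨q, hq⟩ := iInf_lt_iff.1 this
    exact ⟨q, q.2, hq⟩
  choose p hpV hp using hex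
  have hpm : ∀ n, MemLalpha α (f + g) (p n) := fun n => hV _ (hpV n)
  have hc : Tendsto (fun n : ℕ × ℕ => lpow α (f + g) (p n.1 - p n.2)) atTop (𝓝 0) := by
    rw [ENNReal.tendsto_nhds_zero]
    intro η hη
    wlog hηfin : η ≠ ∞ generalizing η
    · push Not at hηfin
      exact Eventually.of_forall fun n => by rw [hηfin]; exact le_top
    have hη' : 0 < η.toReal := ENNReal.toReal_pos hη.ne' hηfin
    -- Chosen so that `2 ε d ≤ η/2`.
    set ε := η.toReal / (4 * (d.toReal + 1)) with hε
    have hdn : 0 ≤ d.toReal := ENNReal.toReal_nonneg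
    have hε0 : 0 < ε := by positivity
    obtain ⟨C, hC, hle⟩ := exists_errorPow_le T hα hε0
    have hlim2 : Tendsto (fun n : ℕ × ℕ => ENNReal.ofReal (ε + C / 2) * (δ n.1 + δ n.2)) atTop
        (𝓝 0) := by
      rw [← prod_atTop_atTop_eq]
      have h1 : Tendsto (fun n : ℕ × ℕ => δ n.1 + δ n.2) (atTop ×ˢ atTop) (𝓝 (0 + 0)) :=
        (hδlim.comp tendsto_fst).add (hδlim.comp tendsto_snd)
      have h2 := ENNReal.Tendsto.const_mul (a := ENNReal.ofReal (ε + C / 2)) h1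
        (Or.inr ENNReal.ofReal_ne_top)
      simpa using h2
    have hη2 : 0 < η / 2 := ENNReal.half_pos hη.ne'
    filter_upwards [hlim2.eventually (gt_mem_nhds hη2)] with n hn
    have h1 := hle f g A (p n.1) (p n.2) hf hg hA.1 (hpm _).1 (hpm _).1
    have h2 : d ≤ errorPow α f g A ((1 / 2 : ℂ) • (p n.1 + p n.2)) :=
      hdle _ (V.smul_mem _ (V.add_mem (hpV _) (hpV _)))
    -- The midpoint lies in `V` and has error at least `d`. So the term `C d` appears on both sides
    -- and cancels, which leaves `2 ε d` and a remainder tending to zero.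
    have h3 : lpow α (f + g) (p n.1 - p n.2) + ENNReal.ofReal C * d ≤
        (2 * ENNReal.ofReal ε * d + ENNReal.ofReal (ε + C / 2) * (δ n.1 + δ n.2)) +
          ENNReal.ofReal C * d := by
      calc _ ≤ lpow α (f + g) (p n.1 - p n.2) +
            ENNReal.ofReal C * errorPow α f g A ((1 / 2 : ℂ) • (p n.1 + p n.2)) := by gcongr
        _ ≤ _ := h1
        _ ≤ ENNReal.ofReal (ε + C / 2) * ((d + δ n.1) + (d + δ n.2)) := by
          gcongr
          · exact (hp _).le
          · exact (hp _).le
        _ = 2 * ENNReal.ofReal (ε + C / 2) * d + ENNReal.ofReal (ε + C / 2) * (δ n.1 + δ n.2) := by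
          ring
        _ = _ := by
          have e : 2 * ENNReal.ofReal (ε + C / 2) = 2 * ENNReal.ofReal ε + ENNReal.ofReal C := by
            rw [ENNReal.ofReal_add hε0.le (by positivity), mul_add]
            congr 1
            rw [show (2 : ℝ≥0∞) = ENNReal.ofReal 2 by simp, ← ENNReal.ofReal_mul (by norm_num)]
            congr 1
            ring
          rw [e]
          ring
    have h4 := (ENNReal.add_le_add_iff_right (by finiteness)).1 h3
    refine h4.trans ?_
    have h5 : 2 * ENNReal.ofReal ε * d ≤ η / 2 := by
      rw [← ENNReal.ofReal_toReal hdfin, ← ENNReal.ofReal_toReal hηfin,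
        show (2 : ℝ≥0∞) = ENNReal.ofReal 2 by simp, ← ENNReal.ofReal_mul (by norm_num),
        ← ENNReal.ofReal_mul (by positivity), ← ENNReal.ofReal_div_of_pos (by norm_num)]
      refine ENNReal.ofReal_le_ofReal ?_
      rw [hε, mul_div_assoc', div_mul_eq_mul_div, div_le_div_iff₀ (by positivity) (by norm_num)]
      nlinarith
    calc _ ≤ η / 2 + η / 2 := add_le_add h5 hn.le
      _ = η := ENNReal.add_halves η
  obtain ⟨h, hh, hlim⟩ := hw.exists_limit hα (hf.add hg) hpm hc
  refine ⟨h, p, hh, hpV, hlim, fun q hq => ?_⟩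
  have h1 := tendsto_errorPow hα hf hg hA hh (fun n => (hpm n).1) hlim
  have h2 : Tendsto (fun n => d + δ n) atTop (𝓝 (d + 0)) := hδlim.const_add d
  rw [add_zero] at h2
  exact (le_of_tendsto_of_tendsto' h1 h2 fun n => (hp n).le).trans (hdle q hq)

/-- At exact minimisers the same cancellation leaves only `2 ε d`, with `ε` arbitrary. -/
lemma minimizer_unique (hα : 1 < α) (hf : IsDensity α f) (hg : IsDensity α g)
    (hA : MemLalpha α (f + g) A) {h h' : ℝ → Fin T → ℂ} (hh : MemLalpha α (f + g) h)
    (hh' : MemLalpha α (f + g) h')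
    (hle : errorPow α f g A h' ≤ errorPow α f g A h)
    (hmid : errorPow α f g A h ≤ errorPow α f g A ((1 / 2 : ℂ) • (h + h'))) :
    lpow α (f + g) (h - h') = 0 := by
  set d := errorPow α f g A h with hd
  have hdfin : d ≠ ∞ := (errorPow_lt_top hα hf hg hA hh).ne
  have hdn : 0 ≤ d.toReal := ENNReal.toReal_nonneg
  refine le_antisymm (ENNReal.le_of_forall_pos_le_add fun η hη _ => ?_) zero_le
  set ε := (η : ℝ) / (2 * (d.toReal + 1)) with hε
  have hη' : (0 : ℝ) < η := hη
  have hε0 : 0 < ε := by positivity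
  obtain ⟨C, hC, hle2⟩ := exists_errorPow_le T hα hε0
  have h1 := hle2 f g A h h' hf hg hA.1 hh.1 hh'.1
  have h3 : lpow α (f + g) (h - h') + ENNReal.ofReal C * d ≤
      2 * ENNReal.ofReal ε * d + ENNReal.ofReal C * d := by
    calc _ ≤ _ := add_le_add le_rfl (mul_le_mul_right hmid _)
      _ ≤ _ := h1
      _ ≤ ENNReal.ofReal (ε + C / 2) * (d + d) := by gcongr
      _ = 2 * ENNReal.ofReal (ε + C / 2) * d := by ring
      _ = _ := by
        have e : 2 * ENNReal.ofReal (ε + C / 2) = 2 * ENNReal.ofReal ε + ENNReal.ofReal C := by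
          rw [ENNReal.ofReal_add hε0.le (by positivity), mul_add]
          congr 1
          rw [show (2 : ℝ≥0∞) = ENNReal.ofReal 2 by simp, ← ENNReal.ofReal_mul (by norm_num)]
          congr 1
          ring
        rw [e]
        ring
  have h4 := (ENNReal.add_le_add_iff_right (by finiteness)).1 h3
  refine h4.trans ?_
  rw [zero_add, ← ENNReal.ofReal_toReal hdfin, ← ENNReal.ofReal_coe_nnreal,
    show (2 : ℝ≥0∞) = ENNReal.ofReal 2 by simp, ← ENNReal.ofReal_mul (by norm_num),
    ← ENNReal.ofReal_mul (by positivity)]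
  refine ENNReal.ofReal_le_ofReal ?_
  rw [hε, mul_div_assoc', div_mul_eq_mul_div, div_le_iff₀ (by positivity)]
  nlinarith

lemma IsCoercive.ae_eq_of_lpow_eq_zero {F : ℝ → Matrix (Fin T) (Fin T) ℂ} (hα : 1 < α)
    (hF : IsDensity α F) (hw : IsCoercive α F w)
    {u v : ℝ → Fin T → ℂ} (hu : AEStronglyMeasurable u lebPi) (hv : AEStronglyMeasurable v lebPi)
    (h : lpow α F (u - v) = 0) : u =ᵐ[lebPi] v := by
  have h1 := hw.lintegral_enorm_le hα hF (hu.sub hv)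
  rw [h, ENNReal.zero_rpow_of_pos (by have : 0 < α := by linarith
                                      positivity), mul_zero, nonpos_iff_eq_zero,
    lintegral_eq_zero_iff' (hu.sub hv).enorm] at h1
  filter_upwards [h1] with θ hθ
  simpa [sub_eq_zero] using hθ

end Minimizer

/-! ### Fourier coefficients of integrable functions on `(-π, π]`. -/

section Fourier

lemma continuous_cexp_int (j : ℤ) : Continuous fun θ : ℝ => Complex.exp (Complex.I * j * θ) := by
  fun_prop

lemma norm_cexp_int (j : ℤ) (θ : ℝ) : ‖Complex.exp (Complex.I * j * θ)‖ = 1 := by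
  rw [show Complex.I * j * θ = (((j : ℝ) * θ : ℝ) : ℂ) * Complex.I by push_cast; ring]
  exact Complex.norm_exp_ofReal_mul_I _

lemma integrable_cexp_mul (j : ℤ) {G : ℝ → ℂ} (hG : Integrable G lebPi) :
    Integrable (fun θ : ℝ => Complex.exp (Complex.I * j * θ) * G θ) lebPi :=
  hG.bdd_mul (c := 1) (continuous_cexp_int j).aestronglyMeasurable
    (ae_of_all _ fun θ => (norm_cexp_int j θ).le)

/-- An integrable function on `(-π, π]` is determined by its Fourier coefficients. -/
lemma ae_eq_zero_of_fourier {G : ℝ → ℂ} (hG : Integrable G lebPi)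
    (h : ∀ j : ℤ, ∫ θ, Complex.exp (Complex.I * j * θ) * G θ ∂lebPi = 0) : G =ᵐ[lebPi] 0 := by
  have hpi := Real.pi_pos
  have : Fact (0 < 2 * Real.pi) := ⟨by positivity⟩
  have hbd : ∀ ψ : C(AddCircle (2 * Real.pi), ℂ),
      Integrable (fun θ : ℝ => ψ (θ : AddCircle (2 * Real.pi)) * G θ) lebPi := fun ψ =>
    hG.bdd_mul (c := ‖ψ‖)
      (ψ.continuous.comp (AddCircle.continuous_mk' _)).aestronglyMeasurable
      (ae_of_all _ fun θ => ψ.norm_coe_le_norm _)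
  -- Integration against `G` is a bounded functional on continuous periodic functions. It vanishes
  -- on trigonometric polynomials, hence everywhere by their uniform density.
  let Λ : C(AddCircle (2 * Real.pi), ℂ) →L[ℂ] ℂ := LinearMap.mkContinuous
    { toFun := fun ψ => ∫ θ, ψ (θ : AddCircle (2 * Real.pi)) * G θ ∂lebPi
      map_add' := fun ψ ψ' => by
        rw [← integral_add (hbd ψ) (hbd ψ')]
        congr 1; funext θ; simp [add_mul]
      map_smul' := fun c ψ => by
        rw [RingHom.id_apply, smul_eq_mul, ← integral_const_mul]
        congr 1; funext θ; simp [mul_assoc] }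
    (∫ θ, ‖G θ‖ ∂lebPi) fun ψ => by
      change ‖∫ θ, ψ (θ : AddCircle (2 * Real.pi)) * G θ ∂lebPi‖ ≤ _
      rw [mul_comm (∫ θ, ‖G θ‖ ∂lebPi), ← integral_const_mul]
      refine norm_integral_le_of_norm_le (hG.norm.const_mul _) (ae_of_all _ fun θ => ?_)
      rw [norm_mul]
      gcongr
      exact ψ.norm_coe_le_norm _
  have hker : (Submodule.span ℂ (range (@fourier (2 * Real.pi)))).topologicalClosure ≤
      (Λ : C(AddCircle (2 * Real.pi), ℂ) →ₗ[ℂ] ℂ).ker := by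
    refine Submodule.topologicalClosure_minimal _ ?_ Λ.isClosed_ker
    rw [Submodule.span_le]
    rintro _ ⟨j, rfl⟩
    change ∫ θ : ℝ, fourier j (θ : AddCircle (2 * Real.pi)) * G θ ∂lebPi = 0
    rw [← h j]
    congr 1
    funext θ
    rw [fourier_coe_apply]
    congr 2
    push_cast
    field_simp
  rw [span_fourier_closure_eq_top] at hker
  have hloc : LocallyIntegrableOn G (Ioo (-Real.pi) Real.pi) volume :=
    IntegrableOn.locallyIntegrableOn (IntegrableOn.mono_set hG Ioo_subset_Ioc_self)
  -- Test functions supported in the open interval vanish at both ends, so they extend to continuous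
  -- periodic functions.
  have key := isOpen_Ioo.ae_eq_zero_of_integral_contDiff_smul_eq_zero hloc (by
    intro φ hφ _ hsupp
    have hz : ∀ x, x ∉ Ioo (-Real.pi) Real.pi → φ x = 0 := fun x hx =>
      image_eq_zero_of_notMem_tsupport fun hx' => hx (hsupp hx')
    have hper : (-Real.pi : ℝ) + 2 * Real.pi = Real.pi := by ring
    let ψ : C(AddCircle (2 * Real.pi), ℂ) :=
      ⟨AddCircle.liftIoc (2 * Real.pi) (-Real.pi) fun x => (φ x : ℂ),
        AddCircle.liftIoc_continuous (by
          rw [hper, hz (-Real.pi) (by simp), hz Real.pi (by simp)])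
          (Complex.continuous_ofReal.comp hφ.continuous).continuousOn⟩
    have hψ : Λ ψ = 0 := hker (Submodule.mem_top : ψ ∈ ⊤)
    have hψ' : ∫ θ, ψ (θ : AddCircle (2 * Real.pi)) * G θ ∂lebPi = 0 := hψ
    rw [← hψ', lebPi]
    have e1 : ∫ x, φ x • G x = ∫ x in Ioc (-Real.pi) Real.pi, φ x • G x := by
      rw [setIntegral_eq_integral_of_forall_compl_eq_zero]
      intro x hx
      rw [hz x fun hx' => hx (Ioo_subset_Ioc_self hx'), zero_smul]
    rw [e1]
    refine setIntegral_congr_fun measurableSet_Ioc fun x hx => ?_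
    have : ψ (x : AddCircle (2 * Real.pi)) = (φ x : ℂ) :=
      AddCircle.liftIoc_coe_apply (f := fun x => (φ x : ℂ)) (by rw [hper]; exact hx)
    rw [this, Complex.real_smul])
  rw [lebPi, EventuallyEq, ae_restrict_iff' measurableSet_Ioc]
  have hne : ∀ᵐ θ ∂(volume : Measure ℝ), θ ≠ Real.pi := by simp [ae_iff, measure_singleton]
  filter_upwards [key, hne] with θ h1 h2 h3
  exact h1 ⟨h3.1, lt_of_le_of_ne h3.2 h2⟩

lemma integral_cexp_int (j : ℤ) :
    ∫ θ : ℝ, Complex.exp (Complex.I * j * θ) ∂lebPi = if j = 0 then (2 * Real.pi : ℂ) else 0 := by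
  have hpi := Real.pi_pos
  rw [lebPi, ← intervalIntegral.integral_of_le (by linarith)]
  split_ifs with hj
  · subst hj
    simp
    ring
  · have hc : Complex.I * (j : ℂ) ≠ 0 :=
      mul_ne_zero Complex.I_ne_zero (by exact_mod_cast hj)
    rw [integral_exp_mul_complex hc]
    have : Complex.exp (Complex.I * j * (Real.pi : ℂ)) =
        Complex.exp (Complex.I * j * ((-Real.pi : ℝ) : ℂ)) := by
      rw [Complex.exp_eq_exp_iff_exists_int]
      exact ⟨j, by push_cast; ring⟩
    rw [this, sub_self, zero_div]

variable {T N : ℕ}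

lemma cexp_neg_eq (j : Fin (N + 1)) (θ : ℝ) :
    Complex.exp (-Complex.I * ((j : ℕ) : ℂ) * θ) =
      Complex.exp (Complex.I * ((-((j : ℕ) : ℤ) : ℤ) : ℂ) * θ) := by
  congr 1
  push_cast
  ring

lemma continuous_polyC (c : Fin (N + 1) → Fin T → ℂ) : Continuous (polyC c) := by
  refine continuous_pi fun k => ?_
  simp only [polyC]
  fun_prop

lemma continuous_polyA (a : Fin (N + 1) → Fin T → ℂ) : Continuous (polyA a) := by
  refine continuous_pi fun k => ?_
  simp only [polyA]
  fun_prop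

lemma integrable_of_continuous {E : Type*} [NormedAddCommGroup E] {u : ℝ → E} (hu : Continuous u) :
    Integrable u lebPi :=
  (hu.integrableOn_Icc (a := -Real.pi) (b := Real.pi)).mono_set Ioc_subset_Icc_self

lemma fourier_polyC (c : Fin (N + 1) → Fin T → ℂ) (k : Fin T) (m : ℤ) :
    ∫ θ, Complex.exp (Complex.I * m * θ) * polyC c θ k ∂lebPi =
      ∑ j : Fin (N + 1), c j k * (if m - ((j : ℕ) : ℤ) = 0 then (2 * Real.pi : ℂ) else 0) := by
  have h1 : ∀ θ : ℝ, Complex.exp (Complex.I * m * θ) * polyC c θ k =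
      ∑ j : Fin (N + 1), c j k * Complex.exp (Complex.I * ((m - ((j : ℕ) : ℤ) : ℤ) : ℂ) * θ) := by
    intro θ
    rw [polyC, Finset.mul_sum]
    refine Finset.sum_congr rfl fun j _ => ?_
    rw [mul_left_comm, ← Complex.exp_add]
    congr 2
    push_cast
    ring
  simp_rw [h1]
  rw [integral_finsetSum _ fun j _ =>
    (integrable_of_continuous (continuous_cexp_int _)).const_mul _]
  refine Finset.sum_congr rfl fun j _ => ?_
  rw [integral_const_mul, integral_cexp_int]

lemma polyC_injective {c c' : Fin (N + 1) → Fin T → ℂ} (h : polyC c =ᵐ[lebPi] polyC c') :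
    c = c' := by
  have key : ∀ (c : Fin (N + 1) → Fin T → ℂ) (j : Fin (N + 1)) (k : Fin T),
      ∫ θ, Complex.exp (Complex.I * (((j : ℕ) : ℤ) : ℂ) * θ) * polyC c θ k ∂lebPi =
        c j k * (2 * Real.pi) := by
    intro c j k
    rw [fourier_polyC, Finset.sum_eq_single j]
    · simp
    · intro i _ hi
      rw [if_neg, mul_zero]
      intro h0
      apply hi
      ext
      omega
    · simp
  funext j k
  have h1 : c j k * (2 * Real.pi) = c' j k * (2 * Real.pi) := by
    rw [← key, ← key]
    refine integral_congr_ae (h.mono fun θ hθ => ?_)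
    simp only [hθ]
  refine mul_right_cancel₀ ?_ h1
  exact_mod_cast (by positivity : (2 * Real.pi) ≠ 0)

/-- An integrable function whose Fourier coefficients vanish outside of `{0, …, N}` is a
trigonometric polynomial. -/
lemma exists_polyC {G : ℝ → Fin T → ℂ} (hG : ∀ k, Integrable (fun θ => G θ k) lebPi)
    (h : ∀ (j : ℤ) (k : Fin T), j ∉ Icc (0 : ℤ) N →
      ∫ θ, Complex.exp (Complex.I * j * θ) * G θ k ∂lebPi = 0) :
    ∃ c : Fin (N + 1) → Fin T → ℂ, G =ᵐ[lebPi] polyC c := by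
  have h2pi : ((2 * Real.pi : ℝ) : ℂ) ≠ 0 := by
    exact_mod_cast (by positivity : (2 * Real.pi) ≠ 0)
  let c : Fin (N + 1) → Fin T → ℂ := fun j k =>
    (∫ θ, Complex.exp (Complex.I * (((j : ℕ) : ℤ) : ℂ) * θ) * G θ k ∂lebPi) / ((2 * Real.pi : ℝ) : ℂ)
  refine ⟨c, ?_⟩
  have hk : ∀ k, (fun θ => G θ k - polyC c θ k) =ᵐ[lebPi] 0 := by
    intro k
    have hcC : Integrable (fun θ => polyC c θ k) lebPi :=
      integrable_of_continuous ((continuous_apply k).comp (continuous_polyC c))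
    refine ae_eq_zero_of_fourier ((hG k).sub hcC) fun m => ?_
    simp_rw [mul_sub]
    rw [integral_sub (integrable_cexp_mul m (hG k)) (integrable_cexp_mul m hcC), fourier_polyC]
    by_cases hm : m ∈ Icc (0 : ℤ) N
    · let j : Fin (N + 1) := ⟨m.toNat, by have := hm.1; have := hm.2; omega⟩
      have hj : ((j : ℕ) : ℤ) = m := Int.toNat_of_nonneg hm.1
      rw [Finset.sum_eq_single j]
      · rw [hj, sub_self, if_pos rfl]
        simp only [c, hj]
        push_cast at h2pi ⊢
        rw [div_mul_cancel₀ _ h2pi, sub_self]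
      · intro i _ hi
        rw [if_neg, mul_zero]
        intro h0
        apply hi
        ext
        omega
      · simp
    · rw [h m k hm, Finset.sum_eq_zero, sub_zero]
      intro j _
      rw [if_neg, mul_zero]
      intro h0
      apply hm
      have := j.2
      constructor <;> omega
  have hall : ∀ᵐ θ ∂lebPi, ∀ k, G θ k - polyC c θ k = 0 := ae_all_iff.2 hk
  filter_upwards [hall] with θ hθ
  funext k
  exact sub_eq_zero.1 (hθ k)

end Fourier

/-! ### First order condition and uniqueness of the solution. -/

section Stationarity

variable {T : ℕ} {α : ℝ} {f g : ℝ → Matrix (Fin T) (Fin T) ℂ} {A h : ℝ → Fin T → ℂ} {w : ℝ → ℝ}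
  {u v : ℝ → Fin T → ℂ}

lemma integrable_nform (hα : 1 < α) (hf : IsDensity α f) (hu : MemLalpha α f u) :
    Integrable (fun θ => nform α (f θ) (u θ)) lebPi := by
  refine ⟨(aemeasurable_nform hf.integrable hu.1).aestronglyMeasurable, ?_⟩
  rw [hasFiniteIntegral_iff_ofReal (hf.stable.mono fun θ h => h.nform_nonneg hα _)]
  exact hu.2

lemma lpow_toReal (hα : 1 < α) (hf : IsDensity α f) (hu : MemLalpha α f u) :
    (lpow α f u).toReal = ∫ θ, nform α (f θ) (u θ) ∂lebPi := by
  rw [lpow_eq, ← integral_eq_lintegral_of_nonneg_ae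
    (hf.stable.mono fun θ h => h.nform_nonneg hα _)
    (aemeasurable_nform hf.integrable hu.1).aestronglyMeasurable]

lemma integrable_sform (hα : 1 < α) (hf : IsDensity α f) (hu : MemLalpha α f u)
    (hv : MemLalpha α f v) : Integrable (fun θ => sform α (f θ) (u θ) (v θ)) lebPi := by
  refine ((integrable_nform hα hf hu).add (integrable_nform hα hf hv)).mono'
    (aestronglyMeasurable_sform hf.integrable hu.1 hv.1) ?_
  filter_upwards [hf.stable] with θ h1
  exact h1.norm_sform_le hα _ _

lemma integral_sform_self (hα : 1 < α) (hf : IsDensity α f) (hu : MemLalpha α f u) :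
    ∫ θ, sform α (f θ) (u θ) (u θ) ∂lebPi = ((lpow α f u).toReal : ℂ) := by
  rw [lpow_toReal hα hf hu, ← integral_complex_ofReal]
  refine integral_congr_ae ?_
  filter_upwards [hf.stable] with θ h1
  exact h1.sform_self hα _

/-- The first order condition at a minimizer, for perturbations in the direction `q`. -/
lemma re_integral_nonpos_of_minimizer (hα : 1 < α) (hf : IsDensity α f) (hg : IsDensity α g)
    (hA : MemLalpha α (f + g) A) (hh : MemLalpha α (f + g) h) {q : ℝ → Fin T → ℂ}
    (hq : MemLalpha α (f + g) q)
    (hmin : ∀ ε : ℝ, errorPow α f g A h ≤ errorPow α f g A (h + (ε : ℂ) • q)) :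
    (∫ θ, (sform α (f θ) (q θ) (A θ - h θ) - sform α (g θ) (q θ) (h θ)) ∂lebPi).re ≤ 0 := by
  have hF := hf.add hg
  have hqf := hq.left hα hf hg
  have hqg := hq.right hα hf hg
  have hu : ∀ ε : ℝ, MemLalpha α f (A - h - (ε : ℂ) • q) := fun ε =>
    ((hA.sub hα hF hh).sub hα hF (hq.smul hα hF _)).left hα hf hg
  have hv : ∀ ε : ℝ, MemLalpha α g (h + (ε : ℂ) • q) := fun ε =>
    (hh.add hα hF (hq.smul hα hF _)).right hα hf hg
  have hu0 : MemLalpha α f (A - h) := (hA.sub hα hF hh).left hα hf hg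
  have hv0 : MemLalpha α g h := hh.right hα hf hg
  let S : ℝ → ℝ → ℂ := fun ε θ => sform α (f θ) (q θ) ((A - h - (ε : ℂ) • q) θ) -
    sform α (g θ) (q θ) ((h + (ε : ℂ) • q) θ)
  have hSint : ∀ ε, Integrable (S ε) lebPi := fun ε =>
    (integrable_sform hα hf hqf (hu ε)).sub (integrable_sform hα hg hqg (hv ε))
  -- The subgradient inequality is used at the perturbed point `h + εq`, not at `h`. It gives `E(h +
  -- εq) + α ε Re ∫ S ε ≤ E(h)`, and minimality gives the sign without differentiating the error
  -- `E`.
  have hneg : ∀ ε : ℝ, 0 < ε → (∫ θ, S ε θ ∂lebPi).re ≤ 0 := by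
    intro ε hε
    have hm := hmin ε
    rw [errorPow, errorPow, ← sub_sub] at hm
    have hm' := ENNReal.toReal_mono (ENNReal.add_lt_top.2 ⟨(hu ε).2, (hv ε).2⟩).ne hm
    rw [ENNReal.toReal_add hu0.2.ne hv0.2.ne, ENNReal.toReal_add (hu ε).2.ne (hv ε).2.ne,
      lpow_toReal hα hf hu0, lpow_toReal hα hg hv0, lpow_toReal hα hf (hu ε),
      lpow_toReal hα hg (hv ε)] at hm'
    have i1 := integrable_nform hα hf hu0
    have i2 := integrable_nform hα hg hv0
    have i3 := integrable_nform hα hf (hu ε)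
    have i4 := integrable_nform hα hg (hv ε)
    have i5 : Integrable (fun θ => (S ε θ).re) lebPi := (hSint ε).re
    have hle : ∫ θ, (nform α (f θ) ((A - h - (ε : ℂ) • q) θ) + nform α (g θ) ((h + (ε : ℂ) • q) θ) +
        α * ε * (S ε θ).re) ∂lebPi ≤
        ∫ θ, (nform α (f θ) ((A - h) θ) + nform α (g θ) (h θ)) ∂lebPi := by
      refine integral_mono_ae ((i3.add i4).add (i5.const_mul _)) (i1.add i2) ?_
      filter_upwards [hf.stable, hg.stable] with θ h1 h2
      have s1 := h1.subgradient hα ((A - h - (ε : ℂ) • q) θ) ((A - h) θ)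
      have s2 := h2.subgradient hα ((h + (ε : ℂ) • q) θ) (h θ)
      have e1 : (A - h) θ - (A - h - (ε : ℂ) • q) θ = (ε : ℂ) • q θ := by simp
      have e2 : h θ - (h + (ε : ℂ) • q) θ = ((-ε : ℝ) : ℂ) • q θ := by simp
      rw [e1, sform_smul_left, Complex.re_ofReal_mul] at s1
      rw [e2, sform_smul_left, Complex.re_ofReal_mul] at s2
      simp only [S, Complex.sub_re]
      linarith
    have i34 : Integrable (fun θ => nform α (f θ) ((A - h - (ε : ℂ) • q) θ) +
        nform α (g θ) ((h + (ε : ℂ) • q) θ)) lebPi := i3.add i4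
    rw [integral_add i34 (i5.const_mul _), integral_add i3 i4, integral_add i1 i2,
      integral_const_mul] at hle
    have h3 : α * ε * ∫ θ, (S ε θ).re ∂lebPi ≤ 0 := by linarith
    have h4 : ∫ θ, (S ε θ).re ∂lebPi ≤ 0 := by
      by_contra hc
      push Not at hc
      have : 0 < α * ε * ∫ θ, (S ε θ).re ∂lebPi := by positivity
      linarith
    have h5 : (∫ θ, S ε θ ∂lebPi).re = ∫ θ, (S ε θ).re ∂lebPi := (integral_re (hSint ε)).symm
    rw [h5]
    exact h4
  have hε0 : ∀ n : ℕ, (0 : ℝ) < 1 / ((n : ℝ) + 1) := fun n => by positivity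
  have hεlim : Tendsto (fun n : ℕ => 1 / ((n : ℝ) + 1)) atTop (𝓝 0) :=
    tendsto_one_div_add_atTop_nhds_zero_nat
  -- With `ε ≤ 1` this inequality supplies one integrable majorant for all perturbations.
  obtain ⟨K, hK, hKle⟩ := exists_nform_add_le (T := T) hα one_pos
  have hlim : Tendsto (fun n : ℕ => ∫ θ, S (1 / ((n : ℝ) + 1)) θ ∂lebPi) atTop
      (𝓝 (∫ θ, (sform α (f θ) (q θ) (A θ - h θ) - sform α (g θ) (q θ) (h θ)) ∂lebPi)) := by
    have iqf := integrable_nform hα hf hqf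
    have iqg := integrable_nform hα hg hqg
    have i1 := integrable_nform hα hf hu0
    have i2 := integrable_nform hα hg hv0
    refine tendsto_integral_of_dominated_convergence
      (fun θ => (nform α (f θ) (q θ) + ((1 + 1) * nform α (f θ) ((A - h) θ) +
        K * nform α (f θ) (q θ))) + (nform α (g θ) (q θ) + ((1 + 1) * nform α (g θ) (h θ) +
        K * nform α (g θ) (q θ)))) (fun n => (hSint _).1)
      ((iqf.add ((i1.const_mul _).add (iqf.const_mul _))).add
        (iqg.add ((i2.const_mul _).add (iqg.const_mul _)))) (fun n => ?_) ?_
    · filter_upwards [hf.stable, hg.stable] with θ h1 h2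
      set ε : ℝ := 1 / ((n : ℝ) + 1) with hε
      have hεle : ε ≤ 1 := by
        rw [hε, div_le_one (by positivity)]
        linarith [Nat.cast_nonneg (α := ℝ) n]
      have hpow : ε ^ α ≤ 1 := Real.rpow_le_one (hε0 n).le hεle (by linarith)
      have hsc : ∀ M : Matrix (Fin T) (Fin T) ℂ, StableMatrix α M → ∀ c : ℂ, ‖c‖ = ε →
          nform α M (c • q θ) ≤ nform α M (q θ) := by
        intro M hM c hc
        rw [hM.nform_smul hα, hc]
        exact mul_le_of_le_one_left (hM.nform_nonneg hα _) hpow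
      have hn1 : nform α (f θ) ((A - h - (ε : ℂ) • q) θ) ≤
          (1 + 1) * nform α (f θ) ((A - h) θ) + K * nform α (f θ) (q θ) := by
        have e1 : (A - h - (ε : ℂ) • q) θ = (A - h) θ + (-(ε : ℂ)) • q θ := by
          simp [sub_eq_add_neg]
        rw [e1]
        refine (hKle _ h1 _ _).trans ?_
        have := hsc _ h1 (-(ε : ℂ)) (by
          rw [norm_neg, Complex.norm_real, Real.norm_of_nonneg (hε0 n).le])
        gcongr
      have hn2 : nform α (g θ) ((h + (ε : ℂ) • q) θ) ≤
          (1 + 1) * nform α (g θ) (h θ) + K * nform α (g θ) (q θ) := by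
        refine (hKle _ h2 _ _).trans ?_
        have := hsc _ h2 (ε : ℂ) (by rw [Complex.norm_real, Real.norm_of_nonneg (hε0 n).le])
        simp only [Pi.smul_apply]
        gcongr
      refine (norm_sub_le _ _).trans (add_le_add ?_ ?_)
      · exact (h1.norm_sform_le hα _ _).trans (by gcongr)
      · exact (h2.norm_sform_le hα _ _).trans (by gcongr)
    · refine ae_of_all _ fun θ => ?_
      have hcont : Continuous fun ε : ℝ => S ε θ := by
        refine ((continuous_sform hα (f θ)).comp (f := fun ε : ℝ => (q θ, (A - h - (ε : ℂ) • q) θ))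
          ?_).sub ((continuous_sform hα (g θ)).comp
            (f := fun ε : ℝ => (q θ, (h + (ε : ℂ) • q) θ)) ?_)
        · simp only [Pi.sub_apply, Pi.smul_apply]
          fun_prop
        · simp only [Pi.add_apply, Pi.smul_apply]
          fun_prop
      have := (hcont.tendsto 0).comp hεlim
      simpa [S, Function.comp_def] using this
  exact le_of_tendsto' ((Complex.continuous_re.tendsto _).comp hlim) fun n => hneg _ (hε0 n)

/-- The sum of the subgradient inequalities at `u` and at `v`. -/
lemma StableMatrix.monotone {M : Matrix (Fin T) (Fin T) ℂ} (hα : 1 < α) (h : StableMatrix α M)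
    (u v : Fin T → ℂ) : 0 ≤ (sform α M (u - v) u - sform α M (u - v) v).re := by
  have h1 := h.subgradient hα u v
  have h2 := h.subgradient hα v u
  rw [← neg_sub u v, sform_neg_left, Complex.neg_re] at h1
  rw [Complex.sub_re]
  by_contra hc
  push Not at hc
  have hα0 : 0 < α := by linarith
  nlinarith

/-- The equation and the system of the coefficients determine the spectral characteristic. -/
lemma spectralEquation_unique {N : ℕ} (hα : 1 < α) (hf : IsDensity α f) (hg : IsDensity α g)
    (hw : IsCoercive α (f + g) w) {a c c' : Fin (N + 1) → Fin T → ℂ} {h h' : ℝ → Fin T → ℂ}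
    (hh : MemLalpha α (f + g) h) (hh' : MemLalpha α (f + g) h')
    (he : SpectralEquation α a c f g h) (he' : SpectralEquation α a c' f g h')
    (hs : CoefficientSystem N h) (hs' : CoefficientSystem N h') :
    h' =ᵐ[lebPi] h ∧ c' = c := by
  have hF := hf.add hg
  have hi : ∀ k, Integrable (fun θ => h θ k) lebPi := fun k =>
    (hw.integrable_of_mem hα hF hh).eval k
  have hi' : ∀ k, Integrable (fun θ => h' θ k) lebPi := fun k =>
    (hw.integrable_of_mem hα hF hh').eval k
  have hterm : ∀ (j : Fin (N + 1)) (k : Fin T), Integrable (fun θ : ℝ =>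
      Complex.exp (-Complex.I * ((j : ℕ) : ℂ) * θ) * (h' θ k - h θ k)) lebPi := by
    intro j k
    simp_rw [cexp_neg_eq]
    exact integrable_cexp_mul _ ((hi' k).sub (hi k))
  have hexp : ∀ θ, (h' θ - h θ) ⬝ᵥ (polyC c θ - polyC c' θ) = ∑ k, ∑ j, (c j k - c' j k) *
      (Complex.exp (-Complex.I * ((j : ℕ) : ℂ) * θ) * (h' θ k - h θ k)) := by
    intro θ
    simp only [dotProduct, polyC, Pi.sub_apply, ← Finset.sum_sub_distrib, Finset.mul_sum]
    exact Finset.sum_congr rfl fun k _ => Finset.sum_congr rfl fun j _ => by ring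
  have hint : Integrable (fun θ => (h' θ - h θ) ⬝ᵥ (polyC c θ - polyC c' θ)) lebPi := by
    simp_rw [hexp]
    exact integrable_finsetSum _ fun k _ => integrable_finsetSum _ fun j _ =>
      (hterm j k).const_mul _
  -- The difference of the two polynomials contains only modes `e^{-ijθ}`, `0 ≤ j ≤ N`, against
  -- which both `h` and `h'` integrate to zero.
  have hzero : ∫ θ, (h' θ - h θ) ⬝ᵥ (polyC c θ - polyC c' θ) ∂lebPi = 0 := by
    simp_rw [hexp]
    rw [integral_finsetSum _ fun k _ => integrable_finsetSum _ fun j _ => (hterm j k).const_mul _]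
    refine Finset.sum_eq_zero fun k _ => ?_
    rw [integral_finsetSum _ fun j _ => (hterm j k).const_mul _]
    refine Finset.sum_eq_zero fun j _ => ?_
    rw [integral_const_mul]
    simp_rw [mul_sub]
    have e1 : Integrable (fun θ : ℝ => Complex.exp (-Complex.I * ((j : ℕ) : ℂ) * θ) * h' θ k) lebPi := by
      simp_rw [cexp_neg_eq]; exact integrable_cexp_mul _ (hi' k)
    have e2 : Integrable (fun θ : ℝ => Complex.exp (-Complex.I * ((j : ℕ) : ℂ) * θ) * h θ k) lebPi := by
      simp_rw [cexp_neg_eq]; exact integrable_cexp_mul _ (hi k)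
    rw [integral_sub e1 e2, hs' j k, hs j k, sub_zero, mul_zero]
  -- Subtracting the equations leaves a monotone difference for `f` and one for `g`, both in the
  -- direction `h' - h = (A - h) - (A - h')`.
  have hpt : ∀ᵐ θ ∂lebPi, (h' θ - h θ) ⬝ᵥ (polyC c θ - polyC c' θ) =
      (sform α (f θ) ((polyA a θ - h θ) - (polyA a θ - h' θ)) (polyA a θ - h θ) -
        sform α (f θ) ((polyA a θ - h θ) - (polyA a θ - h' θ)) (polyA a θ - h' θ)) +
      (sform α (g θ) (h' θ - h θ) (h' θ) - sform α (g θ) (h' θ - h θ) (h θ)) := by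
    filter_upwards [he, he'] with θ h1 h2
    rw [← h1, ← h2, sub_sub_sub_cancel_left]
    simp only [sform, dotProduct_sub]
    ring
  have hnn : ∀ᵐ θ ∂lebPi, 0 ≤ ((h' θ - h θ) ⬝ᵥ (polyC c θ - polyC c' θ)).re := by
    filter_upwards [hpt, hf.stable, hg.stable] with θ h1 h2 h3
    rw [h1, Complex.add_re]
    exact add_nonneg (h2.monotone hα _ _) (h3.monotone hα _ _)
  have hre : ∫ θ, ((h' θ - h θ) ⬝ᵥ (polyC c θ - polyC c' θ)).re ∂lebPi = 0 := by
    have h5 : (∫ θ, (h' θ - h θ) ⬝ᵥ (polyC c θ - polyC c' θ) ∂lebPi).re =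
      ∫ θ, ((h' θ - h θ) ⬝ᵥ (polyC c θ - polyC c' θ)).re ∂lebPi := (integral_re hint).symm
    rw [← h5, hzero, Complex.zero_re]
  rw [integral_eq_zero_iff_of_nonneg_ae hnn hint.re] at hre
  have hlp : lpow α (f + g) (h' - h) = 0 := by
    rw [lpow_eq, lintegral_eq_zero_iff'
      (aemeasurable_nform hF.integrable (hh'.1.sub hh.1)).ennreal_ofReal]
    filter_upwards [hre, hpt, hf.stable, hg.stable] with θ h0 h1 h2 h3
    have m1 := h2.monotone hα (polyA a θ - h θ) (polyA a θ - h' θ)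
    have m2 := h3.monotone hα (h' θ) (h θ)
    rw [h1, Complex.add_re] at h0
    simp only [Pi.zero_apply] at h0
    have z1 := h2.nform_sub_eq_zero hα (u := polyA a θ - h θ) (v := polyA a θ - h' θ) (by linarith)
    have z2 := h3.nform_sub_eq_zero hα (u := h' θ) (v := h θ) (by linarith)
    rw [sub_sub_sub_cancel_left] at z1
    rw [Pi.add_apply, nform_add_mat, Pi.sub_apply, z1, z2]
    simp
  have hae := hw.ae_eq_of_lpow_eq_zero hα hF hh'.1 hh.1 hlp
  refine ⟨hae, polyC_injective ?_⟩
  filter_upwards [he, he', hae] with θ h1 h2 h3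
  rw [← h1, ← h2, h3]

end Stationarity

/-! ### Trigonometric polynomials and linear combinations with the same coefficients. -/

section Trig

variable {Ω : Type*} {T : ℕ} {ξ η : ℤ → Fin T → Ω → ℂ} {Y : Ω → ℂ} {h : ℝ → Fin T → ℂ}

/-- The trigonometric polynomial with coefficients `c`. -/
def trig : (ℤ × Fin T →₀ ℂ) →ₗ[ℂ] (ℝ → Fin T → ℂ) :=
  Finsupp.linearCombination ℂ fun p => expo p.1 p.2

/-- The linear combination of the variables of a sequence with coefficients `c`. -/
def lin (ξ : ℤ → Fin T → Ω → ℂ) : (ℤ × Fin T →₀ ℂ) →ₗ[ℂ] (Ω → ℂ) :=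
  Finsupp.linearCombination ℂ fun p => ξ p.1 p.2

lemma continuous_expo (j : ℤ) (k : Fin T) : Continuous (expo j k) :=
  (continuous_single k).comp (continuous_cexp_int j)

lemma continuous_trig (c : ℤ × Fin T →₀ ℂ) : Continuous (trig c) := by
  induction c using Finsupp.induction_linear with
  | zero => rw [map_zero]; exact continuous_const
  | add c d hc hd => rw [map_add]; exact hc.add hd
  | single p b =>
    rw [trig, Finsupp.linearCombination_single]
    exact (continuous_expo p.1 p.2).const_smul b

lemma lin_add_apply (ξ η : ℤ → Fin T → Ω → ℂ) (c : ℤ × Fin T →₀ ℂ) :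
    lin (ξ + η) c = lin ξ c + lin η c := by
  simp only [lin, Finsupp.linearCombination_apply, Pi.add_apply, smul_add, Finsupp.sum_add]

lemma observations_eq (N : ℕ) (ξ η : ℤ → Fin T → Ω → ℂ) : observations N ξ η =
    (fun p : ℤ × Fin T => (ξ + η) p.1 p.2) '' {p | p.1 ∉ Icc (0 : ℤ) N} := by
  ext Y
  simp [observations, eq_comm]

lemma mem_span_observations {N : ℕ} :
    Y ∈ Submodule.span ℂ (observations N ξ η) ↔
      ∃ c ∈ Finsupp.supported ℂ ℂ {p : ℤ × Fin T | p.1 ∉ Icc (0 : ℤ) N}, lin (ξ + η) c = Y := by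
  rw [observations_eq]
  exact Finsupp.mem_span_image_iff_linearCombination ℂ

lemma mem_span_expo {N : ℕ} :
    h ∈ Submodule.span ℂ {q | ∃ (j : ℤ) (k : Fin T), j ∉ Icc (0 : ℤ) N ∧ q = expo j k} ↔
      ∃ c ∈ Finsupp.supported ℂ ℂ {p : ℤ × Fin T | p.1 ∉ Icc (0 : ℤ) N}, trig c = h := by
  have he : {q | ∃ (j : ℤ) (k : Fin T), j ∉ Icc (0 : ℤ) N ∧ q = expo j k} =
      (fun p : ℤ × Fin T => expo p.1 p.2) '' {p | p.1 ∉ Icc (0 : ℤ) N} := by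
    ext q
    simp [eq_comm]
  rw [he]
  exact Finsupp.mem_span_image_iff_linearCombination ℂ

end Trig

/-! ### Correspondence between the observed span and `L_N^α(f+g)`. -/

section Model

variable {Ω : Type*} [MeasurableSpace Ω] {P : Measure Ω} {T N : ℕ} {α : ℝ}
  {ξ η : ℤ → Fin T → Ω → ℂ} {Z Zξ Zη : ℝ → Fin T → Ω → ℂ} {f g : ℝ → Matrix (Fin T) (Fin T) ℂ}
  {h h' A : ℝ → Fin T → ℂ} {Y Y' : Ω → ℂ} {S : Set (ℤ × Fin T)} {w : ℝ → ℝ}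

lemma memLalpha_of_continuous (hα : 1 < α) (hf : IsDensity α f) {u : ℝ → Fin T → ℂ}
    (hu : Continuous u) : MemLalpha α f u := by
  obtain ⟨C, hC⟩ := (isCompact_Icc (a := -Real.pi) (b := Real.pi)).exists_bound_of_continuousOn
    hu.continuousOn
  refine memLalpha_of_bound hα hf hu.aestronglyMeasurable (C := C) ?_
  rw [lebPi, ae_restrict_iff' measurableSet_Ioc]
  exact ae_of_all _ fun θ hθ => hC θ (Ioc_subset_Icc_self hθ)

lemma IsHarmonizable.isDensity [IsProbabilityMeasure P] (hα₁ : 1 < α) (hα₂ : α ≤ 2)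
    (hξ : IsHarmonizable α P ξ Z f) : IsDensity α f :=
  hξ.density.isDensity hα₁ hα₂ hξ.process

lemma IsHarmonizable.isStochIntegral_lin [IsProbabilityMeasure P] (hα₁ : 1 < α) (hα₂ : α ≤ 2)
    (hξ : IsHarmonizable α P ξ Z f) (c : ℤ × Fin T →₀ ℂ) :
    IsStochIntegral α P Z f (trig c) (lin ξ c) := by
  have hf := hξ.isDensity hα₁ hα₂
  induction c using Finsupp.induction_linear with
  | zero => rw [map_zero, map_zero]; exact isStochIntegral_zero hα₁ hf
  | add c d hc hd => rw [map_add, map_add]; exact hc.add hα₁ hf hd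
  | single p b =>
    rw [trig, lin, Finsupp.linearCombination_single, Finsupp.linearCombination_single]
    exact (hξ.repr p.1 p.2).smul hα₁ hf b

/-- Independent harmonizable sequences: a signal `ξ` observed with a noise `η`. -/
structure SignalNoise (α : ℝ) (P : Measure Ω) (ξ η : ℤ → Fin T → Ω → ℂ)
    (Zξ Zη : ℝ → Fin T → Ω → ℂ) (f g : ℝ → Matrix (Fin T) (Fin T) ℂ) : Prop where
  one_lt : 1 < α
  le_two : α ≤ 2
  signal : IsHarmonizable α P ξ Zξ f
  noise : IsHarmonizable α P η Zη g
  indep : IndepFun (fun ω n k => ξ n k ω) (fun ω n k => η n k ω) P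

lemma SignalNoise.indepFun_lin (M : SignalNoise α P ξ η Zξ Zη f g) (c d : ℤ × Fin T →₀ ℂ) :
    IndepFun (lin ξ c) (lin η d) P := by
  have hm : ∀ c : ℤ × Fin T →₀ ℂ, Measurable fun x : ℤ → Fin T → ℂ =>
      ∑ p ∈ c.support, c p * x p.1 p.2 := fun c =>
    Finset.measurable_fun_sum _ fun p _ =>
      Measurable.const_mul (f := fun x : ℤ → Fin T → ℂ => x p.1 p.2) (by fun_prop) _
  have he : ∀ (ζ : ℤ → Fin T → Ω → ℂ) (c : ℤ × Fin T →₀ ℂ), lin ζ c =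
      (fun x : ℤ → Fin T → ℂ => ∑ p ∈ c.support, c p * x p.1 p.2) ∘ fun ω n k => ζ n k ω := by
    intro ζ c
    funext ω
    simp [lin, Finsupp.linearCombination_apply, Finsupp.sum]
  rw [he, he]
  exact M.indep.comp (hm c) (hm d)

/-- `Y` is the element of the closed linear span of the variables `ξ + η` with indices in `S` that
corresponds to the element `h` of the closed span of the exponentials with indices in `S`. -/
structure Corresponds (α : ℝ) (P : Measure Ω) (ξ η : ℤ → Fin T → Ω → ℂ)
    (f g : ℝ → Matrix (Fin T) (Fin T) ℂ) (S : Set (ℤ × Fin T)) (h : ℝ → Fin T → ℂ)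
    (Y : Ω → ℂ) (c : ℕ → ℤ × Fin T →₀ ℂ) : Prop where
  mem : MemLalpha α (f + g) h
  supp : ∀ n, c n ∈ Finsupp.supported ℂ ℂ S
  tendsto_lpow : Tendsto (fun n => lpow α (f + g) (h - trig (c n))) atTop (𝓝 0)
  tendsto_lin : TendstoInMeasure P (fun n => lin (ξ + η) (c n)) atTop Y

variable {c c' : ℕ → ℤ × Fin T →₀ ℂ}

lemma Corresponds.memLalphaN
    (hc : Corresponds α P ξ η f g {p : ℤ × Fin T | p.1 ∉ Icc (0 : ℤ) N} h Y c) :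
    MemLalphaN α (f + g) N h :=
  ⟨hc.mem, fun n => trig (c n), fun n => mem_span_expo.2 ⟨c n, hc.supp n, rfl⟩, hc.tendsto_lpow⟩

lemma tendsto_lpow_cauchy {F : ℝ → Matrix (Fin T) (Fin T) ℂ} (hα : 1 < α) (hF : IsDensity α F)
    {p q : ℕ → ℝ → Fin T → ℂ} (hh : AEStronglyMeasurable h lebPi)
    (hq : ∀ n, AEStronglyMeasurable (q n) lebPi)
    (h1 : Tendsto (fun n => lpow α F (h - p n)) atTop (𝓝 0))
    (h2 : Tendsto (fun n => lpow α F (h - q n)) atTop (𝓝 0)) :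
    Tendsto (fun n : ℕ × ℕ => lpow α F (p n.1 - q n.2)) atTop (𝓝 0) := by
  rw [← prod_atTop_atTop_eq]
  have h1' : Tendsto (fun n => lpow α F (p n - h)) atTop (𝓝 0) :=
    h1.congr fun n => lpow_sub_comm _ _
  have := tendsto_lpow_add hα hF (u := fun n : ℕ × ℕ => h - q n.2)
    (v := fun n : ℕ × ℕ => p n.1 - h) (fun n => hh.sub (hq n.2))
    (h2.comp tendsto_snd) (h1'.comp tendsto_fst)
  refine this.congr fun n => ?_
  congr 1
  abel

variable [IsProbabilityMeasure P]

/-- Independence of signal and noise enters here: the powers of the two norms add. -/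
lemma SignalNoise.isSaS_lin_add (M : SignalNoise α P ξ η Zξ Zη f g) (c d : ℤ × Fin T →₀ ℂ) :
    IsSaS α P (lin ξ c + lin η d) ((lpow α f (trig c)).toReal + (lpow α g (trig d)).toReal) := by
  have hα := M.one_lt
  refine IsSaS.add (by linarith) (M.indepFun_lin c d) ?_ ?_
  · exact (M.signal.isStochIntegral_lin hα M.le_two c).isSaS hα M.le_two M.signal.process
      M.signal.density
  · exact (M.noise.isStochIntegral_lin hα M.le_two d).isSaS hα M.le_two M.noise.process
      M.noise.density

lemma SignalNoise.isSaS_lin (M : SignalNoise α P ξ η Zξ Zη f g) (c : ℤ × Fin T →₀ ℂ) :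
    IsSaS α P (lin (ξ + η) c) (lpow α (f + g) (trig c)).toReal := by
  have hf := M.signal.isDensity M.one_lt M.le_two
  have hg := M.noise.isDensity M.one_lt M.le_two
  rw [lin_add_apply, lpow_add_density M.one_lt hf hg (continuous_trig c).aestronglyMeasurable,
    ENNReal.toReal_add (memLalpha_of_continuous M.one_lt hf (continuous_trig c)).2.ne
      (memLalpha_of_continuous M.one_lt hg (continuous_trig c)).2.ne]
  exact M.isSaS_lin_add c c

/-- The error is the signal part with coefficients `b - c` plus the noise part with coefficients
`-c`. -/
lemma SignalNoise.isSaS_error (M : SignalNoise α P ξ η Zξ Zη f g) (b c : ℤ × Fin T →₀ ℂ) :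
    IsSaS α P (lin ξ b - lin (ξ + η) c) (errorPow α f g (trig b) (trig c)).toReal := by
  have hf := M.signal.isDensity M.one_lt M.le_two
  have hg := M.noise.isDensity M.one_lt M.le_two
  have h1 := M.isSaS_lin_add (b - c) (-c)
  rw [map_neg, map_neg, map_sub, map_sub, lpow_neg, ← ENNReal.toReal_add
      (memLalpha_of_continuous M.one_lt hf ((continuous_trig b).sub (continuous_trig c))).2.ne
      (memLalpha_of_continuous M.one_lt hg (continuous_trig c)).2.ne] at h1
  rw [lin_add_apply, ← sub_sub, sub_eq_add_neg (lin ξ b - lin ξ c)]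
  exact h1

lemma Corresponds.aemeasurable (M : SignalNoise α P ξ η Zξ Zη f g)
    (hc : Corresponds α P ξ η f g S h Y c) : AEMeasurable Y P :=
  hc.tendsto_lin.aemeasurable fun n => (M.isSaS_lin (c n)).aemeasurable

lemma Corresponds.isSaS_error (M : SignalNoise α P ξ η Zξ Zη f g)
    (hc : Corresponds α P ξ η f g S h Y c) (b : ℤ × Fin T →₀ ℂ) :
    IsSaS α P (lin ξ b - Y) (errorPow α f g (trig b) h).toReal := by
  have hα := M.one_lt
  have hf := M.signal.isDensity M.one_lt M.le_two
  have hg := M.noise.isDensity M.one_lt M.le_two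
  have hA := memLalpha_of_continuous hα (hf.add hg) (continuous_trig b)
  have hξb := (M.signal.isStochIntegral_lin hα M.le_two b).isSaS hα M.le_two M.signal.process
      M.signal.density
  refine IsSaS.of_tendstoInMeasure (by linarith) (fun n => M.isSaS_error b (c n))
    (hξb.aemeasurable.sub (hc.aemeasurable M))
    (tendstoInMeasure_sub (tendstoInMeasure_const _) hc.tendsto_lin) ?_
  exact (ENNReal.tendsto_toReal (errorPow_lt_top hα hf hg hA hc.mem).ne).comp
    (tendsto_errorPow hα hf hg hA hc.mem (fun n => (continuous_trig _).aestronglyMeasurable)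
      hc.tendsto_lpow)

lemma Corresponds.isSaS_sub (M : SignalNoise α P ξ η Zξ Zη f g)
    (hc : Corresponds α P ξ η f g S h Y c) (d : ℤ × Fin T →₀ ℂ) :
    IsSaS α P (Y - lin (ξ + η) d) (lpow α (f + g) (h - trig d)).toReal := by
  have hα := M.one_lt
  have hF := (M.signal.isDensity M.one_lt M.le_two).add (M.noise.isDensity M.one_lt M.le_two)
  have hd := memLalpha_of_continuous hα hF (continuous_trig d)
  refine IsSaS.of_tendstoInMeasure (by linarith) (fun n => M.isSaS_lin (c n - d))
    ((hc.aemeasurable M).sub (M.isSaS_lin d).aemeasurable) (l := atTop) ?_ ?_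
  · simp_rw [map_sub]
    exact tendstoInMeasure_sub hc.tendsto_lin (tendstoInMeasure_const _)
  · refine (ENNReal.tendsto_toReal (hc.mem.sub hα hF hd).2.ne).comp
      (tendsto_lpow_of_sub hα hF (hc.mem.1.sub hd.1)
        (fun n => (continuous_trig _).aestronglyMeasurable) (hc.mem.sub hα hF hd).2 ?_)
    refine hc.tendsto_lpow.congr fun n => ?_
    rw [map_sub]
    congr 1
    abel

lemma tendstoInMeasure_of_isSaS_sub {ι : Type*} {l : Filter ι} (hα : 0 < α) {X : ι → Ω → ℂ}
    {r : ι → ℝ} (h : ∀ i, IsSaS α P (Y - X i) (r i)) (hr : Tendsto r l (𝓝 0)) :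
    TendstoInMeasure P X l Y := by
  have h1 : TendstoInMeasure P (fun i => Y - X i) l 0 :=
    tendstoInMeasure_of_isSaS hα (fun i => by rw [sub_zero]; exact h i) hr
  simpa using tendstoInMeasure_sub (tendstoInMeasure_const Y) h1

lemma Corresponds.ae_eq (M : SignalNoise α P ξ η Zξ Zη f g)
    (hc : Corresponds α P ξ η f g S h Y c) (hc' : Corresponds α P ξ η f g S h' Y' c')
    (heq : h' =ᵐ[lebPi] h) : Y' =ᵐ[P] Y := by
  have h1 : TendstoInMeasure P (fun n => lin (ξ + η) (c n)) atTop Y' := by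
    refine tendstoInMeasure_of_isSaS_sub (by linarith [M.one_lt])
      (fun n => hc'.isSaS_sub M (c n)) ?_
    refine (ENNReal.tendsto_toReal ENNReal.zero_ne_top).comp (hc.tendsto_lpow.congr fun n => ?_)
    exact lpow_congr (heq.symm.sub EventuallyEq.rfl)
  exact tendstoInMeasure_ae_unique h1 hc.tendsto_lin

/-- Every element of the closed span of the exponentials corresponds to a random variable. -/
lemma SignalNoise.exists_corresponds (M : SignalNoise α P ξ η Zξ Zη f g)
    (hh : MemLalpha α (f + g) h) (hS : ∀ n, c n ∈ Finsupp.supported ℂ ℂ S)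
    (hlim : Tendsto (fun n => lpow α (f + g) (h - trig (c n))) atTop (𝓝 0)) :
    ∃ (Y : Ω → ℂ) (c' : ℕ → ℤ × Fin T →₀ ℂ), Corresponds α P ξ η f g S h Y c' := by
  have hα := M.one_lt
  have hF := (M.signal.isDensity M.one_lt M.le_two).add (M.noise.isDensity M.one_lt M.le_two)
  -- By the isometry and the tail bound, a Cauchy sequence in `L^α(f+g)` gives a Cauchy sequence in
  -- probability; a fast subsequence then converges almost surely.
  have hcau : TendstoInMeasure P (fun n : ℕ × ℕ => lin (ξ + η) (c n.1 - c n.2)) atTop 0 := by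
    refine tendstoInMeasure_of_isSaS (α := α) (by linarith)
      (r := fun n => (lpow α (f + g) (trig (c n.1 - c n.2))).toReal) (fun n => ?_) ?_
    · rw [sub_zero]; exact M.isSaS_lin _
    · have h1 := tendsto_lpow_cauchy hα hF hh.1
        (fun n => (continuous_trig (c n)).aestronglyMeasurable) hlim hlim
      have h2 := (ENNReal.tendsto_toReal ENNReal.zero_ne_top).comp h1
      simpa only [map_sub, Function.comp_def, ENNReal.toReal_zero] using h2
  rw [tendstoInMeasure_iff_norm] at hcau
  have hev : ∀ n : ℕ, ∀ᶠ k : ℕ in atTop, ∀ i ≥ k, ∀ j ≥ k,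
      P {ω | (1 / 2 : ℝ) ^ n ≤ ‖lin (ξ + η) (c i - c j) ω‖} ≤ (1 / 2 : ℝ≥0∞) ^ n := by
    intro n
    have h1 := (hcau ((1 / 2) ^ n) (by positivity)).eventually_le_const
      (u := (1 / 2 : ℝ≥0∞) ^ n) (ENNReal.pow_pos (by simp) n)
    rw [eventually_atTop] at h1
    obtain ⟨m, hm⟩ := h1
    filter_upwards [eventually_ge_atTop (max m.1 m.2)] with k hk i hi j hj
    have := hm (i, j) ⟨(le_max_left _ _).trans (hk.trans hi), (le_max_right _ _).trans (hk.trans hj)⟩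
    simpa using this
  obtain ⟨φ, hφ, hφP⟩ := extraction_forall_of_eventually hev
  have hae := exists_tendsto_ae_of_fast (P := P) (Y := fun n => lin (ξ + η) (c (φ n))) fun n => by
    have := hφP n (φ (n + 1)) (hφ.monotone n.le_succ) (φ n) le_rfl
    simpa [map_sub] using this
  classical
  let Y : Ω → ℂ := fun ω => if hω : ∃ y, Tendsto (fun n => lin (ξ + η) (c (φ n)) ω) atTop (𝓝 y)
    then hω.choose else 0
  refine ⟨Y, fun n => c (φ n), hh, fun n => hS _, hlim.comp hφ.tendsto_atTop, ?_⟩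
  refine tendstoInMeasure_of_tendsto_ae
    (fun n => (M.isSaS_lin _).aemeasurable.aestronglyMeasurable) ?_
  filter_upwards [hae] with ω hω
  simp only [Y, dif_pos hω]
  exact hω.choose_spec

/-- A limit in measure of linear combinations of the observations corresponds to an element of the
closed span of the exponentials. -/
lemma SignalNoise.exists_corresponds_of_tendsto (M : SignalNoise α P ξ η Zξ Zη f g)
    (hw : IsCoercive α (f + g) w) (hS : ∀ n, c n ∈ Finsupp.supported ℂ ℂ S)
    (hlim : TendstoInMeasure P (fun n => lin (ξ + η) (c n)) atTop Y) :
    ∃ h, Corresponds α P ξ η f g S h Y c := by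
  have hα := M.one_lt
  have hF := (M.signal.isDensity M.one_lt M.le_two).add (M.noise.isDensity M.one_lt M.le_two)
  have hp := fun n => memLalpha_of_continuous hα hF (continuous_trig (c n))
  have h1 : TendstoInMeasure P (fun n : ℕ × ℕ => lin (ξ + η) (c n.1 - c n.2)) atTop 0 := by
    rw [← prod_atTop_atTop_eq]
    have h2 := tendstoInMeasure_sub (P := P) (l := atTop ×ˢ atTop)
      (X := fun n : ℕ × ℕ => lin (ξ + η) (c n.1)) (Y := fun n : ℕ × ℕ => lin (ξ + η) (c n.2))
      (X' := Y) (Y' := Y) (fun ε hε => (hlim ε hε).comp tendsto_fst)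
      (fun ε hε => (hlim ε hε).comp tendsto_snd)
    rw [sub_self] at h2
    simpa only [map_sub] using h2
  -- For stable variables convergence to zero in probability forces the norms to zero, so the
  -- polynomials are Cauchy in `L^α(f+g)` and completeness applies.
  have h2 := tendsto_of_tendstoInMeasure_zero (by linarith)
    (fun n : ℕ × ℕ => M.isSaS_lin (c n.1 - c n.2)) h1
  obtain ⟨h, hh, hhp⟩ := hw.exists_limit hα hF hp (by
    refine (ENNReal.tendsto_toReal_iff (fun n => ?_) ENNReal.zero_ne_top).1 ?_
    · exact ((hp n.1).sub hα hF (hp n.2)).2.ne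
    · simpa only [map_sub, ENNReal.toReal_zero] using h2)
  exact ⟨h, hh, hS, hhp, hlim⟩

/-- The corresponding random variable is the stochastic integral. -/
lemma Corresponds.isStochIntegral (M : SignalNoise α P ξ η Zξ Zη f g)
    (hc : Corresponds α P ξ η f g S h Y c) : IsStochIntegral α P (Zξ + Zη) (f + g) h Y := by
  have hα := M.one_lt
  have hf := M.signal.isDensity M.one_lt M.le_two
  have hg := M.noise.isDensity M.one_lt M.le_two
  have hF := hf.add hg
  choose φ hφ using fun n : ℕ => exists_steps_of_continuous hα hF (continuous_trig (c n))
    (ε := ((n : ℝ≥0∞) + 1)⁻¹) (ENNReal.inv_pos.2 (by simp))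
  have hφ0 : Tendsto (fun n => lpow α (f + g) (trig (c n) - (φ n).toFun)) atTop (𝓝 0) := by
    refine tendsto_of_tendsto_of_tendsto_of_le_of_le tendsto_const_nhds
      (ENNReal.tendsto_inv_nat_nhds_zero) (fun _ => zero_le) fun n => (hφ n).le.trans ?_
    exact ENNReal.inv_le_inv.2 le_self_add
  have hm := fun n => (continuous_trig (c n)).aestronglyMeasurable.sub (φ n).aestronglyMeasurable
    (μ := lebPi)
  refine ⟨hc.mem, φ, ?_, ?_⟩
  · have := tendsto_lpow_add hα hF (u := fun n => h - trig (c n))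
      (fun n => hc.mem.1.sub (continuous_trig (c n)).aestronglyMeasurable) hc.tendsto_lpow hφ0
    refine this.congr fun n => ?_
    congr 1
    abel
  -- The isometry is applied to `Zξ` and `Zη` separately, with densities below `f + g`. The sum
  -- process itself need not be known to have independent increments.
  · have hξ : TendstoInMeasure P (fun n => lin ξ (c n) - (φ n).integral Zξ) atTop 0 := by
      refine tendstoInMeasure_of_isSaS (α := α) (by linarith)
        (r := fun n => (lpow α f (trig (c n) - (φ n).toFun)).toReal) (fun n => ?_) ?_
      · rw [sub_zero]
        exact ((M.signal.isStochIntegral_lin hα M.le_two (c n)).sub hα hf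
          ((φ n).isStochIntegral hα hf)).isSaS hα M.le_two M.signal.process M.signal.density
      · exact (ENNReal.tendsto_toReal ENNReal.zero_ne_top).comp
          (tendsto_of_tendsto_of_tendsto_of_le_of_le tendsto_const_nhds hφ0 (fun _ => zero_le)
            fun n => lpow_le_add_left hα hf hg (hm n))
    have hη : TendstoInMeasure P (fun n => lin η (c n) - (φ n).integral Zη) atTop 0 := by
      refine tendstoInMeasure_of_isSaS (α := α) (by linarith)
        (r := fun n => (lpow α g (trig (c n) - (φ n).toFun)).toReal) (fun n => ?_) ?_
      · rw [sub_zero]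
        exact ((M.noise.isStochIntegral_lin hα M.le_two (c n)).sub hα hg
          ((φ n).isStochIntegral hα hg)).isSaS hα M.le_two M.noise.process M.noise.density
      · exact (ENNReal.tendsto_toReal ENNReal.zero_ne_top).comp
          (tendsto_of_tendsto_of_tendsto_of_le_of_le tendsto_const_nhds hφ0 (fun _ => zero_le)
            fun n => lpow_le_add_right hα hf hg (hm n))
    have h3 := tendstoInMeasure_sub hc.tendsto_lin (tendstoInMeasure_add hξ hη)
    rw [add_zero, sub_zero] at h3
    refine h3.congr_left fun n => ae_of_all _ fun ω => ?_
    simp only [StepFun.integral_add_process, lin_add_apply, Pi.add_apply, Pi.sub_apply]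
    ring

lemma Corresponds.memClosedSpan (M : SignalNoise α P ξ η Zξ Zη f g)
    (hc : Corresponds α P ξ η f g {p : ℤ × Fin T | p.1 ∉ Icc (0 : ℤ) N} h Y c) :
    MemClosedSpan α P (observations N ξ η) Y := by
  have hα0 : 0 < α := by linarith [M.one_lt]
  refine ⟨fun n => lin (ξ + η) (c n), fun n => mem_span_observations.2 ⟨c n, hc.supp n, rfl⟩,
    fun n => (hc.isSaS_sub M (c n)).jointlySaS hα0, ?_⟩
  have h1 : Tendsto (fun n => (lpow α (f + g) (h - trig (c n))).toReal ^ (1 / α)) atTop (𝓝 0) := by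
    have h2 := ((ENNReal.tendsto_toReal ENNReal.zero_ne_top).comp hc.tendsto_lpow).rpow_const
      (p := 1 / α) (Or.inr (by positivity))
    rwa [ENNReal.toReal_zero, Real.zero_rpow (by positivity)] at h2
  exact h1.congr fun n => ((hc.isSaS_sub M (c n)).alphaNorm_eq hα0).symm

/-- Norm convergence implies convergence in probability by the tail bound, and the limit in
probability determines the element of `L^α(f+g)`. -/
lemma SignalNoise.exists_corresponds_of_memClosedSpan (M : SignalNoise α P ξ η Zξ Zη f g)
    (hw : IsCoercive α (f + g) w) (hY : MemClosedSpan α P (observations N ξ η) Y) :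
    ∃ h c, Corresponds α P ξ η f g {p : ℤ × Fin T | p.1 ∉ Icc (0 : ℤ) N} h Y c := by
  have hα0 : 0 < α := by linarith [M.one_lt]
  obtain ⟨y, hy, hst, hlim⟩ := hY
  choose c hcS hcy using fun n => mem_span_observations.1 (hy n)
  choose r hr using fun n => (jointlySaS_single_iff hα0).1 (hst n)
  have hr0 : Tendsto r atTop (𝓝 0) := by
    have h2 := hlim.rpow_const (p := α) (Or.inr hα0.le)
    rw [Real.zero_rpow hα0.ne'] at h2
    exact h2.congr fun n => (hr n).alphaNorm_rpow hα0
  obtain rfl : (fun n => lin (ξ + η) (c n)) = y := funext hcy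
  have h1 := tendstoInMeasure_of_isSaS_sub hα0 hr hr0
  obtain ⟨h, hh⟩ := M.exists_corresponds_of_tendsto hw hcS h1
  exact ⟨h, c, hh⟩

end Model

/-! ### The spectral characteristic: equation and coefficient system. -/

section Characteristic

variable {T N : ℕ} {α : ℝ} {f g F : ℝ → Matrix (Fin T) (Fin T) ℂ} {h h' A : ℝ → Fin T → ℂ}
  {w : ℝ → ℝ}

lemma MemLalphaN.add (hα : 1 < α) (hF : IsDensity α F) (hh : MemLalphaN α F N h)
    (hh' : MemLalphaN α F N h') : MemLalphaN α F N (h + h') := by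
  obtain ⟨hm, p, hp, hlim⟩ := hh
  obtain ⟨hm', p', hp', hlim'⟩ := hh'
  have hpm : ∀ n, AEStronglyMeasurable (p n) lebPi := by
    intro n
    obtain ⟨c, -, hc⟩ := mem_span_expo.1 (hp n)
    rw [← hc]
    exact (continuous_trig c).aestronglyMeasurable
  refine ⟨hm.add hα hF hm', fun n => p n + p' n, fun n => add_mem (hp n) (hp' n), ?_⟩
  refine (tendsto_lpow_add hα hF (fun n => hm.1.sub (hpm n)) hlim hlim').congr fun n => ?_
  simp only [add_sub_add_comm]

lemma MemLalphaN.smul (hα : 1 < α) (hF : IsDensity α F) (z : ℂ) (hh : MemLalphaN α F N h) :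
    MemLalphaN α F N (z • h) := by
  obtain ⟨hm, p, hp, hlim⟩ := hh
  refine ⟨hm.smul hα hF z, fun n => z • p n, fun n => Submodule.smul_mem _ z (hp n), ?_⟩
  have h1 := ENNReal.Tendsto.const_mul (a := ENNReal.ofReal (‖z‖ ^ α)) hlim
    (Or.inr ENNReal.ofReal_ne_top)
  rw [mul_zero] at h1
  exact h1.congr fun n => by rw [← smul_sub, lpow_smul hα hF]

lemma memLalphaN_expo (hα : 1 < α) (hF : IsDensity α F) {j : ℤ} (hj : j ∉ Icc (0 : ℤ) N)
    (k : Fin T) : MemLalphaN α F N (expo j k) :=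
  ⟨memLalpha_of_continuous hα hF (continuous_expo j k), fun _ => expo j k,
    fun _ => Submodule.subset_span ⟨j, k, hj, rfl⟩, by simp [lpow_zero]⟩

/-- A lower bound on trigonometric polynomials passes to their closure by continuity of the error.
-/
lemma MemLalphaN.le_errorPow (hα : 1 < α) (hf : IsDensity α f) (hg : IsDensity α g)
    (hA : MemLalpha α (f + g) A) {d : ℝ≥0∞}
    (hd : ∀ c ∈ Finsupp.supported ℂ ℂ {p : ℤ × Fin T | p.1 ∉ Icc (0 : ℤ) N},
      d ≤ errorPow α f g A (trig c))
    (hh : MemLalphaN α (f + g) N h) : d ≤ errorPow α f g A h := by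
  obtain ⟨hm, p, hp, hlim⟩ := hh
  choose c hc hcp using fun n => mem_span_expo.1 (hp n)
  obtain rfl : (fun n => trig (c n)) = p := funext hcp
  exact ge_of_tendsto' (tendsto_errorPow hα hf hg hA hm
    (fun n => (continuous_trig (c n)).aestronglyMeasurable) hlim) fun n => hd _ (hc n)

lemma expo_dotProduct (j : ℤ) (k : Fin T) (θ : ℝ) (G : Fin T → ℂ) :
    expo j k θ ⬝ᵥ G = Complex.exp (Complex.I * j * θ) * G k := by
  rw [expo, single_dotProduct]

/-- The equation of the spectral characteristic, from its minimality. -/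
lemma exists_spectralEquation (hα : 1 < α) (hf : IsDensity α f) (hg : IsDensity α g)
    (a : Fin (N + 1) → Fin T → ℂ) (hh : MemLalphaN α (f + g) N h)
    (hmin : ∀ h', MemLalphaN α (f + g) N h' →
      errorPow α f g (polyA a) h ≤ errorPow α f g (polyA a) h') :
    ∃ c, SpectralEquation α a c f g h := by
  have hF := hf.add hg
  have hA := memLalpha_of_continuous hα hF (continuous_polyA a)
  let G : ℝ → Fin T → ℂ := fun θ =>
    f θ *ᵥ vspow (α - 1) (polyA a θ - h θ) - g θ *ᵥ vspow (α - 1) (h θ)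
  have hG : ∀ (q : ℝ → Fin T → ℂ) θ,
      sform α (f θ) (q θ) (polyA a θ - h θ) - sform α (g θ) (q θ) (h θ) = q θ ⬝ᵥ G θ := by
    intro q θ
    simp only [G, sform, dotProduct_sub]
  have hGint : ∀ k, Integrable (fun θ => G θ k) lebPi := by
    intro k
    have he := memLalpha_of_continuous hα hF (continuous_expo 0 k)
    have h1 := (integrable_sform hα hf (he.left hα hf hg)
      ((hA.sub hα hF hh.1).left hα hf hg)).sub
      (integrable_sform hα hg (he.right hα hf hg) (hh.1.right hα hf hg))
    refine h1.congr (ae_of_all _ fun θ => ?_)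
    have := hG (expo 0 k) θ
    rw [expo_dotProduct] at this
    simpa using this
  obtain ⟨c, hc⟩ := exists_polyC (N := N) hGint (by
    intro j k hj
    set I := ∫ θ, Complex.exp (Complex.I * j * θ) * G θ k ∂lebPi with hI
    -- The factor `conj I` turns the one-sided real condition into `|I|² ≤ 0`.
    have hq : MemLalphaN α (f + g) N ((starRingEnd ℂ) I • expo j k) :=
      (memLalphaN_expo hα hF hj k).smul hα hF _
    have h1 := re_integral_nonpos_of_minimizer hα hf hg hA hh.1 hq.1
      fun ε => hmin _ (hh.add hα hF (hq.smul hα hF _))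
    simp_rw [hG, Pi.smul_apply, smul_dotProduct, expo_dotProduct, smul_eq_mul] at h1
    rw [integral_const_mul, ← hI, ← Complex.normSq_eq_conj_mul_self, Complex.ofReal_re] at h1
    exact Complex.normSq_eq_zero.1 (le_antisymm h1 (Complex.normSq_nonneg I)))
  exact ⟨c, hc⟩

lemma coefficient_expo {m : ℤ} (hm : m ∉ Icc (0 : ℤ) N) (l : Fin T) (j : Fin (N + 1))
    (k : Fin T) :
    ∫ θ, Complex.exp (-Complex.I * ((j : ℕ) : ℂ) * θ) * expo m l θ k ∂lebPi = 0 := by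
  by_cases hk : k = l
  · subst hk
    have h1 : ∀ θ : ℝ, Complex.exp (-Complex.I * ((j : ℕ) : ℂ) * θ) * expo m k θ k =
        Complex.exp (Complex.I * ((m - ((j : ℕ) : ℤ) : ℤ) : ℂ) * θ) := by
      intro θ
      rw [expo, Pi.single_eq_same, ← Complex.exp_add]
      congr 1
      push_cast
      ring
    simp_rw [h1]
    rw [integral_cexp_int, if_neg]
    intro h0
    apply hm
    have := j.2
    constructor <;> omega
  · simp [expo, Pi.single_eq_of_ne hk]

lemma coefficientSystem_trig {c : ℤ × Fin T →₀ ℂ}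
    (hc : c ∈ Finsupp.supported ℂ ℂ {p : ℤ × Fin T | p.1 ∉ Icc (0 : ℤ) N}) :
    CoefficientSystem N (trig c) := by
  intro j k
  have h1 : ∀ θ : ℝ, Complex.exp (-Complex.I * ((j : ℕ) : ℂ) * θ) * trig c θ k =
      ∑ p ∈ c.support, c p *
        (Complex.exp (-Complex.I * ((j : ℕ) : ℂ) * θ) * expo p.1 p.2 θ k) := by
    intro θ
    simp only [trig, Finsupp.linearCombination_apply, Finsupp.sum, Finset.sum_apply,
      Pi.smul_apply, smul_eq_mul, Finset.mul_sum]
    exact Finset.sum_congr rfl fun p _ => by ring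
  simp_rw [h1]
  rw [integral_finsetSum]
  · refine Finset.sum_eq_zero fun p hp => ?_
    rw [integral_const_mul, coefficient_expo (hc hp), mul_zero]
  · intro p _
    refine (integrable_of_continuous ?_).const_mul _
    have := (continuous_apply k).comp (continuous_expo p.1 p.2)
    exact Continuous.mul (by fun_prop) this

/-- The coefficients vanish for the approximating polynomials and are continuous in `L¹`, hence in
`L^α(F)`. -/
lemma MemLalphaN.coefficientSystem (hα : 1 < α) (hF : IsDensity α F) (hw : IsCoercive α F w)
    (hh : MemLalphaN α F N h) : CoefficientSystem N h := by
  obtain ⟨hm, p, hp, hlim⟩ := hh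
  choose c hc hcp using fun n => mem_span_expo.1 (hp n)
  obtain rfl : (fun n => trig (c n)) = p := funext hcp
  intro j k
  have hcm : ∀ n, AEStronglyMeasurable (trig (c n)) lebPi := fun n =>
    (continuous_trig (c n)).aestronglyMeasurable
  have hi := hw.integrable_of_mem hα hF hm
  have hic : ∀ n, Integrable (trig (c n)) lebPi := fun n =>
    integrable_of_continuous (continuous_trig (c n))
  have h1 := hw.tendsto_lintegral hα hF (fun n => hm.1.sub (hcm n)) hlim
  have h2 : ∀ n, ‖∫ θ, Complex.exp (-Complex.I * ((j : ℕ) : ℂ) * θ) * h θ k ∂lebPi‖ₑ ≤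
      ∫⁻ θ, ‖(h - trig (c n)) θ‖ₑ ∂lebPi := by
    intro n
    have e0 := coefficientSystem_trig (hc n) j k
    have e1 : Integrable (fun θ : ℝ =>
        Complex.exp (-Complex.I * ((j : ℕ) : ℂ) * θ) * h θ k) lebPi := by
      simp_rw [cexp_neg_eq]
      exact integrable_cexp_mul _ (hi.eval k)
    have e2 : Integrable (fun θ : ℝ =>
        Complex.exp (-Complex.I * ((j : ℕ) : ℂ) * θ) * trig (c n) θ k) lebPi := by
      simp_rw [cexp_neg_eq]
      exact integrable_cexp_mul _ ((hic n).eval k)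
    rw [← sub_zero (∫ θ, Complex.exp (-Complex.I * ((j : ℕ) : ℂ) * θ) * h θ k ∂lebPi), ← e0,
      ← integral_sub e1 e2]
    refine (enorm_integral_le_lintegral_enorm _).trans (lintegral_mono fun θ => ?_)
    rw [← mul_sub, enorm_mul, cexp_neg_eq, ← ofReal_norm, norm_cexp_int, ENNReal.ofReal_one,
      one_mul, ← ofReal_norm, ← ofReal_norm]
    exact ENNReal.ofReal_le_ofReal (norm_le_pi_norm ((h - trig (c n)) θ) k)
  have h3 := ge_of_tendsto' h1 h2
  rwa [nonpos_iff_eq_zero, enorm_eq_zero] at h3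

lemma sform_self_of_dim_one (hα : 1 < α) (hT : T = 1) (M : Matrix (Fin T) (Fin T) ℂ)
    (u : Fin T → ℂ) (k : Fin T) : sform α M u u = ((‖u k‖ ^ α : ℝ) : ℂ) * M k k := by
  subst hT
  rw [Subsingleton.elim k 0, ← mul_spow_self (by linarith : 0 < α)]
  simp [sform_eq_sum]
  ring

end Characteristic

section Functional

variable {Ω : Type*} {T N : ℕ}

/-- The coefficients of the functional `A_N ξ`. -/
def functionalCoeff (a : Fin (N + 1) → Fin T → ℂ) : ℤ × Fin T →₀ ℂ :=
  ∑ j : Fin (N + 1), ∑ k, Finsupp.single (((j : ℕ) : ℤ), k) (a j k)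

lemma lin_functionalCoeff (a : Fin (N + 1) → Fin T → ℂ) (ξ : ℤ → Fin T → Ω → ℂ) :
    lin ξ (functionalCoeff a) = functional a ξ := by
  funext ω
  simp [functionalCoeff, functional, lin, map_sum]

lemma trig_functionalCoeff (a : Fin (N + 1) → Fin T → ℂ) :
    trig (functionalCoeff a) = polyA a := by
  funext θ k
  simp [functionalCoeff, polyA, trig, map_sum, expo, Pi.single_apply]

end Functional

end HSaS

end

/-! ### The optimal estimate. -/

theorem mainTheorem1 {Ω : Type*} [MeasurableSpace Ω] (P : Measure Ω) [IsProbabilityMeasure P]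
    (α : ℝ) (hα₁ : 1 < α) (hα₂ : α ≤ 2) (T N : ℕ)
    (ξ η : ℤ → Fin T → Ω → ℂ) (Zξ Zη : ℝ → Fin T → Ω → ℂ)
    (f g : ℝ → Matrix (Fin T) (Fin T) ℂ)
    (hξ : IsHarmonizable α P ξ Zξ f) (hη : IsHarmonizable α P η Zη g)
    (hind : IndepFun (fun ω n k => ξ n k ω) (fun ω n k => η n k ω) P)
    (hmin : Minimality α f g)
    (a : Fin (N + 1) → Fin T → ℂ) :
    ∃ (Ahat : Ω → ℂ) (h : ℝ → Fin T → ℂ) (c : Fin (N + 1) → Fin T → ℂ),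
      -- `Ahat` is the optimal linear estimate, and it is almost surely unique
      IsProjection α P (observations N ξ η) (functional a ξ) Ahat ∧
      (∀ B, IsProjection α P (observations N ξ η) (functional a ξ) B → B =ᵐ[P] Ahat) ∧
      -- it is the stochastic integral of its spectral characteristic `h`
      MemLalphaN α (f + g) N h ∧
      IsStochIntegral α P (Zξ + Zη) (f + g) h Ahat ∧
      -- `h` and the coefficients satisfy the equation and the system, and are determined by them
      SpectralEquation α a c f g h ∧
      (∀ k, Integrable (fun θ => h θ k) lebPi) ∧ CoefficientSystem N h ∧
      (∀ h' c', MemLalpha α (f + g) h' → SpectralEquation α a c' f g h' →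
        CoefficientSystem N h' → h' =ᵐ[lebPi] h ∧ c' = c) ∧
      -- the error of the optimal estimate
      Integrable (fun θ => sform α (f θ) (polyA a θ - h θ) (polyA a θ - h θ)) lebPi ∧
      Integrable (fun θ => sform α (g θ) (h θ) (h θ)) lebPi ∧
      ((alphaNorm α P (functional a ξ - Ahat) ^ α : ℝ) : ℂ)
        = (∫ θ, sform α (f θ) (polyA a θ - h θ) (polyA a θ - h θ) ∂lebPi)
          + (∫ θ, sform α (g θ) (h θ) (h θ) ∂lebPi) ∧
      -- the error in dimension one
      (T = 1 → ∀ k : Fin T,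
        ((alphaNorm α P (functional a ξ - Ahat) ^ α : ℝ) : ℂ)
          = (∫ θ, ((‖polyA a θ k - h θ k‖ ^ α : ℝ) : ℂ) * f θ k k ∂lebPi)
            + (∫ θ, ((‖h θ k‖ ^ α : ℝ) : ℂ) * g θ k k ∂lebPi)) := by
  have hα0 : 0 < α := by linarith
  have M : SignalNoise α P ξ η Zξ Zη f g := ⟨hα₁, hα₂, hξ, hη, hind⟩
  have hf := hξ.isDensity hα₁ hα₂
  have hg := hη.isDensity hα₁ hα₂
  have hF := hf.add hg
  have hw := hmin.isCoercive hα₁ hF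
  have hA := memLalpha_of_continuous hα₁ hF (continuous_polyA a)
  -- The infimum is taken over trigonometric polynomials; the minimiser lies in their closure, and
  -- its optimality there is `hopt`.
  obtain ⟨h, p, hh, hp, hlim, hle⟩ := exists_minimizer hα₁ hf hg hw hA
    (Submodule.span ℂ {q | ∃ (j : ℤ) (k : Fin T), j ∉ Icc (0 : ℤ) N ∧ q = expo j k}) (by
      intro q hq
      obtain ⟨c, -, rfl⟩ := mem_span_expo.1 hq
      exact memLalpha_of_continuous hα₁ hF (continuous_trig c))
  have hhN : MemLalphaN α (f + g) N h := ⟨hh, p, hp, hlim⟩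
  have hopt : ∀ h', MemLalphaN α (f + g) N h' →
      errorPow α f g (polyA a) h ≤ errorPow α f g (polyA a) h' := fun h' hh' =>
    hh'.le_errorPow hα₁ hf hg hA fun c hc => hle _ (mem_span_expo.2 ⟨c, hc, rfl⟩)
  choose b hb hbp using fun n => mem_span_expo.1 (hp n)
  obtain rfl : (fun n => trig (b n)) = p := funext hbp
  obtain ⟨Ahat, b', hAhat⟩ := M.exists_corresponds hh hb hlim
  have herr : ∀ {h' Y c'}, Corresponds α P ξ η f g {p : ℤ × Fin T | p.1 ∉ Icc (0 : ℤ) N} h' Y c' →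
      IsSaS α P (functional a ξ - Y) (errorPow α f g (polyA a) h').toReal := by
    intro h' Y c' hc'
    rw [← lin_functionalCoeff, ← trig_functionalCoeff]
    exact hc'.isSaS_error M _
  have hproj : IsProjection α P (observations N ξ η) (functional a ξ) Ahat := by
    refine ⟨hAhat.memClosedSpan M, (herr hAhat).jointlySaS hα0, fun Y hY => ?_⟩
    -- A competitor in the closed span has its own characteristic, so distances of random variables
    -- are compared through `errorPow`.
    obtain ⟨h', c', hc'⟩ := M.exists_corresponds_of_memClosedSpan hw hY
    rw [(herr hAhat).alphaNorm_eq hα0, (herr hc').alphaNorm_eq hα0]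
    refine Real.rpow_le_rpow ENNReal.toReal_nonneg (ENNReal.toReal_mono ?_ ?_) (by positivity)
    · exact (errorPow_lt_top hα₁ hf hg hA hc'.mem).ne
    · exact hopt _ hc'.memLalphaN
  obtain ⟨c, hc⟩ := exists_spectralEquation hα₁ hf hg a hhN hopt
  have hsys := hhN.coefficientSystem hα₁ hF hw
  have hu : MemLalpha α f (polyA a - h) := (hA.sub hα₁ hF hh).left hα₁ hf hg
  have hv : MemLalpha α g h := hh.right hα₁ hf hg
  have hval : ((alphaNorm α P (functional a ξ - Ahat) ^ α : ℝ) : ℂ)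
        = (∫ θ, sform α (f θ) (polyA a θ - h θ) (polyA a θ - h θ) ∂lebPi)
          + (∫ θ, sform α (g θ) (h θ) (h θ) ∂lebPi) := by
    have e1 := integral_sform_self hα₁ hf hu
    have e2 := integral_sform_self hα₁ hg hv
    simp only [Pi.sub_apply] at e1
    rw [e1, e2, (herr hAhat).alphaNorm_rpow hα0, errorPow, ENNReal.toReal_add hu.2.ne hv.2.ne,
      Complex.ofReal_add]
  refine ⟨Ahat, h, c, hproj, fun B hB => ?_, hhN, hAhat.isStochIntegral M, hc,
    fun k => (hw.integrable_of_mem hα₁ hF hh).eval k, hsys, fun h' c' hh' he' hs' =>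
      spectralEquation_unique hα₁ hf hg hw hh hh' hc he' hsys hs',
    integrable_sform hα₁ hf hu hu, integrable_sform hα₁ hg hv hv, hval, fun hT k => ?_⟩
  · obtain ⟨h', c', hc'⟩ := M.exists_corresponds_of_memClosedSpan hw hB.mem
    have h1 := hB.le Ahat hproj.mem
    rw [(herr hAhat).alphaNorm_eq hα0, (herr hc').alphaNorm_eq hα0,
      Real.rpow_le_rpow_iff ENNReal.toReal_nonneg ENNReal.toReal_nonneg (by positivity),
      ENNReal.toReal_le_toReal (errorPow_lt_top hα₁ hf hg hA hc'.mem).ne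
        (errorPow_lt_top hα₁ hf hg hA hh).ne] at h1
    -- The midpoint of the two characteristics lies in `L_N^α(f+g)` and does no better than `h`, so
    -- uniform convexity identifies them, and with them the estimates.
    have h2 := minimizer_unique hα₁ hf hg hA hh hc'.mem h1
      (hopt _ ((hhN.add hα₁ hF hc'.memLalphaN).smul hα₁ hF _))
    exact hAhat.ae_eq M hc' (hw.ae_eq_of_lpow_eq_zero hα₁ hF hh.1 hc'.mem.1 h2).symm
  · rw [hval]
    simp_rw [sform_self_of_dim_one hα₁ hT _ _ k, Pi.sub_apply]
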